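/- Let $\Gamma$ be a groupoid (a small category in which all morphisms are invertible) with set of objects $\Gamma_0$; each $e\in\Gamma_0$ is identified with its identity morphism, and $d(\gamma)$, $r(\gamma)$ are the domain and the range of $\gamma\in\Gamma$. Rings are associative, not necessarily unital. A $\Gamma$-graded ring $R=\bigoplus_{\gamma}R_\gamma$ satisfies $R_\gamma R_\delta\subseteq R_{\gamma\delta}$ (and $R_\gamma R_\delta=0$ if $\gamma\delta$ is not defined) and is assumed object unital: each $R_e$, $e\in\Gamma_0$, has an identity $1_e$, and $1_{r(\gamma)}x=x=x1_{d(\gamma)}$ for $x\in R_\gamma$. A $\Gamma$-graded right module $V=\bigoplus_\gamma V_\gamma$ satisfies $V_\gamma R_\delta\subseteq V_{\gamma\delta}$ (or $=0$ if $\gamma\delta$ is not defined) and is assumed unital: $VR=V$. Put $V(e)=\bigoplus_{r(\gamma)=e}V_\gamma$, $R(e)=\bigoplus_{r(\gamma)=e}R_\gamma$, $(e)R=\bigoplus_{d(\gamma)=e}R_\gamma$, $\Gamma_0'(R)=\{e: R(e)\ne0\}$. A gr-isomorphism $\cong_{gr}$ of graded rings is a ring isomorphism that preserves the homogeneous components and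 the elements $1_e$. $R$ is right (left) $\Gamma_0$-artinian if for each $e\in\Gamma_0$ the module $R(e)$ (respectively $(e)R$) satisfies the descending chain condition on graded right (left) submodules; right (left) gr-semisimple if it is a sum of graded right (left) ideals that are gr-simple (nonzero, with no proper nonzero graded submodule); gr-simple if $R\neq0$ and its only graded two-sided ideals are $0$ and $R$; gr-prime if $IJ\ne0$ for all nonzero graded ideals $I,J$; a gr-division ring if $R\ne0$ and each nonzero $x\in R_\gamma$ has an inverse $y\in R_{\gamma^{-1}}$, $xy=1_{r(\gamma)}$, $yx=1_{d(\gamma)}$. Let $I$ be a nonempty set. A sequence $\overline\Sigma=(\Sigma_i)_{i\in I}$ of nonempty subsets of $\Gamma$ is $d$-finite if for each $e\in\Gamma_0$ only finitely many $\Sigma_i$ contain an element with domain $e$. It is matricial for $D$ if it is $d$-finite and, for each $i$, distinct elements of $\Sigma_i$ have distinct domains and distinct ranges, and all these ranges lie in $\Gamma'_0(D)$. Then $\mathbb M_I(D)(\overline\Sigma)=\bigoplus_\gamma \mathbb M_I(D)(\overline\Sigma)_\gamma$, where $\mathbb M_I(D)(\overline\Sigma)_\gamma$ consists of the $I\times I$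 matrices $(a_{ij})$ over $D$ with finitely many nonzero entries such that $a_{ij}\in D_{\sigma\gamma\tau^{-1}}$ if there are (unique) $\sigma\in\Sigma_i$, $\tau\in\Sigma_j$ with $d(\sigma)=r(\gamma)$, $d(\tau)=d(\gamma)$, and $a_{ij}=0$ otherwise. It is a $\Gamma$-graded ring under matrix multiplication. A sequence $\overline\sigma=(\sigma_i)_{i\in I}$ in $\Gamma$ is identified with $(\{\sigma_i\})_{i\in I}$; if $D$ is a gr-division ring with $\operatorname{supp}(D)=\{\gamma: D_\gamma\neq 0\}\subseteq e\Gamma e$, every $d$-finite $\overline\sigma\in(e\Gamma)^I$ (that is, $r(\sigma_i)=e$ for all $i$) is matricial for $D$. For a $\Gamma$-graded right $D$-module $V$, $\mathrm{END}_D(V)=\bigoplus_\gamma \mathrm{END}_D(V)_\gamma$, where $\mathrm{END}_D(V)_\gamma$ consists of the $D$-endomorphisms $g$ with $g(V_\sigma)\subseteq V_{\gamma\sigma}$ ($=0$ if $\gamma\sigma$ is not defined). $V$ is $\Gamma_0$-finite dimensional over a gr-division ring $D$ if each $V(e)$ has a finite pseudo-basis, that is, a finite sequence of homogeneous generators $x_i\in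 V_{\gamma_i}$ such that $\sum x_ia_i=0$ with $a_i\in 1_{d(\gamma_i)}D$ forces all $a_i=0$. **Theorem.** Let $R$ be an (object unital) $\Gamma$-graded ring. The following statements are equivalent. 1. $R$ is gr-simple and right $\Gamma_0$-artinian. 2. $R$ is gr-simple and left $\Gamma_0$-artinian. 3. There are $e\in\Gamma_0$, a $\Gamma$-graded gr-division ring $D$ with $\operatorname{supp}(D)\subseteq e\Gamma e$, a nonempty set $I$ and a $d$-finite sequence $\overline\sigma\in(e\Gamma)^I$ such that $R\cong_{gr}\mathbb M_I(D)(\overline\sigma)$. 4. There are a gr-prime $\Gamma$-graded gr-division ring $D$, a nonempty set $I$ and a matricial sequence $\overline\Sigma=(\Sigma_i)_{i\in I}$ for $D$ such that $R\cong_{gr}\mathbb M_I(D)(\overline\Sigma)$. 5. There are $e\in\Gamma_0$, a $\Gamma$-graded gr-division ring $D$ with $\operatorname{supp}(D)\subseteq e\Gamma e$ and a nonzero $\Gamma_0$-finite dimensional $\Gamma$-graded right $D$-module $V$ such that $R\cong_{gr}\mathrm{END}_D(V)$. 6. There are a gr-prime $\Gamma$-graded gr-division ring $D$ and a nonzero $\Gamma_0$-finite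 dimensional $\Gamma$-graded right $D$-module $V$ such that $R\cong_{gr}\mathrm{END}_D(V)$. In particular, a gr-simple ring $R$ is right $\Gamma_0$-artinian if and only if it is left $\Gamma_0$-artinian. Moreover, every $\Gamma$-graded ring $R$ is right gr-semisimple if and only if it is left gr-semisimple. -/

import Mathlib

open CategoryTheory

universe u v w

namespace GroupoidGraded

/-! ### Families of additive subgroups that form a direct sum -/

section Sums

variable {ι : Type*} {V W : Type*} [AddCommGroup V] [AddCommGroup W]

theorem addHom_ext_of_iSup_eq_top {A : ι → AddSubgroup V} (hA : iSup A = ⊤) {f g : V →+ W}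
    (h : ∀ i, ∀ x ∈ A i, f x = g x) : f = g := by
  have h1 : iSup A ≤ f.eqLocus g := iSup_le fun i x hx => h i x hx
  ext x
  have : x ∈ iSup A := by rw [hA]; trivial
  exact h1 this

theorem iSupIndep_of_separating {A : ι → AddSubgroup V}
    (h : ∀ i, ∀ x ∈ A i, x ≠ 0 → ∃ p : V →+ W, p x ≠ 0 ∧ ∀ j, j ≠ i → ∀ y ∈ A j, p y = 0) :
    iSupIndep A := by
  intro i
  rw [disjoint_iff_inf_le]
  rintro x ⟨hx1, hx2⟩
  by_contra hx
  have hx0 : x ≠ 0 := fun h0 => hx (by rw [h0]; exact zero_mem _)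
  obtain ⟨p, hp, hq⟩ := h i x hx1 hx0
  have h1 : (⨆ (j) (_ : j ≠ i), A j) ≤ p.ker := by
    refine iSup_le fun j => iSup_le fun hj y hy => ?_
    exact hq j hj y hy
  exact hp (h1 hx2)

open Classical in
theorem isInternal_of_indep {A : ι → AddSubgroup V} (h : iSupIndep A) (ht : iSup A = ⊤) :
    DirectSum.IsInternal A := by
  have hinj := h.dfinsuppSumAddHom_injective
  refine ⟨hinj, ?_⟩
  have h2 : (DirectSum.coeAddMonoidHom A).range = ⊤ := by
    rw [eq_top_iff, ← ht]
    refine iSup_le fun i x hx => ?_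
    exact ⟨DirectSum.of (fun i => A i) i ⟨x, hx⟩, by simp⟩
  exact AddMonoidHom.range_eq_top.1 h2

open Classical in
theorem iSup_eq_top_of_isInternal {A : ι → AddSubgroup V} (h : DirectSum.IsInternal A) :
    iSup A = ⊤ := by
  rw [eq_top_iff]
  intro x _
  obtain ⟨y, rfl⟩ := h.2 x
  induction y using DirectSum.induction_on with
  | zero => simp
  | of i x =>
    rw [DirectSum.coeAddMonoidHom_of]
    exact AddSubgroup.mem_iSup_of_mem i x.2
  | add x y hx hy =>
    rw [map_add]
    exact add_mem (hx trivial) (hy trivial)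

open Classical in
/-- The projection of an internal direct sum `⨁ i, A i` onto the sum of the `A i` with `P i`. -/
noncomputable def partProj {A : ι → AddSubgroup V} (h : DirectSum.IsInternal A) (P : ι → Prop) :
    V →+ V :=
  (DirectSum.toAddMonoid fun i => if P i then (A i).subtype else 0).comp
    (AddEquiv.ofBijective (DirectSum.coeAddMonoidHom A) h).symm.toAddMonoidHom

open Classical in
theorem partProj_apply {A : ι → AddSubgroup V} (h : DirectSum.IsInternal A) (P : ι → Prop)
    {i : ι} {x : V} (hx : x ∈ A i) : partProj h P x = if P i then x else 0 := by
  have h1 : (AddEquiv.ofBijective (DirectSum.coeAddMonoidHom A) h).symm x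
      = DirectSum.of (fun i => A i) i ⟨x, hx⟩ := by
    rw [AddEquiv.symm_apply_eq]
    exact (DirectSum.coeAddMonoidHom_of A i ⟨x, hx⟩).symm
  have h2 : partProj h P x = (DirectSum.toAddMonoid fun i => if P i then (A i).subtype else 0)
      ((AddEquiv.ofBijective (DirectSum.coeAddMonoidHom A) h).symm x) := rfl
  rw [h2, h1, DirectSum.toAddMonoid_of]
  split_ifs <;> rfl

end Sums

/-! ### Graded rings

A groupoid `Γ` with set of objects `G` is a type `G` with an instance `Groupoid G`.  A morphism
`γ : a ⟶ b` has domain `d(γ) = a` and range `r(γ) = b`.  The product `γδ` of `γ : b ⟶ c` and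
`δ : a ⟶ b` is `δ ≫ γ`.  The identity of the object `e` is `𝟙 e`. -/

/-- The set of all morphisms of the groupoid: `σ.left` is `d(σ)` and `σ.right` is `r(σ)`. -/
abbrev Mor (G : Type w) [Groupoid.{v} G] := Quiver.Total G

open Classical in
/-- The structure of an object unital `Γ`-graded ring on a ring `R`
(associative, not necessarily unital). -/
structure GrRing (G : Type w) [Groupoid.{v} G] (R : Type u) [NonUnitalRing R] where
  /-- the homogeneous component of degree `γ` -/
  comp : ∀ ⦃a b : G⦄, (a ⟶ b) → AddSubgroup R
  isInternal : DirectSum.IsInternal fun γ : Mor G => comp γ.hom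
  mul_mem : ∀ ⦃a b c : G⦄ (γ : b ⟶ c) (δ : a ⟶ b), ∀ x ∈ comp γ, ∀ y ∈ comp δ,
    x * y ∈ comp (δ ≫ γ)
  mul_eq_zero : ∀ ⦃a b b' c : G⦄ (γ : b' ⟶ c) (δ : a ⟶ b), b' ≠ b →
    ∀ x ∈ comp γ, ∀ y ∈ comp δ, x * y = 0
  /-- the identity element `1_e` of the ring `R_e` -/
  one : G → R
  one_mem : ∀ e : G, one e ∈ comp (𝟙 e)
  one_mul : ∀ ⦃a b : G⦄ (γ : a ⟶ b), ∀ x ∈ comp γ, one b * x = x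
  mul_one : ∀ ⦃a b : G⦄ (γ : a ⟶ b), ∀ x ∈ comp γ, x * one a = x

/-- `R ≅_gr S`: there is a bijective ring homomorphism that respects the homogeneous components
and the elements `1_e`. -/
def GrIsomorphic {G : Type w} [Groupoid.{v} G] {R S : Type*} [NonUnitalRing R] [NonUnitalRing S]
    (𝒜 : GrRing G R) (ℬ : GrRing G S) : Prop :=
  ∃ φ : R ≃+* S, (∀ ⦃a b : G⦄ (γ : a ⟶ b), ∀ x ∈ 𝒜.comp γ, φ x ∈ ℬ.comp γ) ∧
    ∀ e : G, φ (𝒜.one e) = ℬ.one e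

namespace GrRing

variable {G : Type w} [Groupoid.{v} G] {R : Type u} [NonUnitalRing R] (𝒜 : GrRing G R)

/-- An additive subgroup `I` with `I = ⨁ γ, I ∩ R_γ`. -/
def IsHomogeneous (I : AddSubgroup R) : Prop :=
  I ≤ ⨆ γ : Mor G, I ⊓ 𝒜.comp γ.hom

/-- Graded right ideals, that is, graded submodules of `R_R`. -/
def IsGradedRightIdeal (I : AddSubgroup R) : Prop :=
  𝒜.IsHomogeneous I ∧ ∀ x ∈ I, ∀ r : R, x * r ∈ I

/-- Graded left ideals, that is, graded submodules of `_R R`. -/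
def IsGradedLeftIdeal (I : AddSubgroup R) : Prop :=
  𝒜.IsHomogeneous I ∧ ∀ x ∈ I, ∀ r : R, r * x ∈ I

/-- Graded (two-sided) ideals. -/
def IsGradedIdeal (I : AddSubgroup R) : Prop :=
  𝒜.IsGradedRightIdeal I ∧ 𝒜.IsGradedLeftIdeal I

/-- The graded right ideal `R(e)`, the sum of the components `R_γ` with `r(γ) = e`. -/
def rightPart (e : G) : AddSubgroup R := ⨆ (a : G) (γ : a ⟶ e), 𝒜.comp γ

/-- The graded left ideal `(e)R`, the sum of the components `R_γ` with `d(γ) = e`. -/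
def leftPart (e : G) : AddSubgroup R := ⨆ (b : G) (γ : e ⟶ b), 𝒜.comp γ

/-- `Γ'₀(R)`, the set of the objects `e` with `R(e) ≠ 0`. -/
def objSupport : Set G := {e | 𝒜.rightPart e ≠ ⊥}

/-- Every `R(e)` satisfies the descending chain condition on graded submodules. -/
def IsRightArtinian : Prop :=
  ∀ (e : G) (I : ℕ → AddSubgroup R), (∀ n, 𝒜.IsGradedRightIdeal (I n) ∧ I n ≤ 𝒜.rightPart e) →
    Antitone I → ∃ n, ∀ m, n ≤ m → I m = I n

/-- Every `(e)R` satisfies the descending chain condition on graded submodules. -/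
def IsLeftArtinian : Prop :=
  ∀ (e : G) (I : ℕ → AddSubgroup R), (∀ n, 𝒜.IsGradedLeftIdeal (I n) ∧ I n ≤ 𝒜.leftPart e) →
    Antitone I → ∃ n, ∀ m, n ≤ m → I m = I n

/-- Graded right ideals that are gr-simple as graded right modules. -/
def IsGrSimpleRightIdeal (S : AddSubgroup R) : Prop :=
  𝒜.IsGradedRightIdeal S ∧ S ≠ ⊥ ∧ ∀ I, 𝒜.IsGradedRightIdeal I → I ≤ S → I = ⊥ ∨ I = S

/-- Graded left ideals that are gr-simple as graded left modules. -/
def IsGrSimpleLeftIdeal (S : AddSubgroup R) : Prop :=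
  𝒜.IsGradedLeftIdeal S ∧ S ≠ ⊥ ∧ ∀ I, 𝒜.IsGradedLeftIdeal I → I ≤ S → I = ⊥ ∨ I = S

/-- `R_R` is a sum of gr-simple graded submodules. -/
def IsRightGrSemisimple : Prop := sSup {S | 𝒜.IsGrSimpleRightIdeal S} = ⊤

/-- `_R R` is a sum of gr-simple graded submodules. -/
def IsLeftGrSemisimple : Prop := sSup {S | 𝒜.IsGrSimpleLeftIdeal S} = ⊤

/-- `R ≠ 0` and the only graded ideals are `0` and `R`. -/
def IsGrSimple : Prop :=
  Nontrivial R ∧ ∀ I, 𝒜.IsGradedIdeal I → I = ⊥ ∨ I = ⊤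

/-- `IJ ≠ 0` for all nonzero graded ideals `I` and `J`. -/
def IsGrPrime : Prop :=
  ∀ I J, 𝒜.IsGradedIdeal I → 𝒜.IsGradedIdeal J → I ≠ ⊥ → J ≠ ⊥ →
    ∃ x ∈ I, ∃ y ∈ J, x * y ≠ 0

/-- `R ≠ 0` and every nonzero homogeneous element is invertible. -/
def IsGrDivision : Prop :=
  Nontrivial R ∧ ∀ ⦃a b : G⦄ (γ : a ⟶ b), ∀ x ∈ 𝒜.comp γ, x ≠ 0 →
    ∃ y ∈ 𝒜.comp (Groupoid.inv γ), x * y = 𝒜.one b ∧ y * x = 𝒜.one a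

/-- `supp(R) ⊆ eΓe`. -/
def SuppIn (e : G) : Prop :=
  ∀ ⦃a b : G⦄ (γ : a ⟶ b), 𝒜.comp γ ≠ ⊥ → a = e ∧ b = e

end GrRing

/-! ### The graded subring generated by a multiplicative family of components -/

section OfFamily

variable {G : Type w} [Groupoid.{v} G] {X : Type u} [NonUnitalRing X]

theorem mul_mem_iSup_family (A : ∀ ⦃a b : G⦄, (a ⟶ b) → AddSubgroup X)
    (hmul : ∀ ⦃a b c : G⦄ (γ : b ⟶ c) (δ : a ⟶ b), ∀ x ∈ A γ, ∀ y ∈ A δ, x * y ∈ A (δ ≫ γ))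
    (hzero : ∀ ⦃a b b' c : G⦄ (γ : b' ⟶ c) (δ : a ⟶ b), b' ≠ b →
      ∀ x ∈ A γ, ∀ y ∈ A δ, x * y = 0)
    {x y : X} (hx : x ∈ ⨆ γ : Mor G, A γ.hom)
    (hy : y ∈ ⨆ γ : Mor G, A γ.hom) : x * y ∈ ⨆ γ : Mor G, A γ.hom := by
  induction hx using AddSubgroup.iSup_induction' with
  | hp γ x hx =>
    induction hy using AddSubgroup.iSup_induction' with
    | hp δ y hy =>
      obtain ⟨b', c, γ⟩ := γ
      obtain ⟨a, b, δ⟩ := δ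
      by_cases h : b' = b
      · subst h
        exact AddSubgroup.mem_iSup_of_mem (⟨_, _, δ ≫ γ⟩ : Mor G) (hmul γ δ x hx y hy)
      · rw [hzero γ δ h x hx y hy]
        exact zero_mem _
    | h1 => rw [mul_zero]; exact zero_mem _
    | hadd y z _ _ h1 h2 => rw [mul_add]; exact add_mem h1 h2
  | h1 => rw [zero_mul]; exact zero_mem _
  | hadd y z _ _ h1 h2 => rw [add_mul]; exact add_mem h1 h2

/-- The subring `∑ γ, A γ` of `X`. -/
def familyRing (A : ∀ ⦃a b : G⦄, (a ⟶ b) → AddSubgroup X)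
    (hmul : ∀ ⦃a b c : G⦄ (γ : b ⟶ c) (δ : a ⟶ b), ∀ x ∈ A γ, ∀ y ∈ A δ, x * y ∈ A (δ ≫ γ))
    (hzero : ∀ ⦃a b b' c : G⦄ (γ : b' ⟶ c) (δ : a ⟶ b), b' ≠ b →
      ∀ x ∈ A γ, ∀ y ∈ A δ, x * y = 0) : NonUnitalSubring X :=
  { (⨆ γ : Mor G, A γ.hom : AddSubgroup X) with
    mul_mem' := fun hx hy => mul_mem_iSup_family A hmul hzero hx hy }

/-- The component of degree `γ` of the subring `∑ γ, A γ` of `X` is `A γ`. -/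
def familyComp (A : ∀ ⦃a b : G⦄, (a ⟶ b) → AddSubgroup X) (S : NonUnitalSubring X)
    ⦃a b : G⦄ (γ : a ⟶ b) : AddSubgroup S where
  carrier := {x | (x : X) ∈ A γ}
  zero_mem' := zero_mem (A γ)
  add_mem' := fun hx hy => add_mem (S := AddSubgroup X) hx hy
  neg_mem' := fun hx => neg_mem (S := AddSubgroup X) hx

open Classical in
theorem isInternal_familyComp (A : ∀ ⦃a b : G⦄, (a ⟶ b) → AddSubgroup X)
    (S : NonUnitalSubring X) (hS : ∀ x, x ∈ S ↔ x ∈ ⨆ γ : Mor G, A γ.hom)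
    (hind : iSupIndep fun γ : Mor G => A γ.hom) :
    DirectSum.IsInternal fun γ : Mor G => familyComp A S γ.hom := by
  have hcoe : ∀ (P : Mor G → Prop) (x : S), x ∈ (⨆ (γ : Mor G) (_ : P γ), familyComp A S γ.hom) →
      (x : X) ∈ ⨆ (γ : Mor G) (_ : P γ), A γ.hom := by
    intro P x hx
    have h1 : (⨆ (γ : Mor G) (_ : P γ), familyComp A S γ.hom) ≤
        (⨆ (γ : Mor G) (_ : P γ), A γ.hom).comap
          (AddMonoidHom.mk' (fun x : S => (x : X)) fun _ _ => rfl) := by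
      refine iSup_le fun γ => iSup_le fun hγ y hy => ?_
      exact AddSubgroup.mem_iSup_of_mem γ (AddSubgroup.mem_iSup_of_mem hγ hy)
    exact h1 hx
  apply isInternal_of_indep
  · intro γ
    rw [disjoint_iff_inf_le]
    rintro x ⟨hx1, hx2⟩
    have h := (disjoint_iff_inf_le.1 (hind γ)) ⟨hx1, hcoe _ x hx2⟩
    exact Subtype.ext h
  · rw [eq_top_iff]
    rintro ⟨x, hx⟩ _
    have hx' := (hS x).1 hx
    induction hx' using AddSubgroup.iSup_induction' with
    | hp γ x hxγ => exact AddSubgroup.mem_iSup_of_mem γ hxγ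
    | h1 => exact zero_mem _
    | hadd y z hy hz h1 h2 =>
      exact add_mem (h1 ((hS y).2 hy) trivial) (h2 ((hS z).2 hz) trivial)

/-- The subring `∑ γ, A γ` of `X`, graded by the subgroups `A γ`. -/
def familyGrading (A : ∀ ⦃a b : G⦄, (a ⟶ b) → AddSubgroup X)
    (hmul : ∀ ⦃a b c : G⦄ (γ : b ⟶ c) (δ : a ⟶ b), ∀ x ∈ A γ, ∀ y ∈ A δ, x * y ∈ A (δ ≫ γ))
    (hzero : ∀ ⦃a b b' c : G⦄ (γ : b' ⟶ c) (δ : a ⟶ b), b' ≠ b →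
      ∀ x ∈ A γ, ∀ y ∈ A δ, x * y = 0)
    (hind : iSupIndep fun γ : Mor G => A γ.hom) (one : G → X)
    (hone : ∀ e : G, one e ∈ A (𝟙 e))
    (hone_mul : ∀ ⦃a b : G⦄ (γ : a ⟶ b), ∀ x ∈ A γ, one b * x = x)
    (hmul_one : ∀ ⦃a b : G⦄ (γ : a ⟶ b), ∀ x ∈ A γ, x * one a = x) :
    GrRing G (familyRing A hmul hzero) where
  comp := familyComp A (familyRing A hmul hzero)
  isInternal := isInternal_familyComp A _ (fun _ => Iff.rfl) hind
  mul_mem _ _ _ γ δ _ hx _ hy := hmul γ δ _ hx _ hy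
  mul_eq_zero _ _ _ _ γ δ h _ hx _ hy := Subtype.ext (hzero γ δ h _ hx _ hy)
  one e := ⟨one e, AddSubgroup.mem_iSup_of_mem (⟨_, _, 𝟙 e⟩ : Mor G) (hone e)⟩
  one_mem e := hone e
  one_mul _ _ γ _ hx := Subtype.ext (hone_mul γ _ hx)
  mul_one _ _ γ _ hx := Subtype.ext (hmul_one γ _ hx)

end OfFamily

/-! ### Matrix rings -/

section FinMatrices

variable {I : Type*} {R : Type*} [NonUnitalRing R]

/-- The additive group `M_I(R)` of the `I × I` matrices with entries in `R` that have only
finitely many nonzero entries. -/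
def finMatrices (I R : Type*) [NonUnitalRing R] : AddSubgroup (Matrix I I R) where
  carrier := {A | {p : I × I | A p.1 p.2 ≠ 0}.Finite}
  zero_mem' := by simp
  add_mem' := by
    intro A B hA hB
    refine (hA.union hB).subset fun p hp => ?_
    by_contra h
    simp only [Set.mem_union, Set.mem_ofPred_eq, not_or, not_not] at h
    exact hp (by rw [Matrix.add_apply, h.1, h.2, add_zero])
  neg_mem' := by
    intro A hA
    refine Set.Finite.subset hA fun p hp h => hp ?_
    rw [Matrix.neg_apply, h, neg_zero]

/-- The type of the elements of `M_I(R)`. -/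
abbrev FinMatrix (I R : Type*) [NonUnitalRing R] : Type _ := finMatrices I R

/-- A finite set of indices outside of which all rows and columns of `A` vanish. -/
theorem FinMatrix.exists_finset (A : FinMatrix I R) :
    ∃ s : Finset I, ∀ i j, A.1 i j ≠ 0 → i ∈ s ∧ j ∈ s := by
  classical
  refine ⟨A.2.toFinset.image Prod.fst ∪ A.2.toFinset.image Prod.snd, fun i j h => ?_⟩
  have hm : (i, j) ∈ A.2.toFinset := (Set.Finite.mem_toFinset _).2 h
  exact ⟨Finset.mem_union_left _ (Finset.mem_image_of_mem Prod.fst hm),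
    Finset.mem_union_right _ (Finset.mem_image_of_mem Prod.snd hm)⟩

theorem FinMatrix.finsum_mul_eq (A B : Matrix I I R) (s : Finset I)
    (hs : ∀ i j, A i j ≠ 0 → i ∈ s ∧ j ∈ s) (i j : I) :
    ∑ᶠ k, A i k * B k j = ∑ k ∈ s, A i k * B k j := by
  refine finsum_eq_sum_of_support_subset _ fun k hk => ?_
  have : A i k ≠ 0 := fun h => hk (by simp [h])
  exact (hs i k this).2

/-- The usual product of matrices, `(AB)_{ij} = ∑_k a_{ik} b_{kj}`. -/
noncomputable instance : Mul (FinMatrix I R) where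
  mul A B := ⟨fun i j => ∑ᶠ k, A.1 i k * B.1 k j, by
    obtain ⟨s, hs⟩ := A.exists_finset
    obtain ⟨t, ht⟩ := B.exists_finset
    refine Set.Finite.subset (s ×ˢ t).finite_toSet fun p hp => ?_
    have hp' : ∑ᶠ k, A.1 p.1 k * B.1 k p.2 ≠ 0 := hp
    obtain ⟨k, hk⟩ : ∃ k, A.1 p.1 k * B.1 k p.2 ≠ 0 := by
      by_contra! h
      exact hp' (by simp only [h, finsum_zero])
    have h1 : A.1 p.1 k ≠ 0 := fun h => hk (by rw [h, zero_mul])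
    have h2 : B.1 k p.2 ≠ 0 := fun h => hk (by rw [h, mul_zero])
    simp only [Finset.coe_product, Set.mem_prod]
    exact ⟨(hs _ _ h1).1, (ht _ _ h2).2⟩⟩

theorem FinMatrix.mul_apply (A B : FinMatrix I R) (i j : I) :
    (A * B).1 i j = ∑ᶠ k, A.1 i k * B.1 k j := rfl

theorem FinMatrix.mul_apply_finset (A B : FinMatrix I R) {s : Finset I}
    (hs : ∀ i j, A.1 i j ≠ 0 → i ∈ s ∧ j ∈ s) (i j : I) :
    (A * B).1 i j = ∑ k ∈ s, A.1 i k * B.1 k j :=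
  FinMatrix.finsum_mul_eq A.1 B.1 s hs i j

theorem FinMatrix.mul_apply_finset' (A B : FinMatrix I R) {s : Finset I}
    (hs : ∀ i j, B.1 i j ≠ 0 → i ∈ s ∧ j ∈ s) (i j : I) :
    (A * B).1 i j = ∑ k ∈ s, A.1 i k * B.1 k j := by
  refine finsum_eq_sum_of_support_subset _ fun k hk => ?_
  have : B.1 k j ≠ 0 := fun h => hk (by simp [h])
  exact (hs k j this).1

noncomputable instance : NonUnitalRing (FinMatrix I R) where
  left_distrib A B C := by
    obtain ⟨s, hs⟩ := A.exists_finset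
    ext i j
    change (A * (B + C)).1 i j = (A * B).1 i j + (A * C).1 i j
    rw [A.mul_apply_finset _ hs, A.mul_apply_finset _ hs, A.mul_apply_finset _ hs,
      ← Finset.sum_add_distrib]
    exact Finset.sum_congr rfl fun k _ => mul_add _ _ _
  right_distrib A B C := by
    obtain ⟨s, hs⟩ := C.exists_finset
    ext i j
    change ((A + B) * C).1 i j = (A * C).1 i j + (B * C).1 i j
    rw [FinMatrix.mul_apply_finset' _ C hs, FinMatrix.mul_apply_finset' _ C hs,
      FinMatrix.mul_apply_finset' _ C hs, ← Finset.sum_add_distrib]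
    exact Finset.sum_congr rfl fun k _ => add_mul _ _ _
  zero_mul A := by
    ext i j
    rw [FinMatrix.mul_apply]
    simp
  mul_zero A := by
    ext i j
    rw [FinMatrix.mul_apply]
    simp
  mul_assoc A B C := by
    obtain ⟨s, hs⟩ := A.exists_finset
    obtain ⟨t, ht⟩ := C.exists_finset
    ext i j
    rw [FinMatrix.mul_apply_finset' (A * B) C ht, FinMatrix.mul_apply_finset A (B * C) hs]
    have h1 : ∀ l, (A * B).1 i l * C.1 l j = ∑ k ∈ s, A.1 i k * B.1 k l * C.1 l j := by
      intro l
      rw [FinMatrix.mul_apply_finset A B hs, Finset.sum_mul]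
    have h2 : ∀ k, A.1 i k * (B * C).1 k j = ∑ l ∈ t, A.1 i k * B.1 k l * C.1 l j := by
      intro k
      rw [FinMatrix.mul_apply_finset' B C ht, Finset.mul_sum]
      exact Finset.sum_congr rfl fun l _ => (mul_assoc _ _ _).symm
    simp only [h1, h2]
    exact Finset.sum_comm

end FinMatrices

section GradedMatrices

variable {G : Type w} [Groupoid.{v} G]

/-- For each object `e` there is at most one `σ ∈ S` with `d(σ) = e`. -/
def DUnique (S : Set (Mor G)) : Prop :=
  ∀ σ ∈ S, ∀ τ ∈ S, σ.left = τ.left → σ = τ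

/-- The ranges of the elements of `S` lie in `Γ'₀(R)`, and for each object `e` in `Γ'₀(R)` there
is at most one `σ ∈ S` with `r(σ) = e`. -/
def RUnique {R : Type*} [NonUnitalRing R] (𝒜 : GrRing G R) (S : Set (Mor G)) : Prop :=
  (∀ σ ∈ S, σ.right ∈ 𝒜.objSupport) ∧ ∀ σ ∈ S, ∀ τ ∈ S, σ.right = τ.right → σ = τ

/-- For each object `e` there are only finitely many `i` such that `d(σ) = e` for some
`σ ∈ S i`. -/
def DFinite {I : Type*} (S : I → Set (Mor G)) : Prop :=
  ∀ e : G, {i | ∃ σ ∈ S i, σ.left = e}.Finite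

/-- Matricial sequences of nonempty subsets of the groupoid. -/
structure IsMatricial {R : Type*} [NonUnitalRing R] (𝒜 : GrRing G R) {I : Type*}
    (S : I → Set (Mor G)) : Prop where
  nonempty : ∀ i, (S i).Nonempty
  dUnique : ∀ i, DUnique (S i)
  rUnique : ∀ i, RUnique 𝒜 (S i)
  dFinite : DFinite S

/-- If `R` is a gr-division ring with `supp(R) ⊆ eΓe`, then every `d`-finite sequence in `eΓ` is
matricial for `R`. -/
theorem isMatricial_singleton {R : Type*} [NonUnitalRing R] {𝒜 : GrRing G R}
    (hR : 𝒜.IsGrDivision) {e : G} (hs : 𝒜.SuppIn e) {I : Type*} {σ : I → Mor G} (hr : ∀ i, (σ i).right = e)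
    (hσ : DFinite fun i => {σ i}) : IsMatricial 𝒜 fun i => {σ i} where
  nonempty i := Set.singleton_nonempty _
  dUnique i := by
    intro σ hσ τ hτ _
    rw [Set.mem_singleton_iff.1 hσ, Set.mem_singleton_iff.1 hτ]
  rUnique i := by
    refine ⟨fun τ hτ => ?_, fun σ hσ τ hτ _ => ?_⟩
    · rw [Set.mem_singleton_iff.1 hτ, hr i]
      intro h
      have h1 : ∀ γ : Mor G, 𝒜.comp γ.hom = ⊥ := by
        rintro ⟨a, b, γ⟩
        by_contra h2
        obtain ⟨rfl, rfl⟩ := hs γ h2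
        refine h2 (eq_bot_iff.2 ?_)
        rw [← h]
        exact le_iSup₂ (f := fun (a : G) (γ : a ⟶ b) => 𝒜.comp γ) b γ
      have h2 := iSup_eq_top_of_isInternal 𝒜.isInternal
      simp only [h1, iSup_bot] at h2
      have := hR.1
      exact bot_ne_top h2
    · rw [Set.mem_singleton_iff.1 hσ, Set.mem_singleton_iff.1 hτ]
  dFinite := hσ

variable {R : Type u} [NonUnitalRing R] (𝒜 : GrRing G R)

/-- The subgroup `R_{SγT⁻¹}`.  When `S` and `T` are `d`-unique it is `R_{σγτ⁻¹}` if there are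
`σ ∈ S` and `τ ∈ T` with `d(σ) = r(γ)` and `d(τ) = d(γ)`, and it is `0` otherwise. -/
def entryComp (S T : Set (Mor G)) ⦃a b : G⦄ (γ : a ⟶ b) : AddSubgroup R :=
  ⨆ (x : G) (σ : b ⟶ x) (_ : (⟨b, x, σ⟩ : Mor G) ∈ S)
    (y : G) (τ : a ⟶ y) (_ : (⟨a, y, τ⟩ : Mor G) ∈ T), 𝒜.comp (Groupoid.inv τ ≫ γ ≫ σ)

variable {𝒜}

theorem entryComp_eq {S T : Set (Mor G)} (hS : DUnique S) (hT : DUnique T)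
    {a b x y : G} (γ : a ⟶ b) (σ : b ⟶ x) (hσ : (⟨b, x, σ⟩ : Mor G) ∈ S)
    (τ : a ⟶ y) (hτ : (⟨a, y, τ⟩ : Mor G) ∈ T) :
    entryComp 𝒜 S T γ = 𝒜.comp (Groupoid.inv τ ≫ γ ≫ σ) := by
  apply le_antisymm
  · refine iSup_le fun x' => iSup_le fun σ' => iSup_le fun hσ' => iSup_le fun y' =>
      iSup_le fun τ' => iSup_le fun hτ' => ?_
    have h1 := hS _ hσ _ hσ' rfl
    have h2 := hT _ hτ _ hτ' rfl
    cases h1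
    cases h2
    exact le_rfl
  · exact le_iSup_of_le x <| le_iSup_of_le σ <| le_iSup_of_le hσ <| le_iSup_of_le y <|
      le_iSup_of_le τ <| le_iSup_of_le hτ le_rfl

theorem entryComp_eq_bot {S T : Set (Mor G)} {a b : G} (γ : a ⟶ b)
    (h : ∀ (x : G) (σ : b ⟶ x) (y : G) (τ : a ⟶ y),
      ¬ ((⟨b, x, σ⟩ : Mor G) ∈ S ∧ (⟨a, y, τ⟩ : Mor G) ∈ T)) :
    entryComp 𝒜 S T γ = ⊥ := by
  rw [eq_bot_iff]
  refine iSup_le fun x => iSup_le fun σ => iSup_le fun hσ => iSup_le fun y =>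
      iSup_le fun τ => iSup_le fun hτ => ?_
  exact absurd ⟨hσ, hτ⟩ (h x σ y τ)

theorem entryComp_cases {S T : Set (Mor G)} (hS : DUnique S) (hT : DUnique T)
    {a b : G} (γ : a ⟶ b) {r : R} (hr : r ∈ entryComp 𝒜 S T γ) :
    r = 0 ∨ ∃ (x : G) (σ : b ⟶ x) (y : G) (τ : a ⟶ y), (⟨b, x, σ⟩ : Mor G) ∈ S ∧
      (⟨a, y, τ⟩ : Mor G) ∈ T ∧ r ∈ 𝒜.comp (Groupoid.inv τ ≫ γ ≫ σ) := by
  by_cases h : ∃ (x : G) (σ : b ⟶ x) (y : G) (τ : a ⟶ y), (⟨b, x, σ⟩ : Mor G) ∈ S ∧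
      (⟨a, y, τ⟩ : Mor G) ∈ T
  · obtain ⟨x, σ, y, τ, hσ, hτ⟩ := h
    rw [entryComp_eq hS hT γ σ hσ τ hτ] at hr
    exact Or.inr ⟨x, σ, y, τ, hσ, hτ, hr⟩
  · rw [entryComp_eq_bot γ fun x σ y τ h' => h ⟨x, σ, y, τ, h'⟩] at hr
    exact Or.inl hr

theorem entryComp_mul_mem {S T U : Set (Mor G)} (hS : DUnique S) (hT : DUnique T)
    (hU : DUnique U) {a b c : G} (γ : b ⟶ c) (δ : a ⟶ b) {r s : R}
    (hr : r ∈ entryComp 𝒜 S T γ) (hs : s ∈ entryComp 𝒜 T U δ) :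
    r * s ∈ entryComp 𝒜 S U (δ ≫ γ) := by
  rcases entryComp_cases hS hT γ hr with rfl | ⟨x, σ, y, τ, hσ, hτ, hr⟩
  · rw [zero_mul]; exact zero_mem _
  rcases entryComp_cases hT hU δ hs with rfl | ⟨y', τ', z, ρ, hτ', hρ, hs⟩
  · rw [mul_zero]; exact zero_mem _
  have h1 := hT _ hτ _ hτ' rfl
  cases h1
  rw [entryComp_eq hS hU _ σ hσ ρ hρ]
  have h2 := 𝒜.mul_mem _ _ r hr s hs
  simpa using h2

theorem entryComp_mul_eq_zero {S T U : Set (Mor G)} (hS : DUnique S) (hT : DUnique T)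
    (hU : DUnique U) (hT' : RUnique 𝒜 T) {a b b' c : G} (γ : b' ⟶ c) (δ : a ⟶ b) (hb : b' ≠ b)
    {r s : R} (hr : r ∈ entryComp 𝒜 S T γ) (hs : s ∈ entryComp 𝒜 T U δ) : r * s = 0 := by
  rcases entryComp_cases hS hT γ hr with rfl | ⟨x, σ, y, τ, hσ, hτ, hr⟩
  · rw [zero_mul]
  rcases entryComp_cases hT hU δ hs with rfl | ⟨y', τ', z, ρ, hτ', hρ, hs⟩
  · rw [mul_zero]
  refine 𝒜.mul_eq_zero _ _ (fun h => ?_) r hr s hs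
  have h1 := hT'.2 _ hτ _ hτ' h
  cases h1
  exact hb rfl

/-- The subgroup `M_I(R)(S)_γ` of the matrices `(a_{ij})` in `M_I(R)` with
`a_{ij} ∈ R_{S_i γ S_j⁻¹}`. -/
def matrixComp (𝒜 : GrRing G R) {I : Type*} (S : I → Set (Mor G)) ⦃a b : G⦄ (γ : a ⟶ b) :
    AddSubgroup (FinMatrix I R) where
  carrier := {A | ∀ i j, A.1 i j ∈ entryComp 𝒜 (S i) (S j) γ}
  zero_mem' := fun _ _ => zero_mem _
  add_mem' := fun hA hB i j => add_mem (hA i j) (hB i j)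
  neg_mem' := fun hA i j => neg_mem (hA i j)

variable {I : Type*} {S : I → Set (Mor G)}

theorem matrixComp_mul_mem (hS : IsMatricial 𝒜 S) ⦃a b c : G⦄ (γ : b ⟶ c) (δ : a ⟶ b) :
    ∀ A ∈ matrixComp 𝒜 S γ, ∀ B ∈ matrixComp 𝒜 S δ, A * B ∈ matrixComp 𝒜 S (δ ≫ γ) := by
  intro A hA B hB i j
  obtain ⟨s, hs⟩ := A.exists_finset
  rw [A.mul_apply_finset B hs]
  exact sum_mem fun k _ => entryComp_mul_mem (hS.dUnique i) (hS.dUnique k) (hS.dUnique j) γ δ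
    (hA i k) (hB k j)

theorem matrixComp_mul_eq_zero (hS : IsMatricial 𝒜 S) ⦃a b b' c : G⦄ (γ : b' ⟶ c) (δ : a ⟶ b)
    (hb : b' ≠ b) : ∀ A ∈ matrixComp 𝒜 S γ, ∀ B ∈ matrixComp 𝒜 S δ, A * B = 0 := by
  intro A hA B hB
  ext i j
  obtain ⟨s, hs⟩ := A.exists_finset
  rw [A.mul_apply_finset B hs]
  exact Finset.sum_eq_zero fun k _ => entryComp_mul_eq_zero (hS.dUnique i) (hS.dUnique k)
    (hS.dUnique j) (hS.rUnique k) γ δ hb (hA i k) (hB k j)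

theorem iSupIndep_matrixComp (hS : IsMatricial 𝒜 S) :
    iSupIndep fun γ : Mor G => matrixComp 𝒜 S γ.hom := by
  classical
  apply iSupIndep_of_separating (W := R)
  rintro ⟨a, b, γ⟩ A hA hA0
  obtain ⟨i, j, hij⟩ : ∃ i j, A.1 i j ≠ 0 := by
    by_contra! h
    exact hA0 (Subtype.ext (Matrix.ext h))
  rcases entryComp_cases (hS.dUnique i) (hS.dUnique j) γ (hA i j) with h | h
  · exact absurd h hij
  obtain ⟨x, σ, y, τ, hσ, hτ, hr⟩ := h
  let entry : FinMatrix I R →+ R := AddMonoidHom.mk' (fun A => A.1 i j) fun _ _ => rfl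
  let μ : Mor G := ⟨y, x, Groupoid.inv τ ≫ γ ≫ σ⟩
  refine ⟨(partProj 𝒜.isInternal (fun ν => ν = μ)).comp entry, ?_, ?_⟩
  · have h1 := partProj_apply 𝒜.isInternal (fun ν => ν = μ) (i := μ) hr
    rw [if_pos rfl] at h1
    change partProj 𝒜.isInternal (fun ν => ν = μ) (A.1 i j) ≠ 0
    rw [h1]
    exact hij
  · rintro ⟨a', b', δ⟩ hδ B hB
    change partProj 𝒜.isInternal (fun ν => ν = μ) (B.1 i j) = 0
    rcases entryComp_cases (hS.dUnique i) (hS.dUnique j) δ (hB i j) with h | h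
    · rw [h, map_zero]
    obtain ⟨x', σ', y', τ', hσ', hτ', hr'⟩ := h
    have h1 := partProj_apply 𝒜.isInternal (fun ν => ν = μ)
      (i := ⟨y', x', Groupoid.inv τ' ≫ δ ≫ σ'⟩) hr'
    rw [h1, if_neg]
    intro hμ
    have hx : x' = x := congrArg Quiver.Total.right hμ
    have hy : y' = y := congrArg Quiver.Total.left hμ
    have h2 := (hS.rUnique i).2 _ hσ' _ hσ hx
    have h3 := (hS.rUnique j).2 _ hτ' _ hτ hy
    cases h2
    cases h3
    have h4 : Groupoid.inv τ ≫ δ ≫ σ = Groupoid.inv τ ≫ γ ≫ σ := by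
      simpa [μ] using hμ
    have h5 : δ = γ := (cancel_mono σ).1 ((cancel_epi (Groupoid.inv τ)).1 h4)
    exact hδ (by rw [h5])

open Classical in
/-- The diagonal matrix `𝕀_e` whose `(i, i)` entry is `1_{r(σ)}` if there is `σ ∈ S i` with
`d(σ) = e`, and `0` otherwise. -/
noncomputable def matrixOne (hS : IsMatricial 𝒜 S) (e : G) : FinMatrix I R :=
  ⟨fun i j => if i = j then ∑ᶠ σ ∈ {σ : Mor G | σ ∈ S i ∧ σ.left = e}, 𝒜.one σ.right else 0, by
    refine Set.Finite.subset ((hS.dFinite e).image fun i => (i, i)) ?_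
    rintro ⟨i, j⟩ h
    by_cases hij : i = j
    · subst hij
      simp only [Set.mem_ofPred_eq, if_true] at h
      obtain ⟨σ, hσ1, -⟩ := exists_ne_zero_of_finsum_mem_ne_zero h
      exact ⟨i, ⟨σ, hσ1.1, hσ1.2⟩, rfl⟩
    · exact absurd (if_neg hij) h⟩

theorem matrixOne_diag (hS : IsMatricial 𝒜 S) {e x : G} (i : I) (σ : e ⟶ x)
    (hσ : (⟨e, x, σ⟩ : Mor G) ∈ S i) : (matrixOne hS e).1 i i = 𝒜.one x := by
  have h : {τ : Mor G | τ ∈ S i ∧ τ.left = e} = {⟨e, x, σ⟩} := by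
    ext τ
    constructor
    · rintro ⟨h1, h2⟩
      exact hS.dUnique i _ h1 _ hσ h2
    · rintro rfl
      exact ⟨hσ, rfl⟩
  simp only [matrixOne, if_true]
  rw [h, finsum_mem_singleton]

theorem matrixOne_diag_eq_zero (hS : IsMatricial 𝒜 S) {e : G} (i : I)
    (h : ∀ (x : G) (σ : e ⟶ x), (⟨e, x, σ⟩ : Mor G) ∉ S i) : (matrixOne hS e).1 i i = 0 := by
  have h : {τ : Mor G | τ ∈ S i ∧ τ.left = e} = ∅ := by
    rw [Set.eq_empty_iff_forall_notMem]
    rintro ⟨a, b, τ⟩ ⟨h1, rfl⟩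
    exact h _ _ h1
  simp only [matrixOne, if_true]
  rw [h, finsum_mem_empty]

theorem matrixOne_off_diag (hS : IsMatricial 𝒜 S) {e : G} {i j : I} (h : i ≠ j) :
    (matrixOne hS e).1 i j = 0 := by
  simp only [matrixOne, if_neg h]

theorem matrixOne_mem (hS : IsMatricial 𝒜 S) (e : G) :
    matrixOne hS e ∈ matrixComp 𝒜 S (𝟙 e) := by
  intro i j
  by_cases hij : i = j
  · subst hij
    by_cases h : ∃ (x : G) (σ : e ⟶ x), (⟨e, x, σ⟩ : Mor G) ∈ S i
    · obtain ⟨x, σ, hσ⟩ := h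
      rw [matrixOne_diag hS i σ hσ,
        entryComp_eq (hS.dUnique i) (hS.dUnique i) (𝟙 e) σ hσ σ hσ]
      simpa using 𝒜.one_mem x
    · rw [matrixOne_diag_eq_zero hS i fun x σ hσ => h ⟨x, σ, hσ⟩]
      exact zero_mem _
  · rw [matrixOne_off_diag hS hij]
    exact zero_mem _

theorem matrixOne_mul (hS : IsMatricial 𝒜 S) ⦃a b : G⦄ (γ : a ⟶ b) :
    ∀ A ∈ matrixComp 𝒜 S γ, matrixOne hS b * A = A := by
  intro A hA
  ext i j
  rw [FinMatrix.mul_apply, finsum_eq_single _ i fun k hk => by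
    rw [matrixOne_off_diag hS hk.symm, zero_mul]]
  rcases entryComp_cases (hS.dUnique i) (hS.dUnique j) γ (hA i j) with h | h
  · rw [h, mul_zero]
  · obtain ⟨x, σ, y, τ, hσ, hτ, hr⟩ := h
    rw [matrixOne_diag hS i σ hσ]
    exact 𝒜.one_mul _ _ hr

theorem mul_matrixOne (hS : IsMatricial 𝒜 S) ⦃a b : G⦄ (γ : a ⟶ b) :
    ∀ A ∈ matrixComp 𝒜 S γ, A * matrixOne hS a = A := by
  intro A hA
  ext i j
  rw [FinMatrix.mul_apply, finsum_eq_single _ j fun k hk => by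
    rw [matrixOne_off_diag hS hk, mul_zero]]
  rcases entryComp_cases (hS.dUnique i) (hS.dUnique j) γ (hA i j) with h | h
  · rw [h, zero_mul]
  · obtain ⟨x, σ, y, τ, hσ, hτ, hr⟩ := h
    rw [matrixOne_diag hS j τ hτ]
    exact 𝒜.mul_one _ _ hr

/-- The ring `M_I(R)(S) = ⨁ γ, M_I(R)(S)_γ` for a matricial sequence `S`. -/
noncomputable def MatrixRing (hS : IsMatricial 𝒜 S) : NonUnitalSubring (FinMatrix I R) :=
  familyRing (matrixComp 𝒜 S) (matrixComp_mul_mem hS) (matrixComp_mul_eq_zero hS)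

/-- The `Γ`-grading of the ring `M_I(R)(S)`. -/
noncomputable def matrixGrading (hS : IsMatricial 𝒜 S) : GrRing G (MatrixRing hS) :=
  familyGrading (matrixComp 𝒜 S) (matrixComp_mul_mem hS) (matrixComp_mul_eq_zero hS)
    (iSupIndep_matrixComp hS) (matrixOne hS) (matrixOne_mem hS) (matrixOne_mul hS)
    (mul_matrixOne hS)

end GradedMatrices

/-! ### Graded modules and their graded endomorphism rings -/

open Classical in
/-- The structure of a unital `Γ`-graded right `R`-module on an additive group `V`. -/
structure GrModule {G : Type w} [Groupoid.{v} G] {R : Type*} [NonUnitalRing R] (𝒜 : GrRing G R)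
    (V : Type u) [AddCommGroup V] where
  /-- `act x r` is the product `x r` -/
  act : V →+ R →+ V
  act_mul : ∀ (x : V) (r s : R), act x (r * s) = act (act x r) s
  /-- the homogeneous component of degree `γ` -/
  comp : ∀ ⦃a b : G⦄, (a ⟶ b) → AddSubgroup V
  isInternal : DirectSum.IsInternal fun γ : Mor G => comp γ.hom
  act_mem : ∀ ⦃a b c : G⦄ (γ : b ⟶ c) (δ : a ⟶ b), ∀ x ∈ comp γ, ∀ r ∈ 𝒜.comp δ,
    act x r ∈ comp (δ ≫ γ)
  act_eq_zero : ∀ ⦃a b b' c : G⦄ (γ : b' ⟶ c) (δ : a ⟶ b), b' ≠ b →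
    ∀ x ∈ comp γ, ∀ r ∈ 𝒜.comp δ, act x r = 0
  /-- `VR = V` -/
  unital : AddSubgroup.closure {y | ∃ x r, y = act x r} = ⊤

namespace GrModule

variable {G : Type w} [Groupoid.{v} G] {R : Type*} [NonUnitalRing R] {𝒜 : GrRing G R}
  {V : Type u} [AddCommGroup V] (𝒱 : GrModule 𝒜 V)

/-- The graded submodule `V(e)`, the sum of the components `V_γ` with `r(γ) = e`. -/
def part (e : G) : AddSubgroup V := ⨆ (a : G) (γ : a ⟶ e), 𝒱.comp γ

/-- `(x_i)` is a pseudo-basis of the graded submodule `N`: it is a sequence of homogeneous elements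
of `N` with `x_i` in the component of degree `γ_i`, it generates `N` as an `R`-module, and the only
finitely supported sequence `(a_i)` with `a_i ∈ 1_{d(γ_i)} R` and `∑ x_i a_i = 0` is the zero
sequence. -/
def IsPseudoBasis (N : AddSubgroup V) {I : Type*} (γ : I → Mor G) (x : I → V) : Prop :=
  (∀ i, x i ∈ N ⊓ 𝒱.comp (γ i).hom) ∧
  (∀ y ∈ N, ∃ a : I →₀ R, y = a.sum fun i r => 𝒱.act (x i) r) ∧
  ∀ a : I →₀ R, (∀ i, ∃ r, a i = 𝒜.one (γ i).left * r) →
    (a.sum fun i r => 𝒱.act (x i) r) = 0 → a = 0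

/-- For each object `e`, the graded module `V(e)` has finite pseudo-dimension, that is, it has a
finite pseudo-basis. -/
def IsFiniteDimensional : Prop :=
  ∀ e : G, ∃ (n : ℕ) (γ : Fin n → Mor G) (x : Fin n → V), 𝒱.IsPseudoBasis (𝒱.part e) γ x

/-- The group `END_R(V)_γ` of the endomorphisms `g` of the `R`-module `V` of degree `γ`, that is,
`g(V_σ) ⊆ V_{γσ}` if `γσ` is defined and `g(V_σ) = 0` otherwise. -/
def endComp ⦃a b : G⦄ (γ : a ⟶ b) : AddSubgroup (AddMonoid.End V) where
  carrier := {g | (∀ x r, g (𝒱.act x r) = 𝒱.act (g x) r) ∧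
    (∀ (c : G) (σ : c ⟶ a), ∀ x ∈ 𝒱.comp σ, g x ∈ 𝒱.comp (σ ≫ γ)) ∧
    ∀ (c a' : G) (σ : c ⟶ a'), a' ≠ a → ∀ x ∈ 𝒱.comp σ, g x = 0}
  zero_mem' := by
    refine ⟨fun x r => ?_, fun c σ x _ => zero_mem _, fun _ _ _ _ _ _ => rfl⟩
    simp
  add_mem' := by
    rintro g h ⟨hg1, hg2, hg3⟩ ⟨hh1, hh2, hh3⟩
    refine ⟨fun x r => ?_, fun c σ x hx => add_mem (hg2 c σ x hx) (hh2 c σ x hx),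
      fun c a' σ ha x hx => ?_⟩
    · change g _ + h _ = 𝒱.act (g x + h x) r
      rw [hg1, hh1, map_add, AddMonoidHom.add_apply]
    · change g x + h x = 0
      rw [hg3 c a' σ ha x hx, hh3 c a' σ ha x hx, add_zero]
  neg_mem' := by
    rintro g ⟨hg1, hg2, hg3⟩
    refine ⟨fun x r => ?_, fun c σ x hx => neg_mem (hg2 c σ x hx), fun c a' σ ha x hx => ?_⟩
    · change - g _ = 𝒱.act (- g x) r
      rw [hg1, map_neg, AddMonoidHom.neg_apply]
    · change - g x = 0
      rw [hg3 c a' σ ha x hx, neg_zero]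

theorem endComp_mul_mem ⦃a b c : G⦄ (γ : b ⟶ c) (δ : a ⟶ b) :
    ∀ g ∈ 𝒱.endComp γ, ∀ h ∈ 𝒱.endComp δ, g * h ∈ 𝒱.endComp (δ ≫ γ) := by
  rintro g ⟨hg1, hg2, hg3⟩ h ⟨hh1, hh2, hh3⟩
  refine ⟨fun x r => ?_, fun c σ x hx => ?_, fun c a' σ ha x hx => ?_⟩
  · change g (h _) = 𝒱.act (g (h x)) r
    rw [hh1, hg1]
  · rw [← Category.assoc]
    exact hg2 _ _ _ (hh2 _ _ _ hx)
  · change g (h x) = 0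
    rw [hh3 _ _ _ ha x hx, map_zero]

theorem end_ext {g h : AddMonoid.End V}
    (H : ∀ ⦃a b : G⦄ (σ : a ⟶ b), ∀ x ∈ 𝒱.comp σ, g x = h x) : g = h :=
  addHom_ext_of_iSup_eq_top (iSup_eq_top_of_isInternal 𝒱.isInternal)
    fun σ x hx => H σ.hom x hx

theorem endComp_mul_eq_zero ⦃a b b' c : G⦄ (γ : b' ⟶ c) (δ : a ⟶ b) (hb : b' ≠ b) :
    ∀ g ∈ 𝒱.endComp γ, ∀ h ∈ 𝒱.endComp δ, g * h = 0 := by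
  rintro g ⟨hg1, hg2, hg3⟩ h ⟨hh1, hh2, hh3⟩
  refine 𝒱.end_ext fun c a' σ x hx => ?_
  change g (h x) = 0
  by_cases ha : a' = a
  · subst ha
    exact hg3 _ _ _ hb.symm _ (hh2 _ _ _ hx)
  · rw [hh3 _ _ _ ha x hx, map_zero]

theorem iSupIndep_endComp : iSupIndep fun γ : Mor G => 𝒱.endComp γ.hom := by
  classical
  apply iSupIndep_of_separating (W := V)
  rintro ⟨a, b, γ⟩ g ⟨hg1, hg2, hg3⟩ hg0
  obtain ⟨c, a', σ, x, hx, hgx⟩ : ∃ (c a' : G) (σ : c ⟶ a') (x : V), x ∈ 𝒱.comp σ ∧ g x ≠ 0 := by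
    by_contra! h
    exact hg0 (𝒱.end_ext fun c a' σ x hx => h c a' σ x hx)
  by_cases ha : a' = a
  swap
  · exact absurd (hg3 _ _ _ ha x hx) hgx
  subst ha
  let μ : Mor G := ⟨c, b, σ ≫ γ⟩
  let ev : AddMonoid.End V →+ V := AddMonoidHom.mk' (fun g => g x) fun _ _ => rfl
  refine ⟨(partProj 𝒱.isInternal (fun ν => ν = μ)).comp ev, ?_, ?_⟩
  · have h1 := partProj_apply 𝒱.isInternal (fun ν => ν = μ) (i := μ) (hg2 _ _ _ hx)
    rw [if_pos rfl] at h1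
    change partProj 𝒱.isInternal (fun ν => ν = μ) (g x) ≠ 0
    rw [h1]
    exact hgx
  · rintro ⟨a₁, b₁, δ⟩ hδ h ⟨hh1, hh2, hh3⟩
    change partProj 𝒱.isInternal (fun ν => ν = μ) (h x) = 0
    by_cases ha : a' = a₁
    · subst ha
      have h1 := partProj_apply 𝒱.isInternal (fun ν => ν = μ) (i := ⟨c, b₁, σ ≫ δ⟩)
        (hh2 _ _ _ hx)
      rw [h1, if_neg]
      intro hμ
      have hb : b₁ = b := congrArg Quiver.Total.right hμ
      subst hb
      have h4 : σ ≫ δ = σ ≫ γ := by simpa [μ] using hμ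
      have h5 : δ = γ := (cancel_epi σ).1 h4
      exact hδ (by rw [h5])
    · rw [hh3 _ _ _ ha x hx, map_zero]

open Classical in
/-- The canonical projection `V → V(e)`, as an endomorphism of `V`. -/
noncomputable def proj (e : G) : AddMonoid.End V :=
  partProj 𝒱.isInternal fun σ => σ.right = e

theorem proj_self {a e : G} (σ : a ⟶ e) {x : V} (hx : x ∈ 𝒱.comp σ) : 𝒱.proj e x = x := by
  classical
  exact (partProj_apply 𝒱.isInternal (fun σ => σ.right = e) (i := ⟨a, e, σ⟩) hx).trans
    (if_pos rfl)

theorem proj_of_ne {a b e : G} (σ : a ⟶ b) (h : b ≠ e) {x : V} (hx : x ∈ 𝒱.comp σ) :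
    𝒱.proj e x = 0 := by
  classical
  exact (partProj_apply 𝒱.isInternal (fun σ => σ.right = e) (i := ⟨a, b, σ⟩) hx).trans
    (if_neg h)

theorem proj_act (e : G) (x : V) (r : R) : 𝒱.proj e (𝒱.act x r) = 𝒱.act (𝒱.proj e x) r := by
  have h1 : (AddMonoidHom.compHom (𝒱.proj e)).comp 𝒱.act = 𝒱.act.comp (𝒱.proj e) := by
    refine addHom_ext_of_iSup_eq_top (iSup_eq_top_of_isInternal 𝒱.isInternal) ?_
    rintro ⟨b', c, γ⟩ x hx
    refine addHom_ext_of_iSup_eq_top (iSup_eq_top_of_isInternal 𝒜.isInternal) ?_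
    rintro ⟨a, b, δ⟩ r hr
    change 𝒱.proj e (𝒱.act x r) = 𝒱.act (𝒱.proj e x) r
    by_cases hb : b' = b
    · subst hb
      have h2 := 𝒱.act_mem γ δ x hx r hr
      by_cases hc : c = e
      · subst hc
        rw [𝒱.proj_self _ h2, 𝒱.proj_self _ hx]
      · rw [𝒱.proj_of_ne _ hc h2, 𝒱.proj_of_ne _ hc hx, map_zero, AddMonoidHom.zero_apply]
    · rw [𝒱.act_eq_zero γ δ hb x hx r hr, map_zero]
      by_cases hc : c = e
      · subst hc
        rw [𝒱.proj_self _ hx, 𝒱.act_eq_zero γ δ hb x hx r hr]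
      · rw [𝒱.proj_of_ne _ hc hx, map_zero, AddMonoidHom.zero_apply]
  exact DFunLike.congr_fun (DFunLike.congr_fun h1 x) r

theorem proj_mem (e : G) : 𝒱.proj e ∈ 𝒱.endComp (𝟙 e) := by
  refine ⟨𝒱.proj_act e, fun c σ x hx => ?_, fun c a' σ ha x hx => 𝒱.proj_of_ne σ ha hx⟩
  rw [𝒱.proj_self σ hx, Category.comp_id]
  exact hx

theorem proj_mul ⦃a b : G⦄ (γ : a ⟶ b) : ∀ g ∈ 𝒱.endComp γ, 𝒱.proj b * g = g := by
  rintro g ⟨hg1, hg2, hg3⟩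
  refine 𝒱.end_ext fun c a' σ x hx => ?_
  change 𝒱.proj b (g x) = g x
  by_cases ha : a' = a
  · subst ha
    exact 𝒱.proj_self _ (hg2 _ _ _ hx)
  · rw [hg3 _ _ _ ha x hx, map_zero]

theorem mul_proj ⦃a b : G⦄ (γ : a ⟶ b) : ∀ g ∈ 𝒱.endComp γ, g * 𝒱.proj a = g := by
  rintro g ⟨hg1, hg2, hg3⟩
  refine 𝒱.end_ext fun c a' σ x hx => ?_
  change g (𝒱.proj a x) = g x
  by_cases ha : a' = a
  · subst ha
    rw [𝒱.proj_self σ hx]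
  · rw [hg3 _ _ _ ha x hx, 𝒱.proj_of_ne σ ha hx, map_zero]

/-- The ring `END_R(V) = ⨁ γ, END_R(V)_γ`, with composition of maps as product. -/
def EndRing : NonUnitalSubring (AddMonoid.End V) :=
  familyRing 𝒱.endComp 𝒱.endComp_mul_mem 𝒱.endComp_mul_eq_zero

/-- The `Γ`-grading of the ring `END_R(V)`. -/
noncomputable def endGrading : GrRing G 𝒱.EndRing :=
  familyGrading 𝒱.endComp 𝒱.endComp_mul_mem 𝒱.endComp_mul_eq_zero 𝒱.iSupIndep_endComp
    𝒱.proj 𝒱.proj_mem 𝒱.proj_mul 𝒱.mul_proj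

end GrModule

end GroupoidGraded

-- All six conditions are shown equivalent to one left-right symmetric condition, `HasMatrixUnits`:
-- some `R_e` contains an idempotent `f` with `fRf` a gr-division ring, and each `1_c` is a finite
-- sum of products `x_i y_i`, where `x_i ∈ Rf` and `y_i ∈ fR` are homogeneous of inverse degrees and
-- `y_i x_j = δ_{ij} f`.
--
-- Suppose `R` is gr-simple and right artinian. A minimal graded right ideal exists, and the sum of
-- all gr-simple right ideals is two-sided, so `R` is right gr-semisimple. A shortest expression of
-- `1_c` as a sum of elements that are zero or generate gr-simple right ideals then consists of
-- orthogonal idempotents `s` with `sR` gr-simple (`hasMinIdemDecomposition_of_rightGrSemisimple`).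
-- Gr-simplicity of `R` gives `sRf ≠ 0` for a fixed minimal idempotent `f`, and a nonzero
-- homogeneous `x ∈ sRf` has a partner `y` with `yx = f` and `xy = s`
-- (`hasMatrixUnits_of_isGrSimple`). Conversely, matrix units move every nonzero homogeneous element
-- into `fRf`, where it becomes invertible; this gives gr-simplicity and minimal idempotents, hence
-- the chain condition. The left-handed version follows in the opposite ring, where the `x_i` and
-- the `y_i` change places.
--
-- Given matrix units, put `D = fRf` and `V = Rf`. The maps `r ↦ (y_i r x_j)` and `r ↦ (v ↦ rv)` are
-- gr-isomorphisms, because `r` is recovered by inserting `1_c = ∑ x_i y_i`. In the other direction,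
-- any two nonzero `1_a`, `1_b` of a gr-prime gr-division ring are linked by a homogeneous unit
-- (`IsGrDivision.exists_unit`). These units correct the domains and ranges of elementary matrices
-- and of rank one endomorphisms, which then become matrix units.
--
-- For the symmetry of gr-semisimplicity, the decomposition of every `1_c` into minimal idempotents
-- also makes each `Rf` gr-simple, so right implies left; the opposite ring gives the converse.

universe t

namespace GroupoidGraded

/-! ### Components of an element of an internal direct sum. -/

section Components

variable {ι V : Type*} [AddCommGroup V]

open Classical in
theorem partProj_eq_mem {A : ι → AddSubgroup V} (h : DirectSum.IsInternal A) (i : ι) (x : V) :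
    partProj h (fun j => j = i) x ∈ A i := by
  have hx : x ∈ iSup A := by rw [iSup_eq_top_of_isInternal h]; trivial
  induction hx using AddSubgroup.iSup_induction' with
  | hp j x hx =>
    rw [partProj_apply h _ hx]
    split_ifs with hj
    · exact hj ▸ hx
    · exact zero_mem _
  | h1 => rw [map_zero]; exact zero_mem _
  | hadd x y _ _ h1 h2 => rw [map_add]; exact add_mem h1 h2

open Classical in
theorem exists_sum_partProj {A : ι → AddSubgroup V} (h : DirectSum.IsInternal A) (x : V) :
    ∃ s : Finset ι, x = ∑ i ∈ s, partProj h (fun j => j = i) x := by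
  -- Allowing every larger index set `t` lets the two summands of `x + y` share one index set.
  suffices H : ∃ s : Finset ι, ∀ t, s ⊆ t → x = ∑ i ∈ t, partProj h (fun j => j = i) x by
    obtain ⟨s, hs⟩ := H
    exact ⟨s, hs s subset_rfl⟩
  have hx : x ∈ iSup A := by rw [iSup_eq_top_of_isInternal h]; trivial
  induction hx using AddSubgroup.iSup_induction' with
  | hp j x hx =>
    refine ⟨{j}, fun t ht => ?_⟩
    have h1 : ∀ i, partProj h (fun j => j = i) x = if j = i then x else 0 :=
      fun i => partProj_apply h _ hx
    simp only [h1, Finset.sum_ite_eq]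
    rw [if_pos (ht (Finset.mem_singleton_self j))]
  | h1 => exact ⟨∅, fun t _ => by simp⟩
  | hadd x y _ _ h1 h2 =>
    obtain ⟨s, hs⟩ := h1
    obtain ⟨s', hs'⟩ := h2
    refine ⟨s ∪ s', fun t ht => ?_⟩
    simp only [map_add, Finset.sum_add_distrib]
    rw [← hs t (Finset.union_subset_left ht), ← hs' t (Finset.union_subset_right ht)]

end Components

/-! ### Homogeneous components in graded rings. -/

namespace GrRing

variable {G : Type w} [Groupoid.{v} G] {R : Type u} [NonUnitalRing R] (𝒜 : GrRing G R)

theorem addHom_ext {W : Type*} [AddCommGroup W] {f g : R →+ W}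
    (h : ∀ ⦃a b : G⦄ (γ : a ⟶ b), ∀ x ∈ 𝒜.comp γ, f x = g x) : f = g :=
  addHom_ext_of_iSup_eq_top (iSup_eq_top_of_isInternal 𝒜.isInternal)
    fun γ x hx => h γ.hom x hx

theorem mem_iSup_comp (x : R) : x ∈ ⨆ γ : Mor G, 𝒜.comp γ.hom := by
  rw [iSup_eq_top_of_isInternal 𝒜.isInternal]
  trivial

theorem homogeneous_induction {p : R → Prop} (x : R)
    (h : ∀ ⦃a b : G⦄ (γ : a ⟶ b), ∀ x ∈ 𝒜.comp γ, p x) (h0 : p 0)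
    (hadd : ∀ x y, p x → p y → p (x + y)) : p x := by
  have hx := 𝒜.mem_iSup_comp x
  induction hx using AddSubgroup.iSup_induction' with
  | hp γ x hx => exact h γ.hom x hx
  | h1 => exact h0
  | hadd x y _ _ h1 h2 => exact hadd x y h1 h2

open Classical in
/-- The homogeneous component of degree `γ` of an element. -/
noncomputable def homPart ⦃a b : G⦄ (γ : a ⟶ b) : R →+ R :=
  partProj 𝒜.isInternal fun ν => ν = ⟨a, b, γ⟩

variable {𝒜}

theorem homPart_of_mem {a b : G} {γ : a ⟶ b} {x : R} (hx : x ∈ 𝒜.comp γ) :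
    𝒜.homPart γ x = x := by
  classical
  exact (partProj_apply 𝒜.isInternal _ (i := (⟨a, b, γ⟩ : Mor G)) hx).trans (if_pos rfl)

theorem homPart_of_ne {a b a' b' : G} {γ : a ⟶ b} {δ : a' ⟶ b'} {x : R} (hx : x ∈ 𝒜.comp δ)
    (h : (⟨a', b', δ⟩ : Mor G) ≠ ⟨a, b, γ⟩) : 𝒜.homPart γ x = 0 := by
  classical
  exact (partProj_apply 𝒜.isInternal _ (i := (⟨a', b', δ⟩ : Mor G)) hx).trans (if_neg h)

theorem homPart_mem {a b : G} (γ : a ⟶ b) (x : R) : 𝒜.homPart γ x ∈ 𝒜.comp γ := by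
  classical
  exact partProj_eq_mem 𝒜.isInternal (⟨a, b, γ⟩ : Mor G) x

theorem exists_sum_homPart (x : R) :
    ∃ s : Finset (Mor G), x = ∑ γ ∈ s, 𝒜.homPart γ.hom x := by
  classical
  exact exists_sum_partProj 𝒜.isInternal x

theorem exists_homPart_ne_zero {x : R} (hx : x ≠ 0) :
    ∃ (a b : G) (γ : a ⟶ b), 𝒜.homPart γ x ≠ 0 := by
  by_contra! h
  obtain ⟨s, hs⟩ := exists_sum_homPart (𝒜 := 𝒜) x
  exact hx (hs.trans (Finset.sum_eq_zero fun γ _ => h _ _ _))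

/-- The working criterion: it turns the supremum in the definition into a condition on single
components. -/
theorem isHomogeneous_iff {I : AddSubgroup R} :
    𝒜.IsHomogeneous I ↔ ∀ x ∈ I, ∀ ⦃a b : G⦄ (γ : a ⟶ b), 𝒜.homPart γ x ∈ I := by
  constructor
  · intro h x hx a b γ
    have hx' := h hx
    clear hx
    induction hx' using AddSubgroup.iSup_induction' with
    | hp δ x hx =>
      by_cases hδ : δ = ⟨a, b, γ⟩
      · subst hδ
        rw [homPart_of_mem hx.2]
        exact hx.1
      · rw [homPart_of_ne hx.2 hδ]
        exact zero_mem _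
    | h1 => rw [map_zero]; exact zero_mem _
    | hadd x y _ _ h1 h2 => rw [map_add]; exact add_mem h1 h2
  · intro h x hx
    obtain ⟨s, hs⟩ := exists_sum_homPart (𝒜 := 𝒜) x
    rw [hs]
    exact sum_mem fun γ _ => AddSubgroup.mem_iSup_of_mem γ ⟨h x hx γ.hom, homPart_mem _ _⟩

theorem exists_homogeneous_mem {I : AddSubgroup R} (hI : 𝒜.IsHomogeneous I) (h : I ≠ ⊥) :
    ∃ (a b : G) (γ : a ⟶ b) (x : R), x ∈ I ∧ x ∈ 𝒜.comp γ ∧ x ≠ 0 := by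
  obtain ⟨⟨x, hx⟩, hx0⟩ := AddSubgroup.ne_bot_iff_exists_ne_zero.1 h
  replace hx0 : x ≠ 0 := fun h => hx0 (Subtype.ext h)
  obtain ⟨a, b, γ, hγ⟩ := exists_homPart_ne_zero (𝒜 := 𝒜) hx0
  exact ⟨a, b, γ, _, isHomogeneous_iff.1 hI x hx γ, homPart_mem _ _, hγ⟩

theorem mor_comp_left_injective {a' a b c : G} {ε : a' ⟶ b} {δ : a ⟶ b} {γ : b ⟶ c}
    (h : (⟨a', c, ε ≫ γ⟩ : Mor G) = ⟨a, c, δ ≫ γ⟩) :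
    (⟨a', b, ε⟩ : Mor G) = ⟨a, b, δ⟩ := by
  have ha : a' = a := congrArg Quiver.Total.left h
  subst ha
  have h2 : ε ≫ γ = δ ≫ γ := by simpa using h
  rw [(cancel_mono γ).1 h2]

theorem mor_comp_right_injective {c' a b c : G} {ε : b ⟶ c'} {γ : b ⟶ c} {δ : a ⟶ b}
    (h : (⟨a, c', δ ≫ ε⟩ : Mor G) = ⟨a, c, δ ≫ γ⟩) :
    (⟨b, c', ε⟩ : Mor G) = ⟨b, c, γ⟩ := by
  have hc : c' = c := congrArg Quiver.Total.right h
  subst hc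
  have h2 : δ ≫ ε = δ ≫ γ := by simpa using h
  rw [(cancel_epi δ).1 h2]

/-- Left multiplication by `z` sends degree `ε` to degree `γε`, and composition with `γ` can be
cancelled in a groupoid. So only the component of `r` in degree `δ` can contribute to degree `γδ`.
-/
theorem homPart_mul_left {a b c : G} (γ : b ⟶ c) (δ : a ⟶ b) {z : R} (hz : z ∈ 𝒜.comp γ)
    (r : R) : 𝒜.homPart (δ ≫ γ) (z * r) = z * 𝒜.homPart δ r := by
  suffices h : (𝒜.homPart (δ ≫ γ)).comp (AddMonoidHom.mulLeft z)
      = (AddMonoidHom.mulLeft z).comp (𝒜.homPart δ) from DFunLike.congr_fun h r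
  refine 𝒜.addHom_ext fun a' b' ε x hx => ?_
  change 𝒜.homPart (δ ≫ γ) (z * x) = z * 𝒜.homPart δ x
  by_cases hb : b = b'
  · subst hb
    have hm := 𝒜.mul_mem γ ε z hz x hx
    by_cases h : (⟨a', b, ε⟩ : Mor G) = ⟨a, b, δ⟩
    · cases h
      rw [homPart_of_mem hm, homPart_of_mem hx]
    · rw [homPart_of_ne hx h, mul_zero]
      exact homPart_of_ne hm fun h' => h (mor_comp_left_injective h')
  · rw [𝒜.mul_eq_zero γ ε hb z hz x hx, homPart_of_ne hx, map_zero, mul_zero]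
    intro h
    exact hb (congrArg Quiver.Total.right h).symm

theorem homPart_mul_right {a b c : G} (γ : b ⟶ c) (δ : a ⟶ b) {z : R} (hz : z ∈ 𝒜.comp δ)
    (r : R) : 𝒜.homPart (δ ≫ γ) (r * z) = 𝒜.homPart γ r * z := by
  suffices h : (𝒜.homPart (δ ≫ γ)).comp (AddMonoidHom.mulRight z)
      = (AddMonoidHom.mulRight z).comp (𝒜.homPart γ) from DFunLike.congr_fun h r
  refine 𝒜.addHom_ext fun b' c' ε x hx => ?_
  change 𝒜.homPart (δ ≫ γ) (x * z) = 𝒜.homPart γ x * z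
  by_cases hb : b' = b
  · subst hb
    have hm := 𝒜.mul_mem ε δ x hx z hz
    by_cases h : (⟨b', c', ε⟩ : Mor G) = ⟨b', c, γ⟩
    · cases h
      rw [homPart_of_mem hm, homPart_of_mem hx]
    · rw [homPart_of_ne hx h, zero_mul]
      exact homPart_of_ne hm fun h' => h (mor_comp_right_injective h')
  · rw [𝒜.mul_eq_zero ε δ hb x hx z hz, homPart_of_ne hx, map_zero, zero_mul]
    intro h
    exact hb (congrArg Quiver.Total.left h)

/-- Only the component of `r` in degree `γ⁻¹δ` contributes to `x`. This reduces divisibility by a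
homogeneous element to homogeneous quotients. -/
theorem exists_homogeneous_right_factor {a b c : G} {γ : b ⟶ c} {δ : a ⟶ c} {z x r : R}
    (hz : z ∈ 𝒜.comp γ) (hx : x ∈ 𝒜.comp δ) (h : x = z * r) :
    ∃ t ∈ 𝒜.comp (δ ≫ Groupoid.inv γ), x = z * t := by
  refine ⟨_, homPart_mem _ r, ?_⟩
  rw [← homPart_mul_left γ _ hz, ← h]
  simpa using (homPart_of_mem hx).symm

theorem one_mul_one (e : G) : 𝒜.one e * 𝒜.one e = 𝒜.one e :=
  𝒜.one_mul _ _ (𝒜.one_mem e)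

theorem right_eq_of_mul_ne_zero {a b c e : G} {γ : b ⟶ c} {δ : a ⟶ e} {x y : R}
    (hx : x ∈ 𝒜.comp γ) (hy : y ∈ 𝒜.comp δ) (h : x * y ≠ 0) : e = b := by
  by_contra hb
  exact h (𝒜.mul_eq_zero γ δ (Ne.symm hb) x hx y hy)

theorem exists_one_ne_zero [Nontrivial R] : ∃ e : G, 𝒜.one e ≠ 0 := by
  by_contra! h
  obtain ⟨x, hx⟩ := exists_ne (0 : R)
  obtain ⟨a, b, γ, hγ⟩ := exists_homPart_ne_zero (𝒜 := 𝒜) hx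
  have h1 := 𝒜.one_mul γ _ (homPart_mem γ x)
  rw [h b, zero_mul] at h1
  exact hγ h1.symm

/-! ### Graded right ideals and the parts `R(e)`. -/

theorem eq_top_of_one_mem {I : AddSubgroup R} (hI : ∀ x ∈ I, ∀ r : R, x * r ∈ I)
    (h : ∀ e : G, 𝒜.one e ∈ I) : I = ⊤ := by
  rw [eq_top_iff]
  intro x _
  refine 𝒜.homogeneous_induction (p := fun x => x ∈ I) x (fun a b γ x hx => ?_) (zero_mem _)
    fun _ _ => add_mem
  rw [← 𝒜.one_mul γ x hx]
  exact hI _ (h b) x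

theorem mem_rightPart {e a : G} {γ : a ⟶ e} {x : R} (hx : x ∈ 𝒜.comp γ) : x ∈ 𝒜.rightPart e :=
  AddSubgroup.mem_iSup_of_mem a (AddSubgroup.mem_iSup_of_mem γ hx)

theorem one_mul_of_mem_rightPart {e : G} {x : R} (hx : x ∈ 𝒜.rightPart e) :
    𝒜.one e * x = x := by
  have h : 𝒜.rightPart e ≤ (AddMonoidHom.mulLeft (𝒜.one e)).eqLocus (AddMonoidHom.id R) :=
    iSup_le fun a => iSup_le fun γ x hx => 𝒜.one_mul γ x hx
  exact h hx

theorem one_mul_mem_rightPart (e : G) (x : R) : 𝒜.one e * x ∈ 𝒜.rightPart e := by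
  refine 𝒜.homogeneous_induction (p := fun x => 𝒜.one e * x ∈ 𝒜.rightPart e) x
    (fun a b γ x hx => ?_) (by rw [mul_zero]; exact zero_mem _)
    fun x y h1 h2 => by rw [mul_add]; exact add_mem h1 h2
  by_cases h : e = b
  · subst h
    rw [𝒜.one_mul γ x hx]
    exact mem_rightPart hx
  · rw [𝒜.mul_eq_zero (𝟙 e) γ h _ (𝒜.one_mem e) x hx]
    exact zero_mem _

/-- The image of a graded right ideal under left multiplication by a homogeneous element. -/
theorem isGradedRightIdeal_map_mulLeft {I : AddSubgroup R} (hI : 𝒜.IsGradedRightIdeal I)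
    {b c : G} {γ : b ⟶ c} {z : R} (hz : z ∈ 𝒜.comp γ) :
    𝒜.IsGradedRightIdeal (I.map (AddMonoidHom.mulLeft z)) := by
  constructor
  · rintro _ ⟨x, hx, rfl⟩
    have hx' := hI.1 hx
    clear hx
    induction hx' using AddSubgroup.iSup_induction' with
    | hp δ x hx =>
      obtain ⟨a, b', δ⟩ := δ
      change z * x ∈ _
      by_cases hb : b = b'
      · subst hb
        exact AddSubgroup.mem_iSup_of_mem (⟨a, c, δ ≫ γ⟩ : Mor G)
          ⟨⟨x, hx.1, rfl⟩, 𝒜.mul_mem γ δ z hz x hx.2⟩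
      · rw [𝒜.mul_eq_zero γ δ hb z hz x hx.2]
        exact zero_mem _
    | h1 => rw [map_zero]; exact zero_mem _
    | hadd x y _ _ h1 h2 => rw [map_add]; exact add_mem h1 h2
  · rintro _ ⟨x, hx, rfl⟩ r
    exact ⟨x * r, hI.2 x hx r, (mul_assoc z x r).symm⟩

theorem isGradedRightIdeal_top : 𝒜.IsGradedRightIdeal ⊤ :=
  ⟨fun x _ => isHomogeneous_iff.2 (fun _ _ _ _ _ => AddSubgroup.mem_top _) (AddSubgroup.mem_top x),
    fun _ _ _ => trivial⟩

theorem IsGradedRightIdeal.inf {I J : AddSubgroup R} (hI : 𝒜.IsGradedRightIdeal I)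
    (hJ : 𝒜.IsGradedRightIdeal J) : 𝒜.IsGradedRightIdeal (I ⊓ J) :=
  ⟨isHomogeneous_iff.2 fun x hx _ _ γ =>
    ⟨isHomogeneous_iff.1 hI.1 x hx.1 γ, isHomogeneous_iff.1 hJ.1 x hx.2 γ⟩,
    fun x hx r => ⟨hI.2 x hx.1 r, hJ.2 x hx.2 r⟩⟩

/-- The preimage of a graded right ideal under left multiplication by a homogeneous element. -/
theorem isGradedRightIdeal_comap_mulLeft {J : AddSubgroup R} (hJ : 𝒜.IsGradedRightIdeal J)
    {b c : G} {γ : b ⟶ c} {z : R} (hz : z ∈ 𝒜.comp γ) :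
    𝒜.IsGradedRightIdeal (J.comap (AddMonoidHom.mulLeft z)) := by
  constructor
  · refine isHomogeneous_iff.2 fun x hx a b' δ => ?_
    change z * 𝒜.homPart δ x ∈ J
    by_cases hb : b = b'
    · subst hb
      rw [← homPart_mul_left γ δ hz]
      exact isHomogeneous_iff.1 hJ.1 _ hx _
    · rw [𝒜.mul_eq_zero γ δ hb z hz _ (homPart_mem _ _)]
      exact zero_mem _
  · intro x hx r
    change z * (x * r) ∈ J
    rw [← mul_assoc]
    exact hJ.2 _ hx r

theorem isGradedRightIdeal_bot : 𝒜.IsGradedRightIdeal ⊥ :=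
  ⟨bot_le, fun x hx r => by rw [AddSubgroup.mem_bot.1 hx, zero_mul]; exact zero_mem _⟩

theorem isGradedRightIdeal_rightPart (e : G) : 𝒜.IsGradedRightIdeal (𝒜.rightPart e) := by
  constructor
  · refine iSup_le fun a => iSup_le fun γ x hx => ?_
    exact AddSubgroup.mem_iSup_of_mem (⟨a, e, γ⟩ : Mor G) ⟨mem_rightPart hx, hx⟩
  · intro x hx r
    rw [← one_mul_of_mem_rightPart hx, mul_assoc]
    exact one_mul_mem_rightPart e _

theorem mul_mem_left_id {a e : G} {γ : a ⟶ e} {f z : R} (hf : f ∈ 𝒜.comp (𝟙 e))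
    (hz : z ∈ 𝒜.comp γ) : f * z ∈ 𝒜.comp γ := by
  simpa using 𝒜.mul_mem (𝟙 e) γ f hf z hz

theorem mul_mem_right_id {a b : G} {γ : a ⟶ b} {f z : R} (hf : f ∈ 𝒜.comp (𝟙 a))
    (hz : z ∈ 𝒜.comp γ) : z * f ∈ 𝒜.comp γ := by
  simpa using 𝒜.mul_mem γ (𝟙 a) z hz f hf

theorem mul_inv_mem {a b : G} {γ : a ⟶ b} {x y : R} (hx : x ∈ 𝒜.comp γ)
    (hy : y ∈ 𝒜.comp (Groupoid.inv γ)) : x * y ∈ 𝒜.comp (𝟙 b) := by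
  simpa using 𝒜.mul_mem γ (Groupoid.inv γ) x hx y hy

theorem inv_mul_mem {a b : G} {γ : a ⟶ b} {x y : R} (hx : x ∈ 𝒜.comp γ)
    (hy : y ∈ 𝒜.comp (Groupoid.inv γ)) : y * x ∈ 𝒜.comp (𝟙 a) := by
  simpa using 𝒜.mul_mem (Groupoid.inv γ) γ y hy x hx

/-! ### Minimal idempotents and gr-semisimplicity. -/

variable (𝒜) in
/-- An element `s` of `R_e` such that every nonzero homogeneous element of `sR` generates `sR`. -/
def IsMinElement (e : G) (s : R) : Prop :=
  s ∈ 𝒜.comp (𝟙 e) ∧ ∀ ⦃a : G⦄ (γ : a ⟶ e), ∀ t ∈ 𝒜.comp γ, s * t ≠ 0 →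
    ∃ t' ∈ 𝒜.comp (Groupoid.inv γ), s * t * t' = s

variable (𝒜) in
/-- A nonzero idempotent `f` of `R_e` such that the right ideal `fR` is gr-simple. -/
structure IsMinIdem (e : G) (f : R) : Prop where
  mem : f ∈ 𝒜.comp (𝟙 e)
  idem : f * f = f
  ne_zero : f ≠ 0
  exists_mul : ∀ ⦃a : G⦄ (γ : a ⟶ e), ∀ z ∈ 𝒜.comp γ, f * z = z → z ≠ 0 →
    ∃ t ∈ 𝒜.comp (Groupoid.inv γ), z * t = f

variable (𝒜) in
/-- Every `1_c` is a finite sum of orthogonal minimal idempotents. -/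
def HasMinIdemDecomposition : Prop :=
  ∀ c : G, ∃ (n : ℕ) (s : Fin n → R), (∀ k, 𝒜.IsMinIdem c (s k)) ∧
    (∀ k l, k ≠ l → s k * s l = 0) ∧ ∑ k, s k = 𝒜.one c

/-- If `st ≠ 0`, then `stR` is a nonzero graded submodule of `S`, hence equal to `S`, and it
contains `s`. -/
theorem IsGrSimpleRightIdeal.isMinElement {S : AddSubgroup R} (hS : 𝒜.IsGrSimpleRightIdeal S)
    {e : G} {s : R} (hs : s ∈ S) (hse : s ∈ 𝒜.comp (𝟙 e)) : 𝒜.IsMinElement e s := by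
  refine ⟨hse, fun a γ t ht h0 => ?_⟩
  have hst : s * t ∈ 𝒜.comp γ := mul_mem_left_id hse ht
  have h1 := isGradedRightIdeal_map_mulLeft isGradedRightIdeal_top hst
  have h2 : AddSubgroup.map (AddMonoidHom.mulLeft (s * t)) ⊤ ≤ S := by
    rintro _ ⟨x, -, rfl⟩
    exact hS.1.2 _ (hS.1.2 _ hs _) _
  have h3 : s ∈ AddSubgroup.map (AddMonoidHom.mulLeft (s * t)) ⊤ := by
    rcases hS.2.2 _ h1 h2 with h | h
    · refine absurd ?_ h0
      rw [← AddSubgroup.mem_bot, ← h]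
      exact ⟨𝒜.one a, trivial, 𝒜.mul_one γ _ hst⟩
    · rw [h]
      exact hs
  obtain ⟨r, -, hr⟩ := h3
  obtain ⟨t', ht', h4⟩ := exists_homogeneous_right_factor hst hse hr.symm
  exact ⟨t', by simpa using ht', h4.symm⟩

/-- Needed only for `x = 1_e`; the general form, with the projection to `R_e`, is what is additive
in `x` and passes through the sum of the gr-simple ideals. -/
theorem exists_sum_isMinElement (h : 𝒜.IsRightGrSemisimple) (e : G) (x : R) :
    ∃ (n : ℕ) (s : Fin n → R), (∀ k, 𝒜.IsMinElement e (s k)) ∧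
      ∑ k, s k = 𝒜.homPart (𝟙 e) x := by
  have hx : x ∈ sSup {S | 𝒜.IsGrSimpleRightIdeal S} := by rw [h]; trivial
  rw [sSup_eq_iSup'] at hx
  induction hx using AddSubgroup.iSup_induction' with
  | hp S x hx =>
    have h1 := isHomogeneous_iff.1 S.2.1.1 x hx (𝟙 e)
    exact ⟨1, fun _ => 𝒜.homPart (𝟙 e) x, fun _ => S.2.isMinElement h1 (homPart_mem _ _), by simp⟩
  | h1 => exact ⟨0, Fin.elim0, fun k => k.elim0, by simp⟩
  | hadd x y _ _ h1 h2 =>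
    obtain ⟨n, s, hs, hs'⟩ := h1
    obtain ⟨m, t, ht, ht'⟩ := h2
    refine ⟨n + m, Fin.append s t, fun k => ?_, ?_⟩
    · refine Fin.addCases (fun k => ?_) (fun k => ?_) k
      · rw [Fin.append_left]; exact hs k
      · rw [Fin.append_right]; exact ht k
    · rw [Fin.sum_univ_add, map_add, ← hs', ← ht']
      simp

/-- The new element lies in `sR`, so each of its nonzero homogeneous multiples generates `sR`. It
serves to absorb a redundant summand into the others. -/
theorem IsMinElement.sub_mul {e : G} {s u : R} (hs : 𝒜.IsMinElement e s)
    (hu : u ∈ 𝒜.comp (𝟙 e)) : 𝒜.IsMinElement e (s - s * u) := by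
  refine ⟨sub_mem hs.1 (mul_mem_left_id hs.1 hu), fun a γ t ht h0 => ?_⟩
  have h1 : (s - s * u) * t = s * (t - u * t) := by
    rw [_root_.sub_mul, mul_sub, mul_assoc]
  obtain ⟨t', ht', h2⟩ := hs.2 γ (t - u * t) (sub_mem ht (mul_mem_left_id hu ht)) (h1 ▸ h0)
  refine ⟨t' - t' * u, sub_mem ht' (mul_mem_right_id hu ht'), ?_⟩
  rw [h1, mul_sub, ← mul_assoc, h2]

/-- Among all ways to write `1_e` as a sum of minimal elements, one with the fewest summands is
taken. Minimality of the number makes the sum of the ideals `s_k R` direct in degree `e`, and the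
summands of `1_e` in a direct sum of right ideals are orthogonal idempotents. -/
theorem hasMinIdemDecomposition_of_rightGrSemisimple (h : 𝒜.IsRightGrSemisimple) :
    𝒜.HasMinIdemDecomposition := by
  classical
  intro e
  have hex : ∃ (n : ℕ) (s : Fin n → R), (∀ k, 𝒜.IsMinElement e (s k)) ∧
      ∑ k, s k = 𝒜.one e := by
    obtain ⟨n, s, hs, hs'⟩ := exists_sum_isMinElement h e (𝒜.one e)
    exact ⟨n, s, hs, hs'.trans (homPart_of_mem (𝒜.one_mem e))⟩
  obtain ⟨s, hs, hsum⟩ := Nat.find_spec hex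
  have hmin : ∀ m < Nat.find hex, ¬ _ := fun m hm => Nat.find_min hex hm
  generalize Nat.find hex = n at s hs hsum hmin
  -- no `s k` lies in the right ideal generated by the other ones
  have hirr : ∀ (k : Fin n) (u : Fin n → R), (∀ j, u j ∈ 𝒜.comp (𝟙 e)) → u k = 0 →
      s k ≠ ∑ j, s j * u j := by
    intro k u hu huk hk
    obtain ⟨m, rfl⟩ : ∃ m, n = m + 1 := ⟨n - 1, by have := k.2; omega⟩
    -- From `s_k = ∑_{j ≠ k} s_j u_j` it follows that `1_e = ∑_{j ≠ k} (s_j + s_j u_j)`, a sum of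
    -- minimal elements with one summand fewer.
    refine hmin m (Nat.lt_succ_self m) ⟨fun j => s (k.succAbove j) - s (k.succAbove j) *
      (- u (k.succAbove j)), fun j => (hs _).sub_mul (neg_mem (hu _)), ?_⟩
    rw [Fin.sum_univ_succAbove _ k, huk, mul_zero, zero_add] at hk
    rw [Fin.sum_univ_succAbove _ k, hk] at hsum
    simp only [mul_neg, sub_neg_eq_add, Finset.sum_add_distrib]
    rw [add_comm]
    exact hsum
  have hne : ∀ k, s k ≠ 0 := fun k hk =>
    hirr k (fun _ => 0) (fun _ => zero_mem _) rfl (by simpa using hk)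
  have hindep : ∀ u : Fin n → R, (∀ j, u j ∈ 𝒜.comp (𝟙 e)) → ∑ j, s j * u j = 0 →
      ∀ k, s k * u k = 0 := by
    intro u hu h0 k
    by_contra hk
    -- Since `s_k u_k t = s_k`, multiplying the relation by `t` solves it for `s_k`, which `hirr`
    -- excludes.
    obtain ⟨t, ht, hkt⟩ := (hs k).2 (𝟙 e) _ (hu k) hk
    have ht' : t ∈ 𝒜.comp (𝟙 e) := by simpa using ht
    refine hirr k (fun j => if j = k then 0 else - (u j * t)) (fun j => ?_) (if_pos rfl) ?_
    · split_ifs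
      · exact zero_mem _
      · exact neg_mem (mul_mem_left_id (hu j) ht')
    · have h1 : ∑ j, s j * (u j * t) = 0 := by
        simp only [← mul_assoc, ← Finset.sum_mul, h0, zero_mul]
      rw [← Finset.add_sum_erase _ _ (Finset.mem_univ k), ← mul_assoc, hkt] at h1
      rw [← Finset.add_sum_erase _ _ (Finset.mem_univ k), if_pos rfl, mul_zero, zero_add,
        eq_neg_of_add_eq_zero_left h1, ← Finset.sum_neg_distrib]
      refine Finset.sum_congr rfl fun j hj => ?_
      rw [if_neg (Finset.ne_of_mem_erase hj), mul_neg]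
  -- `∑_k s_k (s_j - δ_{kj} 1_e) = 1_e s_j - s_j = 0`, so independence kills each term: `s_k s_j =
  -- δ_{kj} s_k`.
  have hmul : ∀ k j, s k * (s j - if k = j then 𝒜.one e else 0) = 0 := by
    intro k j
    refine hindep (fun k => s j - if k = j then 𝒜.one e else 0) (fun k => ?_) ?_ k
    · refine sub_mem (hs j).1 ?_
      split_ifs
      · exact 𝒜.one_mem e
      · exact zero_mem _
    · simp only [mul_sub, Finset.sum_sub_distrib, ← Finset.sum_mul, hsum, mul_ite, mul_zero,
        Finset.sum_ite_eq', Finset.mem_univ, if_true]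
      rw [𝒜.one_mul _ _ (hs j).1, 𝒜.mul_one _ _ (hs j).1, sub_self]
  refine ⟨n, s, fun k => ⟨(hs k).1, ?_, hne k, ?_⟩, fun k l hkl => ?_, hsum⟩
  · have h1 := hmul k k
    rw [if_pos rfl, mul_sub, 𝒜.mul_one _ _ (hs k).1] at h1
    exact sub_eq_zero.1 h1
  · intro a γ z hz hkz hz0
    obtain ⟨t, ht, h1⟩ := (hs k).2 γ z hz (by rwa [hkz])
    exact ⟨t, ht, by rwa [hkz] at h1⟩
  · have h1 := hmul k l
    rwa [if_neg hkl, sub_zero] at h1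

/-- With `zt = f` one gets `z = zf = zzt = zt = f`. Used to recognise products `xy` and `yx` as the
expected idempotents. -/
theorem IsMinIdem.eq_of_idempotent {e : G} {f z : R} (hf : 𝒜.IsMinIdem e f)
    (hz : z ∈ 𝒜.comp (𝟙 e)) (hfz : f * z = z) (hzf : z * f = z) (hzz : z * z = z) (h0 : z ≠ 0) :
    z = f := by
  obtain ⟨t, -, ht⟩ := hf.exists_mul (𝟙 e) z hz hfz h0
  rw [← hzf, ← ht, ← mul_assoc, hzz]

/-- A nonzero homogeneous element of `Rf` generates `Rf`, if `fR` is gr-simple. -/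
theorem HasMinIdemDecomposition.exists_mul_left (h : 𝒜.HasMinIdemDecomposition) {e c : G} {f x : R}
    (hf : 𝒜.IsMinIdem e f) {γ : e ⟶ c} (hx : x ∈ 𝒜.comp γ) (hxf : x * f = x) (hx0 : x ≠ 0) :
    ∃ y ∈ 𝒜.comp (Groupoid.inv γ), f * y = y ∧ y * x = f := by
  obtain ⟨n, s, hs, -, hsum⟩ := h c
  obtain ⟨k, hk⟩ : ∃ k, s k * x ≠ 0 := by
    by_contra! hk
    apply hx0
    rw [← 𝒜.one_mul γ x hx, ← hsum, Finset.sum_mul]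
    exact Finset.sum_eq_zero fun k _ => hk k
  have hkx := mul_mem_left_id (hs k).mem hx
  obtain ⟨t, ht, hxt⟩ := (hs k).exists_mul γ _ hkx (by rw [← mul_assoc, (hs k).idem]) hk
  -- The partner of `x` is `f t s_k` with `s_k x t = s_k`. Its product with `x` is an idempotent of
  -- `f R_e f`, nonzero because `s_k x ≠ 0`, hence equal to `f`.
  have hm : f * t * s k ∈ 𝒜.comp (Groupoid.inv γ) :=
    mul_mem_right_id (hs k).mem (mul_mem_left_id hf.mem ht)
  have hfm : f * (f * t * s k) = f * t * s k := by rw [← mul_assoc, ← mul_assoc, hf.idem]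
  have hsx : s k * x * (f * t * s k) = s k := by
    calc s k * x * (f * t * s k) = s k * (x * f) * t * s k := by simp only [mul_assoc]
      _ = s k := by rw [hxf, hxt, (hs k).idem]
  refine ⟨_, hm, hfm, ?_⟩
  refine hf.eq_of_idempotent (inv_mul_mem hx hm) (by rw [← mul_assoc, hfm])
    (by rw [mul_assoc, hxf]) ?_ ?_
  · calc f * t * s k * x * (f * t * s k * x)
        = f * t * (s k * x * (f * t * s k)) * x := by simp only [mul_assoc]
      _ = _ := by rw [hsx]
  · intro h0
    apply hk
    calc s k * x = s k * x * (f * t * s k) * x := by rw [hsx]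
      _ = s k * x * (f * t * s k * x) := by simp only [mul_assoc]
      _ = 0 := by rw [h0, mul_zero]

/-- By `exists_mul_left` each `Rf` is a gr-simple left ideal, and `x = x 1_a = ∑ x s_k` lies in a
sum of such ideals. -/
theorem HasMinIdemDecomposition.isLeftGrSemisimple (h : 𝒜.HasMinIdemDecomposition) :
    𝒜.IsLeftGrSemisimple := by
  have hsimple : ∀ (e : G) (f : R), 𝒜.IsMinIdem e f →
      𝒜.IsGrSimpleLeftIdeal ((⊤ : AddSubgroup R).map (AddMonoidHom.mulRight f)) := by
    intro e f hf
    refine ⟨⟨?_, ?_⟩, ?_, ?_⟩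
    · refine isHomogeneous_iff.2 ?_
      rintro _ ⟨x, -, rfl⟩ a b γ
      change 𝒜.homPart γ (x * f) ∈ _
      by_cases ha : a = e
      · subst ha
        refine ⟨𝒜.homPart γ x, trivial, ?_⟩
        simpa using (homPart_mul_right γ (𝟙 a) hf.mem x).symm
      · have h1 : (𝒜.homPart γ).comp (AddMonoidHom.mulRight f) = 0 := by
          refine 𝒜.addHom_ext fun a' b' δ x hx => ?_
          change 𝒜.homPart γ (x * f) = 0
          by_cases ha' : a' = e
          · subst ha'
            exact homPart_of_ne (mul_mem_right_id hf.mem hx)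
              fun h => ha (congrArg Quiver.Total.left h).symm
          · rw [𝒜.mul_eq_zero δ (𝟙 e) ha' x hx f hf.mem, map_zero]
        rw [show 𝒜.homPart γ (x * f) = 0 from DFunLike.congr_fun h1 x]
        exact zero_mem _
    · rintro _ ⟨x, -, rfl⟩ r
      exact ⟨r * x, trivial, mul_assoc r x f⟩
    · intro h0
      refine hf.ne_zero ?_
      rw [← AddSubgroup.mem_bot, ← h0]
      exact ⟨f, trivial, hf.idem⟩
    · intro I hI hle
      by_cases hI0 : I = ⊥
      · exact Or.inl hI0
      refine Or.inr (le_antisymm hle ?_)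
      obtain ⟨a, b, γ, x, hxI, hx, hx0⟩ := exists_homogeneous_mem hI.1 hI0
      have hxf : x * f = x := by
        obtain ⟨y, -, rfl⟩ := hle hxI
        change y * f * f = y * f
        rw [mul_assoc, hf.idem]
      obtain rfl : e = a := right_eq_of_mul_ne_zero hx hf.mem (by rwa [hxf])
      obtain ⟨y, -, -, hyx⟩ := h.exists_mul_left hf hx hxf hx0
      rintro _ ⟨r, -, rfl⟩
      change r * f ∈ I
      rw [← hyx, ← mul_assoc]
      exact hI.2 x hxI _
  rw [IsLeftGrSemisimple, eq_top_iff]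
  intro x _
  refine 𝒜.homogeneous_induction (p := fun x => x ∈ _) x (fun a b γ x hx => ?_) (zero_mem _)
    fun _ _ => add_mem
  obtain ⟨n, s, hs, -, hsum⟩ := h a
  rw [← 𝒜.mul_one γ x hx, ← hsum, Finset.mul_sum]
  refine sum_mem fun k _ => ?_
  exact le_sSup (show _ ∈ {S | 𝒜.IsGrSimpleLeftIdeal S} from hsimple a (s k) (hs k))
    ⟨x, trivial, rfl⟩

/-- `R(e)` is the finite direct sum of the gr-simple `s_k R`, so it has finite length. The induction
removes one coordinate `x ↦ s_k x` at a time, comparing the kernel and the image of this map on the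
chain. -/
theorem HasMinIdemDecomposition.isRightArtinian (h : 𝒜.HasMinIdemDecomposition) :
    𝒜.IsRightArtinian := by
  intro e
  obtain ⟨n, s, hs, -, hsum⟩ := h e
  -- `T` is a set of coordinates that together detect every nonzero element of the chain.
  have key : ∀ (T : Finset (Fin n)) (I : ℕ → AddSubgroup R),
      (∀ n, 𝒜.IsGradedRightIdeal (I n)) → Antitone I →
      (∀ m, ∀ x ∈ I m, (∀ k ∈ T, s k * x = 0) → x = 0) → ∃ n, ∀ m, n ≤ m → I m = I n := by
    intro T
    induction T using Finset.induction_on with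
    | empty =>
      intro I _ _ h0
      refine ⟨0, fun m _ => ?_⟩
      have hbot : ∀ m, I m = ⊥ := fun m =>
        (AddSubgroup.eq_bot_iff_forall _).2 fun x hx => h0 m x hx (by simp)
      rw [hbot, hbot]
    | insert k T _ ih =>
      intro I hI hanti h0
      obtain ⟨n₁, hn₁⟩ := ih (fun m => I m ⊓ (⊥ : AddSubgroup R).comap (AddMonoidHom.mulLeft (s k)))
        (fun m => (hI m).inf (isGradedRightIdeal_comap_mulLeft isGradedRightIdeal_bot (hs k).mem))
        (fun m m' hm => inf_le_inf_right _ (hanti hm)) (by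
          intro m x hx hT
          refine h0 m x hx.1 fun j hj => ?_
          rcases Finset.mem_insert.1 hj with rfl | hj
          · exact hx.2
          · exact hT j hj)
      -- the image `s k * I m` is either `0` or contains `s k`
      have hn₂ : ∃ n₂, ∀ m, n₂ ≤ m → ∀ x ∈ I n₂, ∃ y ∈ I m, s k * x = s k * y := by
        by_cases hall : ∀ m, ∃ y ∈ I m, s k * y = s k
        · refine ⟨0, fun m _ x _ => ?_⟩
          obtain ⟨y, hy, hky⟩ := hall m
          exact ⟨y * x, (hI m).2 y hy x, by rw [← mul_assoc, hky]⟩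
        · push Not at hall
          obtain ⟨n₂, hn₂⟩ := hall
          refine ⟨n₂, fun m _ x hx => ⟨0, zero_mem _, ?_⟩⟩
          rw [mul_zero]
          by_contra hkx
          -- A nonzero homogeneous component of `s_k x` stays in `s_k I(n₂)` and generates `s_k R`,
          -- so `s_k` itself would lie in this image.
          obtain ⟨a, b, γ, hγ⟩ := exists_homPart_ne_zero (𝒜 := 𝒜) hkx
          have hz := homPart_mem (𝒜 := 𝒜) γ (s k * x)
          have h1 : (I n₂).map (AddMonoidHom.mulLeft (s k)) |> 𝒜.IsGradedRightIdeal :=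
            isGradedRightIdeal_map_mulLeft (hI n₂) (hs k).mem
          obtain ⟨y, hy, hky⟩ := isHomogeneous_iff.1 h1.1 _ ⟨x, hx, rfl⟩ γ
          change s k * y = 𝒜.homPart γ (s k * x) at hky
          have hkz : s k * 𝒜.homPart γ (s k * x) = 𝒜.homPart γ (s k * x) := by
            rw [← hky, ← mul_assoc, (hs k).idem]
          obtain rfl := right_eq_of_mul_ne_zero (hs k).mem hz (by rwa [hkz])
          obtain ⟨t, -, ht⟩ := (hs k).exists_mul γ _ hz hkz hγ
          exact hn₂ (y * t) ((hI n₂).2 y hy t) (by rw [← mul_assoc, hky, ht])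
      obtain ⟨n₂, hn₂⟩ := hn₂
      have hmono : ∀ m, max n₁ n₂ ≤ m → I n₂ ⊓ I n₁ ≤ I m := by
        intro m hm x hx
        -- The images agree, so `x` can be corrected by some `y ∈ I m` until `x - y` lies in the
        -- kernel, where the chain is already stationary.
        obtain ⟨y, hy, hxy⟩ := hn₂ m (le_of_max_le_right hm) x hx.1
        have h2 : x - y ∈ I n₁ ⊓ (⊥ : AddSubgroup R).comap (AddMonoidHom.mulLeft (s k)) :=
          AddSubgroup.mem_inf.2 ⟨sub_mem hx.2 (hanti (le_of_max_le_left hm) hy), by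
            change s k * (x - y) = 0
            rw [mul_sub, hxy, sub_self]⟩
        have h3 := hn₁ m (le_of_max_le_left hm)
        rw [← h3] at h2
        have := add_mem h2.1 hy
        rwa [sub_add_cancel] at this
      refine ⟨max n₁ n₂, fun m hm => le_antisymm (hanti hm) ?_⟩
      exact (le_inf (hanti (le_max_right _ _)) (hanti (le_max_left _ _))).trans (hmono m hm)
  intro I hI hanti
  refine key Finset.univ I (fun m => (hI m).1) hanti fun m x hx h0 => ?_
  rw [← one_mul_of_mem_rightPart ((hI m).2 hx), ← hsum, Finset.sum_mul]
  exact Finset.sum_eq_zero fun k hk => h0 k hk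

/-! ### Gr-simple right artinian rings are right gr-semisimple. -/

theorem exists_isGrSimpleRightIdeal [Nontrivial R] (h : 𝒜.IsRightArtinian) :
    ∃ S, 𝒜.IsGrSimpleRightIdeal S := by
  obtain ⟨e, he⟩ := exists_one_ne_zero (𝒜 := 𝒜)
  let P := {I : AddSubgroup R // 𝒜.IsGradedRightIdeal I ∧ I ≤ 𝒜.rightPart e}
  have hwf : WellFounded fun I J : P => I < J := by
    refine wellFounded_iff_isEmpty_descending_chain.2 ⟨fun ⟨f, hf⟩ => ?_⟩
    have hanti : StrictAnti f := strictAnti_nat_of_succ_lt hf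
    obtain ⟨n, hn⟩ := h e (fun n => (f n).1) (fun n => (f n).2) fun m n hmn => hanti.antitone hmn
    exact (hf n).ne (Subtype.ext (hn _ (Nat.le_succ n)))
  have hne : ({I : P | I.1 ≠ ⊥} : Set P).Nonempty := by
    refine ⟨⟨_, isGradedRightIdeal_rightPart e, le_rfl⟩, fun h0 => he ?_⟩
    rw [← AddSubgroup.mem_bot, ← h0]
    exact mem_rightPart (𝒜.one_mem e)
  refine ⟨(hwf.min _ hne).1, (hwf.min _ hne).2.1, hwf.min_mem _ hne, fun I hI hle => ?_⟩
  by_contra! hcon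
  refine hwf.not_lt_min {I : P | I.1 ≠ ⊥} (x := ⟨I, hI, hle.trans (hwf.min _ hne).2.2⟩)
    hcon.1 ?_
  exact lt_of_le_of_ne hle fun h' => hcon.2 (congrArg Subtype.val h')

/-- A graded submodule `J` of `zS` pulls back to a graded submodule of `S`, which is `0` or `S`;
then `J` is `0` or `zS`. -/
theorem IsGrSimpleRightIdeal.map_mulLeft {S : AddSubgroup R} (hS : 𝒜.IsGrSimpleRightIdeal S)
    {a b : G} {γ : a ⟶ b} {z : R} (hz : z ∈ 𝒜.comp γ)
    (h0 : S.map (AddMonoidHom.mulLeft z) ≠ ⊥) :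
    𝒜.IsGrSimpleRightIdeal (S.map (AddMonoidHom.mulLeft z)) := by
  refine ⟨isGradedRightIdeal_map_mulLeft hS.1 hz, h0, fun J hJ hle => ?_⟩
  rcases hS.2.2 _ (hS.1.inf (isGradedRightIdeal_comap_mulLeft hJ hz)) inf_le_left with h | h
  · refine Or.inl ((AddSubgroup.eq_bot_iff_forall _).2 fun x hx => ?_)
    obtain ⟨s, hs, rfl⟩ := hle hx
    have h1 : s ∈ S ⊓ J.comap (AddMonoidHom.mulLeft z) := ⟨hs, hx⟩
    rw [h, AddSubgroup.mem_bot] at h1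
    rw [h1, map_zero]
  · refine Or.inr (le_antisymm hle ?_)
    rintro _ ⟨s, hs, rfl⟩
    rw [← h] at hs
    exact hs.2

/-- The sum of all gr-simple right ideals is stable under left multiplication by homogeneous `r`,
since `rS` is `0` or gr-simple. It is thus a nonzero graded two-sided ideal. -/
theorem IsGrSimple.isRightGrSemisimple (h : 𝒜.IsGrSimple) (ha : 𝒜.IsRightArtinian) :
    𝒜.IsRightGrSemisimple := by
  have := h.1
  obtain ⟨S, hS⟩ := exists_isGrSimpleRightIdeal ha
  have hle : ∀ S, 𝒜.IsGrSimpleRightIdeal S → S ≤ sSup {S | 𝒜.IsGrSimpleRightIdeal S} :=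
    fun S hS => le_sSup hS
  have hhom : 𝒜.IsHomogeneous (sSup {S | 𝒜.IsGrSimpleRightIdeal S}) := by
    refine sSup_le fun S hS x hx => ?_
    refine iSup_mono (fun γ => inf_le_inf_right _ (hle S hS)) (hS.1.1 hx)
  refine (h.2 _ ⟨⟨hhom, ?_⟩, hhom, ?_⟩).resolve_left ?_
  · intro x hx r
    rw [sSup_eq_iSup'] at hx
    induction hx using AddSubgroup.iSup_induction' with
    | hp S x hx => exact hle S.1 S.2 (S.2.1.2 x hx r)
    | h1 => rw [zero_mul]; exact zero_mem _
    | hadd x y _ _ h1 h2 => rw [add_mul]; exact add_mem h1 h2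
  · intro x hx r
    refine 𝒜.homogeneous_induction (p := fun r => r * x ∈ _) r (fun a b γ r hr => ?_)
      (by rw [zero_mul]; exact zero_mem _) fun y z h1 h2 => by rw [add_mul]; exact add_mem h1 h2
    rw [sSup_eq_iSup'] at hx
    induction hx using AddSubgroup.iSup_induction' with
    | hp S x hx =>
      by_cases h0 : S.1.map (AddMonoidHom.mulLeft r) = ⊥
      · have h1 : r * x ∈ S.1.map (AddMonoidHom.mulLeft r) := ⟨x, hx, rfl⟩
        rw [h0, AddSubgroup.mem_bot] at h1
        rw [h1]
        exact zero_mem _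
      · exact hle _ (S.2.map_mulLeft hr h0) ⟨x, hx, rfl⟩
    | h1 => rw [mul_zero]; exact zero_mem _
    | hadd x y _ _ h1 h2 => rw [mul_add]; exact add_mem h1 h2
  · intro h0
    exact hS.2.1 (le_bot_iff.1 (h0 ▸ hle S hS))

/-! ### Systems of matrix units -/

variable (𝒜) in
/-- A nonzero idempotent `f` of `R_e` such that `fRf` is a gr-division ring. -/
structure IsDivisionIdem (e : G) (f : R) : Prop where
  mem : f ∈ 𝒜.comp (𝟙 e)
  idem : f * f = f
  ne_zero : f ≠ 0
  exists_inv : ∀ (γ : e ⟶ e), ∀ z ∈ 𝒜.comp γ, f * z = z → z * f = z → z ≠ 0 →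
    ∃ w ∈ 𝒜.comp (Groupoid.inv γ), f * w = w ∧ w * f = w ∧ z * w = f ∧ w * z = f

variable (𝒜) in
/-- Elements `x i ∈ R f` and `y i ∈ f R` of inverse degrees with `y i * x j = δ_{ij} f` and
`1_c = ∑ i, x i * y i`. -/
structure IsUnitSystem {e : G} (f : R) (c : G) {J : Type*} (T : Finset J) (γ : J → (e ⟶ c))
    (x y : J → R) : Prop where
  left_mem : ∀ i ∈ T, x i ∈ 𝒜.comp (γ i)
  right_mem : ∀ i ∈ T, y i ∈ 𝒜.comp (Groupoid.inv (γ i))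
  left_mul : ∀ i ∈ T, x i * f = x i
  mul_right : ∀ i ∈ T, f * y i = y i
  mul_same : ∀ i ∈ T, y i * x i = f
  mul_ne : ∀ i ∈ T, ∀ j ∈ T, i ≠ j → y i * x j = 0
  sum_mul : ∑ i ∈ T, x i * y i = 𝒜.one c

variable (𝒜) in
/-- The ring is an `e`-homogeneous matrix ring over a gr-division ring `fRf`, expressed by
matrix units. -/
def HasMatrixUnits : Prop :=
  ∃ (e : G) (f : R), 𝒜.IsDivisionIdem e f ∧ ∀ c : G, ∃ (n : ℕ) (γ : Fin n → (e ⟶ c))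
    (x y : Fin n → R), 𝒜.IsUnitSystem f c Finset.univ γ x y

theorem IsUnitSystem.exists_fin {e : G} {f : R} {c : G} {J : Type*} {T : Finset J}
    {γ : J → (e ⟶ c)} {x y : J → R} (h : 𝒜.IsUnitSystem f c T γ x y) :
    ∃ (n : ℕ) (γ : Fin n → (e ⟶ c)) (x y : Fin n → R),
      𝒜.IsUnitSystem f c Finset.univ γ x y := by
  let ε := T.equivFin.symm
  refine ⟨T.card, fun k => γ (ε k), fun k => x (ε k), fun k => y (ε k),
    fun k _ => h.left_mem _ (ε k).2, fun k _ => h.right_mem _ (ε k).2,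
    fun k _ => h.left_mul _ (ε k).2, fun k _ => h.mul_right _ (ε k).2,
    fun k _ => h.mul_same _ (ε k).2,
    fun k _ l _ hkl => h.mul_ne _ (ε k).2 _ (ε l).2 fun h' => hkl (ε.injective (Subtype.ext h')),
    ?_⟩
  rw [← h.sum_mul, ← Finset.sum_coe_sort T]
  exact Equiv.sum_comp ε fun i => x i.1 * y i.1

/-- Schur's lemma makes `fRf` a gr-division ring. Gr-simplicity connects `f` with each minimal
idempotent `s_k` below `1_c` by a nonzero homogeneous `x ∈ s_k R f`. -/
theorem hasMatrixUnits_of_isGrSimple (h : 𝒜.IsGrSimple) (hd : 𝒜.HasMinIdemDecomposition) :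
    𝒜.HasMatrixUnits := by
  have := h.1
  obtain ⟨e, he⟩ := exists_one_ne_zero (𝒜 := 𝒜)
  obtain ⟨f, hf⟩ : ∃ f, 𝒜.IsMinIdem e f := by
    obtain ⟨n, s, hs, -, hsum⟩ := hd e
    rcases Nat.eq_zero_or_pos n with rfl | hn
    · rw [Finset.univ_eq_empty, Finset.sum_empty] at hsum
      exact absurd hsum.symm he
    · exact ⟨s ⟨0, hn⟩, hs _⟩
  refine ⟨e, f, ⟨hf.mem, hf.idem, hf.ne_zero, fun γ z hz hfz hzf hz0 => ?_⟩, fun c => ?_⟩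
  · obtain ⟨w, hw, hfw, hwz⟩ := hd.exists_mul_left hf hz hzf hz0
    obtain ⟨t, -, hzt⟩ := hf.exists_mul γ z hz hfz hz0
    -- The left inverse `w` and the right inverse `t` of `z` agree inside the corner, so `wf` is a
    -- two-sided inverse.
    have hwf : w * f = f * t := by
      calc w * f = w * (z * t) := by rw [hzt]
        _ = f * t := by rw [← mul_assoc, hwz]
    have hzw : z * (w * f) = f := by rw [hwf, ← mul_assoc, hzf, hzt]
    refine ⟨w * f, mul_mem_right_id hf.mem hw, ?_, ?_, hzw, ?_⟩
    · rw [← mul_assoc, hfw]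
    · rw [mul_assoc, hf.idem]
    · rw [mul_assoc, hfz, hwz]
  · obtain ⟨n, s, hs, horth, hsum⟩ := hd c
    have key : ∀ k, ∃ (γ : e ⟶ c) (x y : R), x ∈ 𝒜.comp γ ∧ y ∈ 𝒜.comp (Groupoid.inv γ) ∧
        x * f = x ∧ f * y = y ∧ y * x = f ∧ x * y = s k ∧ s k * x = x ∧ y * s k = y := by
      intro k
      -- the annihilator of `s k * R` is a graded ideal different from `R`
      let J : AddSubgroup R :=
        { carrier := {r | ∀ t, s k * t * r = 0}
          zero_mem' := fun t => mul_zero _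
          add_mem' := fun {r r'} hr hr' t => by rw [mul_add, hr t, hr' t, add_zero]
          neg_mem' := fun {r} hr t => by rw [mul_neg, hr t, neg_zero] }
      have hJ : 𝒜.IsGradedIdeal J := by
        have hhom : 𝒜.IsHomogeneous J := by
          refine isHomogeneous_iff.2 fun r hr a b γ t => ?_
          refine 𝒜.homogeneous_induction (p := fun t => s k * t * 𝒜.homPart γ r = 0) t
            (fun a' b' δ t ht => ?_) (by rw [mul_zero, zero_mul])
            fun t t' h1 h2 => by rw [mul_add, add_mul, h1, h2, add_zero]
          by_contra h0
          have h0' : s k * t ≠ 0 := fun h' => h0 (by rw [h', zero_mul])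
          obtain rfl := right_eq_of_mul_ne_zero (hs k).mem ht h0'
          have hst := mul_mem_left_id (hs k).mem ht
          obtain rfl := right_eq_of_mul_ne_zero hst (homPart_mem γ r) h0
          rw [← homPart_mul_left δ γ hst, hr t, map_zero] at h0
          exact h0 rfl
        refine ⟨⟨hhom, fun r hr r' t => ?_⟩, hhom, fun r hr r' t => ?_⟩
        · rw [← mul_assoc, hr, zero_mul]
        · rw [← mul_assoc, mul_assoc (s k), hr]
      have hfJ : f ∉ J := by
        intro hfJ
        rcases h.2 J hJ with h0 | h0
        · rw [h0, AddSubgroup.mem_bot] at hfJ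
          exact hf.ne_zero hfJ
        · have h1 : s k ∈ J := h0 ▸ AddSubgroup.mem_top _
          have h2 := h1 (s k)
          rw [(hs k).idem, (hs k).idem] at h2
          exact (hs k).ne_zero h2
      obtain ⟨t, ht⟩ : ∃ t, s k * t * f ≠ 0 := by
        by_contra! h'
        exact hfJ h'
      obtain ⟨a, b, δ, t, ht, ht0⟩ : ∃ (a b : G) (δ : a ⟶ b) (t : R), t ∈ 𝒜.comp δ ∧
          s k * t * f ≠ 0 := by
        by_contra! h'
        refine ht (𝒜.homogeneous_induction (p := fun t => s k * t * f = 0) t h'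
          (by rw [mul_zero, zero_mul]) fun t t' h1 h2 => by rw [mul_add, add_mul, h1, h2, add_zero])
      obtain rfl := right_eq_of_mul_ne_zero (hs k).mem ht fun h' => ht0 (by rw [h', zero_mul])
      have hst := mul_mem_left_id (hs k).mem ht
      obtain rfl := right_eq_of_mul_ne_zero hst hf.mem ht0
      have hx := mul_mem_right_id hf.mem hst
      have hxf : s k * t * f * f = s k * t * f := by rw [mul_assoc, hf.idem]
      have hsx : s k * (s k * t * f) = s k * t * f := by
        rw [← mul_assoc, ← mul_assoc, (hs k).idem]
      generalize s k * t * f = x at *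
      obtain ⟨y, hy, hfy, hyx⟩ := hd.exists_mul_left hf hx hxf ht0
      have hyx' : y * s k * x = f := by rw [mul_assoc, hsx, hyx]
      have hy' : y * s k ∈ 𝒜.comp (Groupoid.inv δ) := mul_mem_right_id (hs k).mem hy
      refine ⟨δ, x, y * s k, hx, hy', hxf, by rw [← mul_assoc, hfy], hyx', ?_, hsx,
        by rw [mul_assoc, (hs k).idem]⟩
      -- `x y s_k` is a nonzero idempotent of `s_k R_c s_k`, hence equal to `s_k`.
      refine (hs k).eq_of_idempotent (mul_inv_mem hx hy') (by rw [← mul_assoc, hsx])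
        (by rw [mul_assoc, mul_assoc, (hs k).idem]) ?_ fun h0 => ?_
      · rw [mul_assoc, ← mul_assoc (y * s k), hyx', ← mul_assoc f, hfy]
      · apply ht0
        rw [← hxf, ← hyx', ← mul_assoc, h0, zero_mul]
    choose γ x y hx hy hxf hfy hyx hxy hsx hys using key
    refine ⟨n, γ, x, y, fun k _ => hx k, fun k _ => hy k, fun k _ => hxf k, fun k _ => hfy k,
      fun k _ => hyx k, fun k _ l _ hkl => ?_, by simp only [hxy, hsum]⟩
    rw [← hys k, ← hsx l, mul_assoc, ← mul_assoc (s k), horth k l hkl, zero_mul, mul_zero]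

theorem HasMatrixUnits.exists_ne_zero (h : 𝒜.HasMatrixUnits) : ∃ x : R, x ≠ 0 := by
  obtain ⟨e, f, hf, -⟩ := h
  exact ⟨f, hf.ne_zero⟩

/-- As `z = z 1_a = ∑ z x_k y_k`, some `z x_k` is nonzero. This moves `z` into `Rf` without losing
it. -/
theorem exists_corner_ne_zero {e : G} {f : R}
    (hu : ∀ c : G, ∃ (n : ℕ) (γ : Fin n → (e ⟶ c)) (x y : Fin n → R),
      𝒜.IsUnitSystem f c Finset.univ γ x y) {a b : G} {δ : a ⟶ b} {z : R} (hz : z ∈ 𝒜.comp δ)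
    (h0 : z ≠ 0) : ∃ (γ : e ⟶ a) (x : R), x ∈ 𝒜.comp γ ∧ x * f = x ∧ z * x ≠ 0 ∧
      ∃ y ∈ 𝒜.comp (Groupoid.inv γ), f * y = y ∧ y * x = f := by
  obtain ⟨n, γ, x, y, h⟩ := hu a
  obtain ⟨k, hk⟩ : ∃ k, z * x k ≠ 0 := by
    by_contra! hk
    apply h0
    rw [← 𝒜.mul_one δ z hz, ← h.sum_mul, Finset.mul_sum]
    exact Finset.sum_eq_zero fun k _ => by rw [← mul_assoc, hk, zero_mul]
  have ht := Finset.mem_univ k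
  exact ⟨γ k, x k, h.left_mem k ht, h.left_mul k ht, hk, y k, h.right_mem k ht, h.mul_right k ht,
    h.mul_same k ht⟩

/-- The idempotents are `x_k y_k`. For nonzero homogeneous `z ∈ x_k y_k R`, some `y_k z x'` is a
nonzero element of `fRf`; if `w` is its inverse there, then `z (x' w y_k) = x_k y_k`. -/
theorem HasMatrixUnits.hasMinIdemDecomposition (h : 𝒜.HasMatrixUnits) :
    𝒜.HasMinIdemDecomposition := by
  obtain ⟨e, f, hf, hu⟩ := h
  intro c
  obtain ⟨n, γ, x, y, hxy⟩ := hu c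
  have T : ∀ k : Fin n, k ∈ Finset.univ := Finset.mem_univ
  refine ⟨n, fun k => x k * y k, fun k => ⟨mul_inv_mem (hxy.left_mem k (T k))
    (hxy.right_mem k (T k)), ?_, ?_, ?_⟩, ?_, hxy.sum_mul⟩
  · rw [mul_assoc, ← mul_assoc (y k), hxy.mul_same k (T k), hxy.mul_right k (T k)]
  · intro (h0 : x k * y k = 0)
    apply hf.ne_zero
    rw [← hf.idem, ← hxy.mul_same k (T k), mul_assoc, ← mul_assoc (x k), h0, zero_mul, mul_zero]
  · intro a δ z hz hz1 hz0
    have hyz : y k * z ≠ 0 := fun h' => hz0 (by rw [← hz1, mul_assoc, h', mul_zero])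
    have hyz' := 𝒜.mul_mem _ _ _ (hxy.right_mem k (T k)) _ hz
    obtain ⟨ε, x', hx', hx'f, hne, -⟩ := exists_corner_ne_zero hu hyz' hyz
    obtain ⟨w, hw, hfw, hwf, hzw, -⟩ := hf.exists_inv _ _ (𝒜.mul_mem _ _ _ hyz' _ hx')
      (by rw [← mul_assoc, ← mul_assoc, hxy.mul_right k (T k)]) (by rw [mul_assoc, hx'f]) hne
    refine ⟨x' * w * y k, ?_, ?_⟩
    · have h1 := 𝒜.mul_mem _ _ _ (𝒜.mul_mem _ _ _ hx' _ hw) _ (hxy.right_mem k (T k))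
      simpa using h1
    · calc z * (x' * w * y k) = x k * (y k * z * x' * w) * y k := by
            conv_lhs => rw [← hz1]
            simp only [mul_assoc]
        _ = x k * y k := by rw [hzw, hxy.left_mul k (T k)]
  · intro k l hkl
    change x k * y k * (x l * y l) = 0
    rw [mul_assoc, ← mul_assoc (y k), hxy.mul_ne k (T k) l (T l) hkl, zero_mul, mul_zero]

/-- A nonzero graded ideal contains some nonzero homogeneous `y z x ∈ fRf`, which is invertible, so
it contains `f` and then every `1_c = ∑ x_k f y_k`. -/
theorem HasMatrixUnits.isGrSimple (h : 𝒜.HasMatrixUnits) : 𝒜.IsGrSimple := by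
  obtain ⟨x, hx⟩ := h.exists_ne_zero
  refine ⟨⟨x, 0, hx⟩, fun I hI => ?_⟩
  by_cases hI0 : I = ⊥
  · exact Or.inl hI0
  refine Or.inr ?_
  have hd := h.hasMinIdemDecomposition
  obtain ⟨e, f, hf, hu⟩ := h
  obtain ⟨a, b, δ, z, hzI, hz, hz0⟩ := exists_homogeneous_mem hI.1.1 hI0
  obtain ⟨γ, x, hx, hxf, hzx, -⟩ := exists_corner_ne_zero hu hz hz0
  obtain ⟨n, γ', x', y', hxy⟩ := hu b
  have hfI : f ∈ I := by
    have hzx' := 𝒜.mul_mem _ _ _ hz _ hx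
    obtain ⟨k, hk⟩ : ∃ k, y' k * (z * x) ≠ 0 := by
      by_contra! hk
      apply hzx
      rw [← 𝒜.one_mul _ _ hzx', ← hxy.sum_mul, Finset.sum_mul]
      exact Finset.sum_eq_zero fun k _ => by rw [mul_assoc, hk, mul_zero]
    have T := Finset.mem_univ k
    obtain ⟨w, -, -, -, h1, -⟩ := hf.exists_inv _ _ (𝒜.mul_mem _ _ _ (hxy.right_mem k T) _ hzx')
      (by rw [← mul_assoc, hxy.mul_right k T]) (by rw [mul_assoc, mul_assoc, hxf]) hk
    rw [← h1]
    exact hI.1.2 _ (hI.2.2 _ (hI.1.2 _ hzI _) _) _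
  refine eq_top_of_one_mem (𝒜 := 𝒜) hI.1.2 fun c => ?_
  obtain ⟨n, γ', x', y', hxy⟩ := hu c
  rw [← hxy.sum_mul]
  refine sum_mem fun k hk => ?_
  rw [← hxy.left_mul k hk]
  exact hI.1.2 _ (hI.2.2 _ hfI _) _

/-! ### The opposite graded ring -/

variable (𝒜) in
open MulOpposite in
/-- The opposite ring, where the component of degree `γ` is the component of degree `γ⁻¹` of the
given ring. -/
noncomputable def opposite : GrRing G Rᵐᵒᵖ where
  comp _ _ γ := (opAddEquiv : R ≃+ Rᵐᵒᵖ).mapAddSubgroup (𝒜.comp (Groupoid.inv γ))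
  isInternal := by
    classical
    let inv : Mor G → Mor G := fun γ => ⟨γ.right, γ.left, Groupoid.inv γ.hom⟩
    have hinv : Function.Involutive inv := fun ⟨a, b, γ⟩ => by simp [inv]
    have h1 := 𝒜.isInternal.addSubgroup_iSupIndep
    have h2 : iSupIndep fun γ => (opAddEquiv : R ≃+ Rᵐᵒᵖ).mapAddSubgroup
        (𝒜.comp (inv γ).hom) :=
      (h1.comp hinv.injective).map_orderIso (opAddEquiv : R ≃+ Rᵐᵒᵖ).mapAddSubgroup
    refine isInternal_of_indep h2 ?_
    rw [← OrderIso.map_iSup, hinv.surjective.iSup_comp (fun γ : Mor G => 𝒜.comp γ.hom),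
      iSup_eq_top_of_isInternal 𝒜.isInternal, OrderIso.map_top]
  mul_mem := by
    rintro a b c γ δ _ ⟨x, hx, rfl⟩ _ ⟨y, hy, rfl⟩
    refine ⟨y * x, ?_, rfl⟩
    simpa using 𝒜.mul_mem (Groupoid.inv δ) (Groupoid.inv γ) y hy x hx
  mul_eq_zero := by
    rintro a b b' c γ δ hb _ ⟨x, hx, rfl⟩ _ ⟨y, hy, rfl⟩
    change op (y * x) = 0
    rw [𝒜.mul_eq_zero (Groupoid.inv δ) (Groupoid.inv γ) hb.symm y hy x hx, op_zero]
  one e := op (𝒜.one e)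
  one_mem e := ⟨𝒜.one e, by simpa using 𝒜.one_mem e, rfl⟩
  one_mul := by
    rintro a b γ _ ⟨x, hx, rfl⟩
    exact congrArg op (𝒜.mul_one _ x hx)
  mul_one := by
    rintro a b γ _ ⟨x, hx, rfl⟩
    exact congrArg op (𝒜.one_mul _ x hx)

open MulOpposite in
theorem op_mem_opposite_comp {a b : G} {γ : a ⟶ b} {x : R} :
    op x ∈ 𝒜.opposite.comp γ ↔ x ∈ 𝒜.comp (Groupoid.inv γ) :=
  ⟨fun ⟨_, hy, h⟩ => op_injective h ▸ hy, fun h => ⟨x, h, rfl⟩⟩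

open MulOpposite in
theorem unop_mem_comp_inv {a b : G} {γ : a ⟶ b} {x : Rᵐᵒᵖ} (hx : x ∈ 𝒜.opposite.comp γ) :
    unop x ∈ 𝒜.comp (Groupoid.inv γ) := by
  obtain ⟨x, hx, rfl⟩ := hx
  exact hx

/-- The subgroup of the opposite ring that corresponds to a subgroup. -/
abbrev opSubgroup : AddSubgroup R ≃o AddSubgroup Rᵐᵒᵖ :=
  (MulOpposite.opAddEquiv : R ≃+ Rᵐᵒᵖ).mapAddSubgroup

open MulOpposite in
theorem op_mem_opSubgroup {I : AddSubgroup R} {x : R} : op x ∈ opSubgroup I ↔ x ∈ I :=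
  ⟨fun ⟨_, hy, h⟩ => op_injective h ▸ hy, fun h => ⟨x, h, rfl⟩⟩

/-- Passing to the opposite ring permutes the degrees by the involution `γ ↦ γ⁻¹`, which leaves the
sum over all degrees unchanged. -/
theorem isHomogeneous_opposite {I : AddSubgroup R} :
    𝒜.opposite.IsHomogeneous (opSubgroup I) ↔ 𝒜.IsHomogeneous I := by
  let inv : Mor G → Mor G := fun γ => ⟨γ.right, γ.left, Groupoid.inv γ.hom⟩
  have hinv : Function.Involutive inv := fun ⟨a, b, γ⟩ => by simp [inv]
  have h1 : (⨆ γ : Mor G, opSubgroup I ⊓ 𝒜.opposite.comp γ.hom)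
      = opSubgroup (⨆ γ : Mor G, I ⊓ 𝒜.comp γ.hom) := by
    rw [← hinv.surjective.iSup_comp (fun γ : Mor G => I ⊓ 𝒜.comp γ.hom), OrderIso.map_iSup]
    simp only [OrderIso.map_inf]
    rfl
  rw [IsHomogeneous, h1, OrderIso.le_iff_le]
  rfl

theorem isGradedRightIdeal_opposite {I : AddSubgroup R} :
    𝒜.opposite.IsGradedRightIdeal (opSubgroup I) ↔ 𝒜.IsGradedLeftIdeal I :=
  and_congr isHomogeneous_opposite
    ⟨fun h x hx r => op_mem_opSubgroup.1 (h _ (op_mem_opSubgroup.2 hx) (MulOpposite.op r)),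
      fun h x hx r => by
        obtain ⟨x, hx, rfl⟩ := hx
        exact op_mem_opSubgroup.2 (h x hx r.unop)⟩

theorem isGradedLeftIdeal_opposite {I : AddSubgroup R} :
    𝒜.opposite.IsGradedLeftIdeal (opSubgroup I) ↔ 𝒜.IsGradedRightIdeal I :=
  and_congr isHomogeneous_opposite
    ⟨fun h x hx r => op_mem_opSubgroup.1 (h _ (op_mem_opSubgroup.2 hx) (MulOpposite.op r)),
      fun h x hx r => by
        obtain ⟨x, hx, rfl⟩ := hx
        exact op_mem_opSubgroup.2 (h x hx r.unop)⟩

theorem opSubgroup_ne_bot {I : AddSubgroup R} : opSubgroup I ≠ ⊥ ↔ I ≠ ⊥ := by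
  rw [Ne, Ne, map_eq_bot_iff]

theorem isGrSimpleRightIdeal_opposite {I : AddSubgroup R} :
    𝒜.opposite.IsGrSimpleRightIdeal (opSubgroup I) ↔ 𝒜.IsGrSimpleLeftIdeal I := by
  refine and_congr isGradedRightIdeal_opposite (and_congr opSubgroup_ne_bot ?_)
  rw [opSubgroup.surjective.forall]
  simp only [isGradedRightIdeal_opposite, OrderIso.le_iff_le, map_eq_bot_iff,
    EmbeddingLike.apply_eq_iff_eq]

theorem isGrSimpleLeftIdeal_opposite {I : AddSubgroup R} :
    𝒜.opposite.IsGrSimpleLeftIdeal (opSubgroup I) ↔ 𝒜.IsGrSimpleRightIdeal I := by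
  refine and_congr isGradedLeftIdeal_opposite (and_congr opSubgroup_ne_bot ?_)
  rw [opSubgroup.surjective.forall]
  simp only [isGradedLeftIdeal_opposite, OrderIso.le_iff_le, map_eq_bot_iff,
    EmbeddingLike.apply_eq_iff_eq]

theorem isRightGrSemisimple_opposite :
    𝒜.opposite.IsRightGrSemisimple ↔ 𝒜.IsLeftGrSemisimple := by
  have h : {S | 𝒜.opposite.IsGrSimpleRightIdeal S}
      = opSubgroup '' {S | 𝒜.IsGrSimpleLeftIdeal S} := by
    ext S
    obtain ⟨S, rfl⟩ := opSubgroup.surjective S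
    rw [opSubgroup.injective.mem_set_image]
    exact isGrSimpleRightIdeal_opposite
  rw [IsRightGrSemisimple, IsLeftGrSemisimple, h, sSup_image, ← OrderIso.map_sSup, map_eq_top_iff]

theorem isLeftGrSemisimple_opposite :
    𝒜.opposite.IsLeftGrSemisimple ↔ 𝒜.IsRightGrSemisimple := by
  have h : {S | 𝒜.opposite.IsGrSimpleLeftIdeal S}
      = opSubgroup '' {S | 𝒜.IsGrSimpleRightIdeal S} := by
    ext S
    obtain ⟨S, rfl⟩ := opSubgroup.surjective S
    rw [opSubgroup.injective.mem_set_image]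
    exact isGrSimpleLeftIdeal_opposite
  rw [IsLeftGrSemisimple, IsRightGrSemisimple, h, sSup_image, ← OrderIso.map_sSup, map_eq_top_iff]

/-- Right and left graded semisimplicity are equivalent. -/
theorem isRightGrSemisimple_iff_isLeftGrSemisimple :
    𝒜.IsRightGrSemisimple ↔ 𝒜.IsLeftGrSemisimple :=
  ⟨fun h => (hasMinIdemDecomposition_of_rightGrSemisimple h).isLeftGrSemisimple,
    fun h => isLeftGrSemisimple_opposite.1 (hasMinIdemDecomposition_of_rightGrSemisimple
      (isRightGrSemisimple_opposite.2 h)).isLeftGrSemisimple⟩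

theorem rightPart_opposite (e : G) : 𝒜.opposite.rightPart e = opSubgroup (𝒜.leftPart e) := by
  simp only [rightPart, leftPart, OrderIso.map_iSup]
  refine iSup_congr fun a => ?_
  have h : Function.Surjective fun γ : a ⟶ e => Groupoid.inv γ := fun γ =>
    ⟨Groupoid.inv γ, by simp⟩
  exact h.iSup_comp fun γ : e ⟶ a => opSubgroup (𝒜.comp γ)

theorem isRightArtinian_opposite : 𝒜.opposite.IsRightArtinian ↔ 𝒜.IsLeftArtinian := by
  refine forall_congr' fun e => ?_
  have h : Function.Surjective fun (I : ℕ → AddSubgroup R) n => opSubgroup (I n) :=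
    opSubgroup.surjective.comp_left
  rw [h.forall]
  simp only [isGradedRightIdeal_opposite, rightPart_opposite, OrderIso.le_iff_le,
    EmbeddingLike.apply_eq_iff_eq, Antitone]

theorem isGrSimple_opposite : 𝒜.opposite.IsGrSimple ↔ 𝒜.IsGrSimple := by
  refine and_congr ⟨fun _ => MulOpposite.opEquiv.nontrivial, fun _ => inferInstance⟩ ?_
  rw [opSubgroup.surjective.forall]
  simp only [IsGradedIdeal, isGradedRightIdeal_opposite, isGradedLeftIdeal_opposite,
    map_eq_bot_iff, map_eq_top_iff]
  exact forall_congr' fun I => imp_congr_left and_comm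

open MulOpposite in
-- The `x_k` and the `y_k` exchange roles; the degree `γ_k` of the system is unchanged, because both
-- the degrees and the sides are reversed.
theorem HasMatrixUnits.opposite (h : 𝒜.HasMatrixUnits) : 𝒜.opposite.HasMatrixUnits := by
  obtain ⟨e, f, hf, hu⟩ := h
  refine ⟨e, op f, ⟨op_mem_opposite_comp.2 (by simpa using hf.mem), congrArg op hf.idem,
    (op_ne_zero_iff f).2 hf.ne_zero, ?_⟩, fun c => ?_⟩
  · rintro γ _ ⟨z, hz, rfl⟩ hfz hzf hz0
    obtain ⟨w, hw, h1, h2, h3, h4⟩ := hf.exists_inv _ z hz (op_injective hzf) (op_injective hfz)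
      fun h => hz0 (by rw [h, map_zero])
    exact ⟨op w, op_mem_opposite_comp.2 hw, congrArg op h2, congrArg op h1, congrArg op h4,
      congrArg op h3⟩
  · obtain ⟨n, γ, x, y, hxy⟩ := hu c
    refine ⟨n, γ, fun k => op (y k), fun k => op (x k),
      fun k hk => op_mem_opposite_comp.2 (hxy.right_mem k hk),
      fun k hk => op_mem_opposite_comp.2 (by simpa using hxy.left_mem k hk),
      fun k hk => congrArg op (hxy.mul_right k hk), fun k hk => congrArg op (hxy.left_mul k hk),
      fun k hk => congrArg op (hxy.mul_same k hk),
      fun k hk l hl hkl => congrArg op (hxy.mul_ne l hl k hk hkl.symm), ?_⟩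
    have h1 := congrArg (opAddEquiv : R ≃+ Rᵐᵒᵖ) hxy.sum_mul
    rw [map_sum] at h1
    exact h1

open MulOpposite in
-- Done directly, since the double opposite is a different type from `R`.
theorem HasMatrixUnits.of_opposite (h : 𝒜.opposite.HasMatrixUnits) : 𝒜.HasMatrixUnits := by
  obtain ⟨e, f, hf, hu⟩ := h
  refine ⟨e, unop f, ⟨by simpa using unop_mem_comp_inv hf.mem, congrArg unop hf.idem,
    (unop_ne_zero_iff f).2 hf.ne_zero, ?_⟩, fun c => ?_⟩
  · intro γ z hz hfz hzf hz0
    obtain ⟨w, hw, h1, h2, h3, h4⟩ := hf.exists_inv (Groupoid.inv γ) (op z)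
      (op_mem_opposite_comp.2 (by simpa using hz)) (congrArg op hzf) (congrArg op hfz)
      ((op_ne_zero_iff z).2 hz0)
    exact ⟨unop w, by simpa using unop_mem_comp_inv hw, congrArg unop h2, congrArg unop h1,
      congrArg unop h4, congrArg unop h3⟩
  · obtain ⟨n, γ, x, y, hxy⟩ := hu c
    refine ⟨n, γ, fun k => unop (y k), fun k => unop (x k),
      fun k hk => by simpa using unop_mem_comp_inv (hxy.right_mem k hk),
      fun k hk => unop_mem_comp_inv (hxy.left_mem k hk),
      fun k hk => congrArg unop (hxy.mul_right k hk),
      fun k hk => congrArg unop (hxy.left_mul k hk),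
      fun k hk => congrArg unop (hxy.mul_same k hk),
      fun k hk l hl hkl => congrArg unop (hxy.mul_ne l hl k hk hkl.symm), ?_⟩
    have h1 := congrArg (opAddEquiv : R ≃+ Rᵐᵒᵖ).symm hxy.sum_mul
    rw [map_sum] at h1
    exact h1

theorem hasMatrixUnits_iff_right : 𝒜.HasMatrixUnits ↔ 𝒜.IsGrSimple ∧ 𝒜.IsRightArtinian :=
  ⟨fun h => ⟨h.isGrSimple, h.hasMinIdemDecomposition.isRightArtinian⟩,
    fun h => hasMatrixUnits_of_isGrSimple h.1
      (hasMinIdemDecomposition_of_rightGrSemisimple (h.1.isRightGrSemisimple h.2))⟩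

theorem hasMatrixUnits_iff_left : 𝒜.HasMatrixUnits ↔ 𝒜.IsGrSimple ∧ 𝒜.IsLeftArtinian := by
  rw [← isGrSimple_opposite, ← isRightArtinian_opposite, ← hasMatrixUnits_iff_right]
  exact ⟨HasMatrixUnits.opposite, HasMatrixUnits.of_opposite⟩

end GrRing

/-! ### Graded homomorphisms -/

section Iso

variable {G : Type w} [Groupoid.{v} G] {R S : Type*} [NonUnitalRing R] [NonUnitalRing S]
  {𝒜 : GrRing G R} {ℬ : GrRing G S}

open GrRing

theorem homPart_map {φ : R →+ S} (hφ : ∀ ⦃a b : G⦄ (γ : a ⟶ b), ∀ x ∈ 𝒜.comp γ, φ x ∈ ℬ.comp γ)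
    {a b : G} (γ : a ⟶ b) (x : R) : ℬ.homPart γ (φ x) = φ (𝒜.homPart γ x) := by
  suffices h : (ℬ.homPart γ).comp φ = φ.comp (𝒜.homPart γ) from DFunLike.congr_fun h x
  refine 𝒜.addHom_ext fun a' b' δ x hx => ?_
  change ℬ.homPart γ (φ x) = φ (𝒜.homPart γ x)
  by_cases h : (⟨a', b', δ⟩ : Mor G) = ⟨a, b, γ⟩
  · cases h
    rw [homPart_of_mem hx, homPart_of_mem (hφ _ _ hx)]
  · rw [homPart_of_ne hx h, homPart_of_ne (hφ _ _ hx) h, map_zero]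

/-- An additive map is a gr-isomorphism if it is multiplicative and restricts to bijections of the
homogeneous components. -/
theorem grIsomorphic_of_components (φ : R →+ S)
    (hφ : ∀ ⦃a b : G⦄ (γ : a ⟶ b), ∀ x ∈ 𝒜.comp γ, φ x ∈ ℬ.comp γ)
    (hmul : ∀ ⦃a b : G⦄ (γ : a ⟶ b), ∀ x ∈ 𝒜.comp γ, ∀ y, φ (x * y) = φ x * φ y)
    (hinj : ∀ ⦃a b : G⦄ (γ : a ⟶ b), ∀ x ∈ 𝒜.comp γ, φ x = 0 → x = 0)
    (hsurj : ∀ ⦃a b : G⦄ (γ : a ⟶ b), ∀ y ∈ ℬ.comp γ, ∃ x ∈ 𝒜.comp γ, φ x = y) :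
    GrIsomorphic 𝒜 ℬ := by
  have hmul' : ∀ x y, φ (x * y) = φ x * φ y := fun x y =>
    𝒜.homogeneous_induction (p := fun x => φ (x * y) = φ x * φ y) x
      (fun a b γ x hx => hmul γ x hx y) (by simp)
      fun x x' h1 h2 => by rw [add_mul, map_add, h1, h2, map_add, add_mul]
  have hinj' : Function.Injective φ := by
    refine (injective_iff_map_eq_zero φ).2 fun x hx => ?_
    by_contra hx0
    obtain ⟨a, b, γ, hγ⟩ := exists_homPart_ne_zero (𝒜 := 𝒜) hx0
    refine hγ (hinj γ _ (homPart_mem γ x) ?_)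
    rw [← homPart_map hφ, hx, map_zero]
  have hsurj' : Function.Surjective φ := fun y => by
    refine ℬ.homogeneous_induction (p := fun y => ∃ x, φ x = y) y (fun a b γ y hy => ?_)
      ⟨0, map_zero φ⟩ fun _ _ => ?_
    · obtain ⟨x, -, h⟩ := hsurj γ y hy
      exact ⟨x, h⟩
    · rintro ⟨x, rfl⟩ ⟨x', rfl⟩
      exact ⟨x + x', map_add φ x x'⟩
  let ψ : R →ₙ+* S := { φ with map_mul' := hmul', map_zero' := map_zero φ }
  refine ⟨RingEquiv.ofBijective ψ ⟨hinj', hsurj'⟩, hφ, fun e => ?_⟩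
  change φ (𝒜.one e) = ℬ.one e
  -- Units are preserved automatically: if `φ x = 1_e` with `x` of degree `e`, then `φ 1_e = φ 1_e ·
  -- φ x = φ (1_e x) = φ x = 1_e`.
  obtain ⟨x, hx, h⟩ := hsurj (𝟙 e) _ (ℬ.one_mem e)
  have h1 := ℬ.mul_one (𝟙 e) _ (hφ (𝟙 e) _ (𝒜.one_mem e))
  rw [← h1, ← h, ← hmul', 𝒜.one_mul (𝟙 e) x hx]

theorem HasMatrixUnits.of_grIsomorphic (h : GrIsomorphic 𝒜 ℬ) (hℬ : ℬ.HasMatrixUnits) :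
    𝒜.HasMatrixUnits := by
  obtain ⟨φ, hφ, hone⟩ := h
  -- The inverse preserves degrees as well, because `φ` commutes with taking homogeneous components
  -- and is injective.
  have hsymm : ∀ ⦃a b : G⦄ (γ : a ⟶ b), ∀ y ∈ ℬ.comp γ, φ.symm y ∈ 𝒜.comp γ := by
    intro a b γ y hy
    have h1 := homPart_map (φ := (φ : R →+ S)) hφ γ (φ.symm y)
    have h2 : 𝒜.homPart γ (φ.symm y) = φ.symm y := by
      apply φ.injective
      change (φ : R →+ S) _ = _
      rw [← h1]
      change ℬ.homPart γ (φ (φ.symm y)) = φ (φ.symm y)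
      rw [φ.apply_symm_apply, homPart_of_mem hy]
    rw [← h2]
    exact homPart_mem γ _
  obtain ⟨e, f, hf, hu⟩ := hℬ
  have hmap : ∀ {x y z : S}, x * y = z → φ.symm x * φ.symm y = φ.symm z := fun h => by
    rw [← map_mul, h]
  refine ⟨e, φ.symm f, ⟨hsymm _ _ hf.mem, hmap hf.idem, ?_, ?_⟩, fun c => ?_⟩
  · exact fun h0 => hf.ne_zero (φ.symm.injective (h0.trans (map_zero _).symm))
  · intro γ z hz hfz hzf hz0
    obtain ⟨w, hw, h1, h2, h3, h4⟩ := hf.exists_inv γ (φ z) (hφ γ z hz)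
      (by rw [← φ.apply_symm_apply f, ← map_mul, hfz])
      (by rw [← φ.apply_symm_apply f, ← map_mul, hzf])
      (fun h0 => hz0 (φ.injective (h0.trans (map_zero _).symm)))
    have h5 := hmap h3
    have h6 := hmap h4
    rw [φ.symm_apply_apply] at h5 h6
    exact ⟨φ.symm w, hsymm _ _ hw, hmap h1, hmap h2, h5, h6⟩
  · obtain ⟨n, γ, x, y, hxy⟩ := hu c
    refine ⟨n, γ, fun k => φ.symm (x k), fun k => φ.symm (y k),
      fun k hk => hsymm _ _ (hxy.left_mem k hk), fun k hk => hsymm _ _ (hxy.right_mem k hk),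
      fun k hk => hmap (hxy.left_mul k hk), fun k hk => hmap (hxy.mul_right k hk),
      fun k hk => hmap (hxy.mul_same k hk),
      fun k hk l hl hkl => (hmap (hxy.mul_ne k hk l hl hkl)).trans (map_zero _), ?_⟩
    simp only [← map_mul, ← map_sum, hxy.sum_mul]
    rw [← hone, φ.symm_apply_apply]

end Iso

namespace GrRing

variable {G : Type w} [Groupoid.{v} G] {R : Type u} [NonUnitalRing R] {𝒜 : GrRing G R}

/-! ### A global system of matrix units -/

variable (𝒜) in
/-- A system of matrix units for all objects at once: the elements `x i`, `y i` with `c i = c`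
form the system that belongs to the object `c`. -/
structure IsGlobalUnitSystem {e : G} (f : R) {I : Type*} {c : I → G} (γ : ∀ i, e ⟶ c i)
    (x y : I → R) (T : G → Finset I) : Prop where
  left_mem : ∀ i, x i ∈ 𝒜.comp (γ i)
  right_mem : ∀ i, y i ∈ 𝒜.comp (Groupoid.inv (γ i))
  left_mul : ∀ i, x i * f = x i
  mul_right : ∀ i, f * y i = y i
  mul_same : ∀ i, y i * x i = f
  mul_ne : ∀ i j, i ≠ j → y i * x j = 0
  mem_iff : ∀ c' i, i ∈ T c' ↔ c i = c'
  sum_mul : ∀ c', ∑ i ∈ T c', x i * y i = 𝒜.one c'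

/-- The natural index set of pairs `(c, k)` lives in the universe of the objects. The `x_p` are
distinct, since `y_p x_p = f ≠ 0` while `y_p x_q = 0`; so the index set embeds in `R` and can be
shrunk to its universe. -/
theorem HasMatrixUnits.exists_global (h : 𝒜.HasMatrixUnits) :
    ∃ (e : G) (f : R) (I : Type u) (c : I → G) (γ : ∀ i, e ⟶ c i) (x y : I → R)
      (T : G → Finset I), 𝒜.IsDivisionIdem e f ∧ 𝒜.IsGlobalUnitSystem f γ x y T := by
  obtain ⟨e, f, hf, hu⟩ := h
  choose n γ x y hxy using hu
  have M : ∀ {c} (k : Fin (n c)), k ∈ Finset.univ := fun k => Finset.mem_univ k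
  have hne : ∀ p q : Σ c, Fin (n c), p ≠ q → y p.1 p.2 * x q.1 q.2 = 0 := by
    rintro ⟨c, k⟩ ⟨c', k'⟩ hpq
    by_cases hc : c = c'
    · subst hc
      exact (hxy c).mul_ne k (M k) k' (M k') fun h => hpq (by rw [h])
    · exact 𝒜.mul_eq_zero _ _ hc _ ((hxy c).right_mem k (M k)) _ ((hxy c').left_mem k' (M k'))
  have hinj : Function.Injective fun p : Σ c, Fin (n c) => x p.1 p.2 := by
    intro p q hpq
    by_contra hne'
    have h1 := hne p q hne'
    rw [← show x p.1 p.2 = x q.1 q.2 from hpq, (hxy p.1).mul_same _ (M _)] at h1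
    exact hf.ne_zero h1
  have := small_of_injective hinj
  let ε : Shrink.{u} (Σ c, Fin (n c)) ≃ Σ c, Fin (n c) := (equivShrink _).symm
  refine ⟨e, f, Shrink.{u} (Σ c, Fin (n c)), fun i => (ε i).1, fun i => γ (ε i).1 (ε i).2,
    fun i => x (ε i).1 (ε i).2, fun i => y (ε i).1 (ε i).2,
    fun c => Finset.univ.map ((Function.Embedding.sigmaMk c).trans ε.symm.toEmbedding), hf,
    fun i => (hxy _).left_mem _ (M _), fun i => (hxy _).right_mem _ (M _),
    fun i => (hxy _).left_mul _ (M _), fun i => (hxy _).mul_right _ (M _),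
    fun i => (hxy _).mul_same _ (M _), fun i j hij => hne _ _ (ε.injective.ne hij), ?_, ?_⟩
  · intro c' i
    rw [Finset.mem_map]
    constructor
    · rintro ⟨k, -, rfl⟩
      simp
    · rintro rfl
      exact ⟨(ε i).2, M _, by simp⟩
  · intro c'
    rw [Finset.sum_map, ← (hxy c').sum_mul]
    refine Finset.sum_congr rfl fun k _ => ?_
    have h1 : ε (((Function.Embedding.sigmaMk c').trans ε.symm.toEmbedding) k) = ⟨c', k⟩ :=
      ε.apply_symm_apply _
    rw [h1]

/-! ### The corner ring `fRf` and the module `Rf` -/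

/-- The subgroup `fRf` for an idempotent `f`. -/
def cornerSubgroup (f : R) : AddSubgroup R where
  carrier := {r | f * r = r ∧ r * f = r}
  zero_mem' := ⟨mul_zero f, zero_mul f⟩
  add_mem' := fun {r s} hr hs => ⟨by rw [mul_add, hr.1, hs.1], by rw [add_mul, hr.2, hs.2]⟩
  neg_mem' := fun {r} hr => ⟨by rw [mul_neg, hr.1], by rw [neg_mul, hr.2]⟩

/-- The subgroup `Rf` for an idempotent `f`. -/
def leftSubgroup (f : R) : AddSubgroup R where
  carrier := {r | r * f = r}
  zero_mem' := zero_mul f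
  add_mem' := fun {r s} (hr : _ = _) (hs : _ = _) => show _ = _ by rw [add_mul, hr, hs]
  neg_mem' := fun {r} (hr : _ = _) => show _ = _ by rw [neg_mul, hr]

variable (𝒜)

theorem iSupIndep_comp : iSupIndep fun γ : Mor G => 𝒜.comp γ.hom := by
  classical
  exact 𝒜.isInternal.addSubgroup_iSupIndep

/-- The component of degree `γ` of `fRf`. -/
def cornerComp (f : R) ⦃a b : G⦄ (γ : a ⟶ b) : AddSubgroup R := 𝒜.comp γ ⊓ cornerSubgroup f

/-- The component of degree `γ` of `Rf`. -/
def leftComp (f : R) ⦃a b : G⦄ (γ : a ⟶ b) : AddSubgroup R := 𝒜.comp γ ⊓ leftSubgroup f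

theorem cornerComp_mul_mem (f : R) ⦃a b c : G⦄ (γ : b ⟶ c) (δ : a ⟶ b) :
    ∀ x ∈ 𝒜.cornerComp f γ, ∀ y ∈ 𝒜.cornerComp f δ, x * y ∈ 𝒜.cornerComp f (δ ≫ γ) :=
  fun x hx y hy => ⟨𝒜.mul_mem γ δ x hx.1 y hy.1, by rw [← mul_assoc, hx.2.1],
    by rw [mul_assoc, hy.2.2]⟩

theorem cornerComp_mul_eq_zero (f : R) ⦃a b b' c : G⦄ (γ : b' ⟶ c) (δ : a ⟶ b) (hb : b' ≠ b) :
    ∀ x ∈ 𝒜.cornerComp f γ, ∀ y ∈ 𝒜.cornerComp f δ, x * y = 0 :=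
  fun x hx y hy => 𝒜.mul_eq_zero γ δ hb x hx.1 y hy.1

theorem leftComp_mul_mem (f : R) ⦃a b c : G⦄ (γ : b ⟶ c) (δ : a ⟶ b) :
    ∀ x ∈ 𝒜.leftComp f γ, ∀ y ∈ 𝒜.leftComp f δ, x * y ∈ 𝒜.leftComp f (δ ≫ γ) :=
  fun x hx y hy => ⟨𝒜.mul_mem γ δ x hx.1 y hy.1,
    show x * y * f = x * y by rw [mul_assoc, show y * f = y from hy.2]⟩

theorem leftComp_mul_eq_zero (f : R) ⦃a b b' c : G⦄ (γ : b' ⟶ c) (δ : a ⟶ b) (hb : b' ≠ b) :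
    ∀ x ∈ 𝒜.leftComp f γ, ∀ y ∈ 𝒜.leftComp f δ, x * y = 0 :=
  fun x hx y hy => 𝒜.mul_eq_zero γ δ hb x hx.1 y hy.1

/-- The ring `fRf`. -/
def Corner (f : R) : NonUnitalSubring R :=
  familyRing (𝒜.cornerComp f) (𝒜.cornerComp_mul_mem f) (𝒜.cornerComp_mul_eq_zero f)

/-- The left ideal `Rf`. -/
def LeftCorner (f : R) : NonUnitalSubring R :=
  familyRing (𝒜.leftComp f) (𝒜.leftComp_mul_mem f) (𝒜.leftComp_mul_eq_zero f)

variable {𝒜} {e : G} {f : R}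

theorem Corner.mem_cornerSubgroup {r : R} (hr : r ∈ 𝒜.Corner f) : r ∈ cornerSubgroup f := by
  have h : (⨆ γ : Mor G, 𝒜.cornerComp f γ.hom) ≤ cornerSubgroup f := iSup_le fun γ => inf_le_right
  exact h hr

theorem LeftCorner.mul_eq {r : R} (hr : r ∈ 𝒜.LeftCorner f) : r * f = r := by
  have h : (⨆ γ : Mor G, 𝒜.leftComp f γ.hom) ≤ leftSubgroup f := iSup_le fun γ => inf_le_right
  exact h hr

/-- `Corner` is built as a sum of homogeneous pieces; together with `mem_corner` this gives
membership by the equations `fr = r = rf`. -/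
theorem mul_mul_mem_corner (hf : f ∈ 𝒜.comp (𝟙 e)) (hff : f * f = f) (r : R) :
    f * r * f ∈ 𝒜.Corner f := by
  refine 𝒜.homogeneous_induction (p := fun r => f * r * f ∈ 𝒜.Corner f) r
    (fun a b γ r hr => ?_) (by rw [mul_zero, zero_mul]; exact zero_mem _)
    fun x y hx hy => by rw [mul_add, add_mul]; exact add_mem hx hy
  by_cases h0 : f * r * f = 0
  · rw [h0]
    exact zero_mem _
  obtain rfl := right_eq_of_mul_ne_zero hf hr fun h' => h0 (by rw [h', zero_mul])
  have hfr := mul_mem_left_id hf hr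
  obtain rfl := right_eq_of_mul_ne_zero hfr hf h0
  exact AddSubgroup.mem_iSup_of_mem (⟨_, _, γ⟩ : Mor G) ⟨mul_mem_right_id hf hfr,
    by rw [← mul_assoc, ← mul_assoc, hff], by rw [mul_assoc, hff]⟩

theorem mem_corner (hf : f ∈ 𝒜.comp (𝟙 e)) (hff : f * f = f) {r : R} (h1 : f * r = r)
    (h2 : r * f = r) : r ∈ 𝒜.Corner f := by
  have := mul_mul_mem_corner hf hff r
  rwa [h1, h2] at this

theorem mem_leftCorner (hf : f ∈ 𝒜.comp (𝟙 e)) (hff : f * f = f) {r : R} (h : r * f = r) :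
    r ∈ 𝒜.LeftCorner f := by
  rw [← h]
  refine 𝒜.homogeneous_induction (p := fun r => r * f ∈ 𝒜.LeftCorner f) r
    (fun a b γ r hr => ?_) (by rw [zero_mul]; exact zero_mem _)
    fun x y hx hy => by rw [add_mul]; exact add_mem hx hy
  by_cases h0 : r * f = 0
  · rw [h0]
    exact zero_mem _
  obtain rfl := right_eq_of_mul_ne_zero hr hf h0
  exact AddSubgroup.mem_iSup_of_mem (⟨_, _, γ⟩ : Mor G) ⟨mul_mem_right_id hf hr,
    show _ = _ by rw [mul_assoc, hff]⟩

theorem eq_of_mem_cornerComp (hf : f ∈ 𝒜.comp (𝟙 e)) {a b : G} {γ : a ⟶ b} {r : R}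
    (hr : r ∈ 𝒜.cornerComp f γ) (h0 : r ≠ 0) : a = e ∧ b = e :=
  ⟨(right_eq_of_mul_ne_zero hr.1 hf (by rwa [hr.2.2])).symm,
    right_eq_of_mul_ne_zero hf hr.1 (by rwa [hr.2.1])⟩

/-- The grading of the ring `fRf`. -/
noncomputable def cornerGrading (hf : f ∈ 𝒜.comp (𝟙 e)) (hff : f * f = f) :
    GrRing G (𝒜.Corner f) :=
  familyGrading (𝒜.cornerComp f) (𝒜.cornerComp_mul_mem f) (𝒜.cornerComp_mul_eq_zero f)
    -- The element `f 1_c` is `f` for `c = e` and `0` for every other object.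
    (𝒜.iSupIndep_comp.mono fun _ => inf_le_left) (fun c => f * 𝒜.one c)
    (by
      intro c
      by_cases hc : e = c
      · subst hc
        rw [𝒜.mul_one _ f hf]
        exact ⟨hf, hff, hff⟩
      · rw [𝒜.mul_eq_zero _ _ hc f hf _ (𝒜.one_mem c)]
        exact zero_mem _)
    (by
      intro a b γ x hx
      rw [mul_assoc, 𝒜.one_mul γ x hx.1, hx.2.1])
    (by
      intro a b γ x hx
      rw [← mul_assoc, hx.2.2, 𝒜.mul_one γ x hx.1])

theorem IsDivisionIdem.suppIn_corner (hf : 𝒜.IsDivisionIdem e f) :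
    (cornerGrading hf.mem hf.idem).SuppIn e := by
  intro a b γ h
  obtain ⟨⟨⟨x, hx'⟩, hx⟩, hx0⟩ := AddSubgroup.ne_bot_iff_exists_ne_zero.1 h
  exact eq_of_mem_cornerComp hf.mem hx fun h0 => hx0 (Subtype.ext (Subtype.ext h0))

theorem IsDivisionIdem.isGrDivision_corner (hf : 𝒜.IsDivisionIdem e f) :
    (cornerGrading hf.mem hf.idem).IsGrDivision := by
  refine ⟨⟨⟨f, mem_corner hf.mem hf.idem hf.idem hf.idem⟩, 0,
    fun h => hf.ne_zero (congrArg Subtype.val h)⟩, ?_⟩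
  rintro a b γ ⟨z, hz'⟩ hz hz0
  replace hz0 : z ≠ 0 := fun h => hz0 (Subtype.ext h)
  obtain ⟨rfl, rfl⟩ := eq_of_mem_cornerComp hf.mem hz hz0
  obtain ⟨w, hw, h1, h2, h3, h4⟩ := hf.exists_inv γ z hz.1 hz.2.1 hz.2.2 hz0
  refine ⟨⟨w, mem_corner hf.mem hf.idem h1 h2⟩, ⟨hw, h1, h2⟩, Subtype.ext ?_, Subtype.ext ?_⟩
  · exact h3.trans (𝒜.mul_one _ f hf.mem).symm
  · exact h4.trans (𝒜.mul_one _ f hf.mem).symm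

/-- `Rf` as a graded right module over `fRf`. -/
noncomputable def leftCornerModule (hf : f ∈ 𝒜.comp (𝟙 e)) (hff : f * f = f) :
    GrModule (cornerGrading hf hff) (𝒜.LeftCorner f) where
  act := AddMonoidHom.mk' (fun v => AddMonoidHom.mk' (fun d => ⟨v.1 * d.1,
      mem_leftCorner hf hff (by rw [mul_assoc, (Corner.mem_cornerSubgroup d.2).2])⟩)
      fun d d' => Subtype.ext (mul_add v.1 d.1 d'.1))
    fun v v' => AddMonoidHom.ext fun d => Subtype.ext (add_mul v.1 v'.1 d.1)
  act_mul v d d' := Subtype.ext (mul_assoc v.1 d.1 d'.1).symm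
  comp := familyComp (𝒜.leftComp f) (𝒜.LeftCorner f)
  isInternal := isInternal_familyComp (𝒜.leftComp f) (𝒜.LeftCorner f) (fun _ => Iff.rfl)
    (𝒜.iSupIndep_comp.mono fun _ => inf_le_left)
  act_mem _ _ _ γ δ v hv d hd := ⟨𝒜.mul_mem γ δ _ hv.1 _ hd.1,
    show v.1 * d.1 * f = v.1 * d.1 by rw [mul_assoc, hd.2.2]⟩
  act_eq_zero _ _ _ _ γ δ hb v hv d hd := Subtype.ext (𝒜.mul_eq_zero γ δ hb _ hv.1 _ hd.1)
  unital := by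
    rw [eq_top_iff]
    rintro v -
    refine AddSubgroup.subset_closure ⟨v, ⟨f, mem_corner hf hff hff hff⟩, Subtype.ext ?_⟩
    exact (LeftCorner.mul_eq v.2).symm

theorem IsGlobalUnitSystem.nonempty {e : G} {f : R} {I : Type*} {c : I → G} {γ : ∀ i, e ⟶ c i}
    {x y : I → R} {T : G → Finset I} (h : 𝒜.IsGlobalUnitSystem f γ x y T)
    (hf : 𝒜.IsDivisionIdem e f) : Nonempty I := by
  by_contra hI
  rw [not_nonempty_iff] at hI
  have h1 := h.sum_mul e
  rw [Finset.eq_empty_of_isEmpty (T e), Finset.sum_empty] at h1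
  apply hf.ne_zero
  rw [← 𝒜.one_mul _ f hf.mem, ← h1, zero_mul]

/-! ### The isomorphism of `R` with the endomorphism ring of `Rf`. -/

section EndIso

variable {e : G} {f : R} {I : Type*} {c : I → G} {γ : ∀ i, e ⟶ c i} {x y : I → R}
  {T : G → Finset I}

/-- The `x_i` with `c_i = c'` form the pseudo-basis: `v = ∑ x_i (y_i v)` shows that they generate,
and left multiplication by `y_k` extracts the `k`-th coefficient of a relation. -/
theorem IsGlobalUnitSystem.isFiniteDimensional (h : 𝒜.IsGlobalUnitSystem f γ x y T)
    (hf : 𝒜.IsDivisionIdem e f) : (leftCornerModule hf.mem hf.idem).IsFiniteDimensional := by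
  intro c'
  let ε := (T c').equivFin.symm
  have hc : ∀ k, c (ε k).1 = c' := fun k => (h.mem_iff c' _).1 (ε k).2
  have hx : ∀ i, x i ∈ 𝒜.LeftCorner f := fun i => mem_leftCorner hf.mem hf.idem (h.left_mul i)
  have hxc : ∀ i, (⟨x i, hx i⟩ : 𝒜.LeftCorner f) ∈
      (leftCornerModule hf.mem hf.idem).comp (γ i) := fun i => ⟨h.left_mem i, h.left_mul i⟩
  refine ⟨_, fun k => ⟨e, c (ε k).1, γ (ε k).1⟩, fun k => ⟨x (ε k).1, hx _⟩,
    fun k => ⟨?_, hxc _⟩, fun v hv => ?_, fun a ha h0 => ?_⟩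
  · have hpart : ∀ i, c i = c' → (⟨x i, hx i⟩ : 𝒜.LeftCorner f) ∈
        (leftCornerModule hf.mem hf.idem).part c' := by
      rintro i rfl
      exact AddSubgroup.mem_iSup_of_mem e (AddSubgroup.mem_iSup_of_mem (γ i) (hxc i))
    exact hpart _ (hc k)
  · have hv' : 𝒜.one c' * v.1 = v.1 := by
      have hle : (leftCornerModule hf.mem hf.idem).part c' ≤
          (𝒜.rightPart c').comap (NonUnitalRingHom.toAddMonoidHom
            (NonUnitalSubringClass.subtype (𝒜.LeftCorner f))) :=
        iSup_le fun a => iSup_le fun δ w hw => mem_rightPart hw.1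
      exact one_mul_of_mem_rightPart (hle hv)
    refine ⟨Finsupp.equivFunOnFinite.symm fun k => ⟨y (ε k).1 * v.1, mem_corner hf.mem hf.idem
      (by rw [← mul_assoc, h.mul_right]) (by rw [mul_assoc, LeftCorner.mul_eq v.2])⟩, ?_⟩
    rw [Finsupp.sum_fintype _ _ fun _ => map_zero _]
    refine Subtype.ext (hv'.symm.trans ?_)
    rw [← h.sum_mul, Finset.sum_mul, ← Finset.sum_coe_sort (T c'), ← Equiv.sum_comp ε,
      AddSubmonoidClass.coe_finsetSum]
    refine Finset.sum_congr rfl fun k _ => ?_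
    exact mul_assoc _ _ _
  · rw [Finsupp.sum_fintype _ _ fun _ => map_zero _] at h0
    ext k
    have h1 : ∑ l, x (ε l).1 * (a l).1 = 0 := by
      have := congrArg Subtype.val h0
      rwa [AddSubmonoidClass.coe_finsetSum] at this
    have h2 : y (ε k).1 * ∑ l, x (ε l).1 * (a l).1 = (a k).1 := by
      rw [Finset.mul_sum, Finset.sum_eq_single k]
      · rw [← mul_assoc, h.mul_same, (Corner.mem_cornerSubgroup (a k).2).1]
      · intro l _ hl
        rw [← mul_assoc, h.mul_ne _ _ fun h' => hl (ε.injective (Subtype.ext h')).symm, zero_mul]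
      · exact fun h' => absurd (Finset.mem_univ k) h'
    rw [← h2, h1, mul_zero]
    rfl

/-- Left multiplication `R → END(Rf)`. -/
noncomputable def leftMulEnd (hf : f ∈ 𝒜.comp (𝟙 e)) (hff : f * f = f) :
    R →+ AddMonoid.End (𝒜.LeftCorner f) :=
  AddMonoidHom.mk' (fun r => AddMonoidHom.mk' (fun v => ⟨r * v.1,
      mem_leftCorner hf hff (by rw [mul_assoc, LeftCorner.mul_eq v.2])⟩)
      fun v v' => Subtype.ext (mul_add r v.1 v'.1))
    fun r r' => AddMonoidHom.ext fun v => Subtype.ext (add_mul r r' v.1)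

theorem leftMulEnd_mem_endComp (hf : f ∈ 𝒜.comp (𝟙 e)) (hff : f * f = f) {a b : G} {δ : a ⟶ b}
    {r : R} (hr : r ∈ 𝒜.comp δ) :
    leftMulEnd hf hff r ∈ (leftCornerModule hf hff).endComp δ := by
  refine ⟨fun v d => Subtype.ext (mul_assoc r v.1 d.1).symm, fun c' σ v hv => ⟨?_, ?_⟩,
    fun c' a' σ ha v hv => Subtype.ext (𝒜.mul_eq_zero δ σ ha.symm r hr v.1 hv.1)⟩
  · exact 𝒜.mul_mem δ σ r hr v.1 hv.1
  · exact LeftCorner.mul_eq (leftMulEnd hf hff r v).2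

theorem leftMulEnd_mem (hf : f ∈ 𝒜.comp (𝟙 e)) (hff : f * f = f) (r : R) :
    leftMulEnd hf hff r ∈ (leftCornerModule hf hff).EndRing := by
  refine 𝒜.homogeneous_induction (p := fun r => leftMulEnd hf hff r ∈ _) r (fun a b δ r hr => ?_)
    (by rw [map_zero]; exact zero_mem _) fun x y hx hy => by rw [map_add]; exact add_mem hx hy
  exact AddSubgroup.mem_iSup_of_mem (⟨a, b, δ⟩ : Mor G) (leftMulEnd_mem_endComp hf hff hr)

theorem IsGlobalUnitSystem.mul_sum_mul (h : 𝒜.IsGlobalUnitSystem f γ x y T) {a b : G} {δ : a ⟶ b}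
    {r : R} (hr : r ∈ 𝒜.comp δ) : ∑ i ∈ T a, r * x i * y i = r := by
  simp only [mul_assoc]
  rw [← Finset.mul_sum, h.sum_mul, 𝒜.mul_one δ r hr]

/-- An element of degree `a ⟶ b` is determined by its values on the `x_i` with `c_i = a`, because `r
= ∑ (r x_i) y_i`; the same formula builds `r` from an endomorphism. -/
theorem IsGlobalUnitSystem.grIsomorphic_end (h : 𝒜.IsGlobalUnitSystem f γ x y T)
    (hf : 𝒜.IsDivisionIdem e f) :
    GrIsomorphic 𝒜 (leftCornerModule hf.mem hf.idem).endGrading := by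
  have hx : ∀ i, x i ∈ 𝒜.LeftCorner f := fun i => mem_leftCorner hf.mem hf.idem (h.left_mul i)
  refine grIsomorphic_of_components
    (AddMonoidHom.mk' (fun r => ⟨leftMulEnd hf.mem hf.idem r, leftMulEnd_mem hf.mem hf.idem r⟩)
      fun r s => Subtype.ext (map_add _ r s))
    (fun a b δ r hr => leftMulEnd_mem_endComp hf.mem hf.idem hr)
    (fun a b δ r _ s => Subtype.ext (AddMonoidHom.ext fun v => Subtype.ext (mul_assoc r s v.1)))
    (fun a b δ r hr h0 => ?_) ?_
  · rw [← h.mul_sum_mul hr]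
    refine Finset.sum_eq_zero fun i _ => ?_
    have h1 : leftMulEnd hf.mem hf.idem r ⟨x i, hx i⟩ = 0 :=
      DFunLike.congr_fun (congrArg Subtype.val h0) _
    rw [show r * x i = 0 from congrArg Subtype.val h1, zero_mul]
  · rintro a b δ ⟨g, hg'⟩ ⟨hg1, hg2, hg3⟩
    change ∀ x r, g _ = _ at hg1
    have hxc : ∀ i, (⟨x i, hx i⟩ : 𝒜.LeftCorner f) ∈
      (leftCornerModule hf.mem hf.idem).comp (γ i) := fun i => ⟨h.left_mem i, h.left_mul i⟩
    refine ⟨∑ i ∈ T a, (g ⟨x i, hx i⟩).1 * y i, sum_mem fun i hi => ?_, Subtype.ext ?_⟩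
    · obtain rfl := (h.mem_iff a i).1 hi
      have h1 := hg2 _ (γ i) _ (hxc i)
      simpa using 𝒜.mul_mem _ _ _ h1.1 _ (h.right_mem i)
    · refine GrModule.end_ext (leftCornerModule hf.mem hf.idem) fun a' b' σ v hv => ?_
      by_cases hb : b' = a
      · subst hb
        have hy : ∀ i, y i * v.1 ∈ 𝒜.Corner f := fun i => mem_corner hf.mem hf.idem
          (by rw [← mul_assoc, h.mul_right]) (by rw [mul_assoc, LeftCorner.mul_eq v.2])
        -- Expanding `v` in the `x_i` with coefficients in `fRf` lets the linearity of `g` be used.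
        have hv1 : v = ∑ i ∈ T b', (leftCornerModule hf.mem hf.idem).act ⟨x i, hx i⟩
            ⟨y i * v.1, hy i⟩ := by
          apply Subtype.ext
          rw [AddSubmonoidClass.coe_finsetSum]
          change v.1 = ∑ i ∈ T b', x i * (y i * v.1)
          simp only [← mul_assoc]
          rw [← Finset.sum_mul, h.sum_mul, 𝒜.one_mul σ v.1 hv.1]
        conv_rhs => rw [show (Subtype.val (⟨g, hg'⟩ :
          (leftCornerModule hf.mem hf.idem).EndRing)) = g from rfl, hv1, map_sum]
        apply Subtype.ext
        rw [AddSubmonoidClass.coe_finsetSum]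
        change (∑ i ∈ T b', (g ⟨x i, hx i⟩).1 * y i) * v.1 = _
        rw [Finset.sum_mul]
        refine Finset.sum_congr rfl fun i _ => ?_
        rw [hg1]
        exact mul_assoc _ _ _
      · refine Eq.trans ?_ (hg3 _ _ σ hb v hv).symm
        apply Subtype.ext
        change (∑ i ∈ T a, (g ⟨x i, hx i⟩).1 * y i) * v.1 = 0
        rw [Finset.sum_mul]
        refine Finset.sum_eq_zero fun i hi => ?_
        obtain rfl := (h.mem_iff a i).1 hi
        rw [mul_assoc, 𝒜.mul_eq_zero _ σ (Ne.symm hb) _ (h.right_mem i) _ hv.1, mul_zero]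

end EndIso

/-! ### The isomorphism of `R` with a matrix ring over `fRf`. -/

section MatrixIso

variable {e : G} {f : R} {I : Type*} {c : I → G} {γ : ∀ i, e ⟶ c i} {x y : I → R}
  {T : G → Finset I}

/-- The degrees `σ_i : c_i → e` of the matrix ring. -/
def IsGlobalUnitSystem.degrees (_ : 𝒜.IsGlobalUnitSystem f γ x y T) (i : I) : Mor G :=
  ⟨c i, e, Groupoid.inv (γ i)⟩

theorem IsGlobalUnitSystem.dFinite (h : 𝒜.IsGlobalUnitSystem f γ x y T) :
    DFinite fun i => {h.degrees i} := by
  intro c'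
  refine (T c').finite_toSet.subset ?_
  rintro i ⟨σ, rfl, hi⟩
  exact (h.mem_iff c' i).2 hi

theorem IsGlobalUnitSystem.entry_mem (h : 𝒜.IsGlobalUnitSystem f γ x y T)
    (hf : 𝒜.IsDivisionIdem e f) (r : R) (i j : I) : y i * r * x j ∈ 𝒜.Corner f :=
  mem_corner hf.mem hf.idem (by rw [← mul_assoc, ← mul_assoc, h.mul_right])
    (by rw [mul_assoc, h.left_mul])

theorem IsGlobalUnitSystem.eq_of_entry_ne_zero (h : 𝒜.IsGlobalUnitSystem f γ x y T) {a b : G}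
    {δ : a ⟶ b} {r : R} (hr : r ∈ 𝒜.comp δ) {i j : I} (h0 : y i * r * x j ≠ 0) :
    c i = b ∧ c j = a := by
  have h1 : y i * r ≠ 0 := fun h' => h0 (by rw [h', zero_mul])
  have hi : b = c i := right_eq_of_mul_ne_zero (h.right_mem i) hr h1
  subst hi
  exact ⟨rfl, right_eq_of_mul_ne_zero (𝒜.mul_mem _ _ _ (h.right_mem i) _ hr) (h.left_mem j) h0⟩

theorem IsGlobalUnitSystem.entry_finite (h : 𝒜.IsGlobalUnitSystem f γ x y T) (r : R) :
    {p : I × I | y p.1 * r * x p.2 ≠ 0}.Finite := by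
  refine 𝒜.homogeneous_induction (p := fun r => {p : I × I | y p.1 * r * x p.2 ≠ 0}.Finite) r
    (fun a b δ r hr => ?_) (by simp) fun r s hr hs => ?_
  · refine ((T b) ×ˢ (T a)).finite_toSet.subset fun p hp => ?_
    obtain ⟨h1, h2⟩ := h.eq_of_entry_ne_zero hr hp
    simp only [Finset.coe_product, Set.mem_prod]
    exact ⟨(h.mem_iff _ _).2 h1, (h.mem_iff _ _).2 h2⟩
  · refine (hr.union hs).subset fun p hp => ?_
    by_contra h0
    simp only [Set.mem_union, Set.mem_ofPred_eq, not_or, not_not] at h0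
    exact hp (by rw [mul_add, add_mul, h0.1, h0.2, add_zero])

/-- The map `r ↦ (y_i r x_j)`. -/
noncomputable def IsGlobalUnitSystem.toFinMatrix (h : 𝒜.IsGlobalUnitSystem f γ x y T)
    (hf : 𝒜.IsDivisionIdem e f) : R →+ FinMatrix I (𝒜.Corner f) :=
  AddMonoidHom.mk' (fun r => ⟨fun i j => ⟨y i * r * x j, h.entry_mem hf r i j⟩,
      (h.entry_finite r).subset fun _ hp h0 => hp (Subtype.ext h0)⟩)
    fun r s => Subtype.ext (Matrix.ext fun i j => Subtype.ext
      (show y i * (r + s) * x j = y i * r * x j + y i * s * x j by rw [mul_add, add_mul]))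

theorem IsGlobalUnitSystem.toFinMatrix_apply (h : 𝒜.IsGlobalUnitSystem f γ x y T)
    (hf : 𝒜.IsDivisionIdem e f) (r : R) (i j : I) :
    ((h.toFinMatrix hf r).1 i j).1 = y i * r * x j := rfl

theorem IsGlobalUnitSystem.entryComp_degrees (h : 𝒜.IsGlobalUnitSystem f γ x y T)
    (hf : 𝒜.IsDivisionIdem e f) (i j : I) (δ : c j ⟶ c i) :
    entryComp (cornerGrading hf.mem hf.idem) {h.degrees i} {h.degrees j} δ
      = (cornerGrading hf.mem hf.idem).comp (γ j ≫ δ ≫ Groupoid.inv (γ i)) := by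
  have h1 := isMatricial_singleton hf.isGrDivision_corner hf.suppIn_corner (fun _ => rfl) h.dFinite
  rw [entryComp_eq (h1.dUnique i) (h1.dUnique j) δ (Groupoid.inv (γ i)) rfl (Groupoid.inv (γ j))
    rfl]
  simp

theorem IsGlobalUnitSystem.toFinMatrix_mem_matrixComp (h : 𝒜.IsGlobalUnitSystem f γ x y T)
    (hf : 𝒜.IsDivisionIdem e f) {a b : G} {δ : a ⟶ b} {r : R} (hr : r ∈ 𝒜.comp δ) :
    h.toFinMatrix hf r ∈ matrixComp (cornerGrading hf.mem hf.idem) (fun i => {h.degrees i}) δ := by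
  intro i j
  by_cases h0 : y i * r * x j = 0
  · rw [show (h.toFinMatrix hf r).1 i j = 0 from Subtype.ext h0]
    exact zero_mem _
  obtain ⟨rfl, rfl⟩ := h.eq_of_entry_ne_zero hr h0
  rw [h.entryComp_degrees hf]
  refine ⟨?_, Corner.mem_cornerSubgroup ((h.toFinMatrix hf r).1 i j).2⟩
  have h1 := 𝒜.mul_mem _ _ _ (𝒜.mul_mem _ _ _ (h.right_mem i) _ hr) _ (h.left_mem j)
  rwa [h.toFinMatrix_apply]

/-- The Peirce decomposition: inserting `∑ x_k y_k` between factors makes `r ↦ (y_i r x_j)`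
multiplicative, and `∑ x_i a_{ij} y_j` inverts it. -/
theorem IsGlobalUnitSystem.grIsomorphic_matrix (h : 𝒜.IsGlobalUnitSystem f γ x y T)
    (hf : 𝒜.IsDivisionIdem e f) :
    GrIsomorphic 𝒜 (matrixGrading (isMatricial_singleton hf.isGrDivision_corner hf.suppIn_corner
      (fun _ => rfl) h.dFinite)) := by
  have hS := isMatricial_singleton hf.isGrDivision_corner hf.suppIn_corner (fun _ => rfl) h.dFinite
  have hmem : ∀ r, h.toFinMatrix hf r ∈ MatrixRing hS := fun r => by
    refine 𝒜.homogeneous_induction (p := fun r => h.toFinMatrix hf r ∈ MatrixRing hS) r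
      (fun a b δ r hr => ?_) (by rw [map_zero]; exact zero_mem _)
      fun x y hx hy => by rw [map_add]; exact add_mem hx hy
    exact AddSubgroup.mem_iSup_of_mem (⟨a, b, δ⟩ : Mor G) (h.toFinMatrix_mem_matrixComp hf hr)
  refine grIsomorphic_of_components
    (AddMonoidHom.mk' (fun r => (⟨h.toFinMatrix hf r, hmem r⟩ : MatrixRing hS))
      fun r s => Subtype.ext (map_add _ r s))
    (fun a b δ r hr => h.toFinMatrix_mem_matrixComp hf hr)
    (fun a b δ r hr s => Subtype.ext (Subtype.ext (Matrix.ext fun i j => Subtype.ext ?_)))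
    (fun a b δ r hr h0 => ?_) ?_
  · change y i * (r * s) * x j =
      ((h.toFinMatrix hf r * h.toFinMatrix hf s : FinMatrix I (𝒜.Corner f)).1 i j).1
    rw [FinMatrix.mul_apply, finsum_eq_sum_of_support_subset (s := T a) _ ?_,
      AddSubmonoidClass.coe_finsetSum]
    · calc y i * (r * s) * x j = y i * (∑ k ∈ T a, r * x k * y k) * s * x j := by
            rw [h.mul_sum_mul hr, mul_assoc (y i) r s]
        _ = _ := by
          simp only [Finset.mul_sum, Finset.sum_mul]
          refine Finset.sum_congr rfl fun k _ => ?_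
          change _ = y i * r * x k * (y k * s * x j)
          simp only [mul_assoc]
    · intro k hk
      refine (h.mem_iff a k).2 (h.eq_of_entry_ne_zero hr (i := i) (j := k) fun h0 => hk ?_).2
      change (h.toFinMatrix hf r).1 i k * _ = 0
      rw [show (h.toFinMatrix hf r).1 i k = 0 from Subtype.ext h0, zero_mul]
  · have h1 : ∀ i j, y i * r * x j = 0 := fun i j => by
      have h2 : (h.toFinMatrix hf r).1 i j = 0 := by
        rw [show h.toFinMatrix hf r = 0 from congrArg Subtype.val h0]
        rfl
      exact congrArg Subtype.val h2
    rw [← h.mul_sum_mul hr, ← 𝒜.one_mul δ r hr, ← h.sum_mul]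
    refine Finset.sum_eq_zero fun j _ => ?_
    rw [Finset.sum_mul, Finset.sum_mul, Finset.sum_mul]
    refine Finset.sum_eq_zero fun i _ => ?_
    rw [mul_assoc (x i), mul_assoc (x i), h1, mul_zero, zero_mul]
  · rintro a b δ ⟨A, hA'⟩ hA
    change ∀ i j, A.1 i j ∈ _ at hA
    refine ⟨∑ i ∈ T b, ∑ j ∈ T a, x i * (A.1 i j).1 * y j,
      sum_mem fun i hi => sum_mem fun j hj => ?_,
      Subtype.ext (Subtype.ext (Matrix.ext fun k l => Subtype.ext ?_))⟩
    · obtain rfl := (h.mem_iff b i).1 hi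
      obtain rfl := (h.mem_iff a j).1 hj
      have h1 := hA i j
      rw [h.entryComp_degrees hf] at h1
      simpa using 𝒜.mul_mem _ _ _ (𝒜.mul_mem _ _ _ (h.left_mem i) _ h1.1) _ (h.right_mem j)
    · change y k * (∑ i ∈ T b, ∑ j ∈ T a, x i * (A.1 i j).1 * y j) * x l = (A.1 k l).1
      have hcorner := Corner.mem_cornerSubgroup (A.1 k l).2
      simp only [Finset.mul_sum, Finset.sum_mul]
      have hterm : ∀ i j, (i ≠ k ∨ j ≠ l) → y k * (x i * (A.1 i j).1 * y j) * x l = 0 := by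
        rintro i j (hi | hj)
        · simp only [← mul_assoc]
          rw [h.mul_ne _ _ hi.symm]
          simp only [zero_mul]
        · simp only [mul_assoc]
          rw [h.mul_ne _ _ hj]
          simp only [mul_zero]
      have hdiag : y k * (x k * (A.1 k l).1 * y l) * x l = (A.1 k l).1 := by
        simp only [← mul_assoc]
        rw [h.mul_same, hcorner.1, mul_assoc, h.mul_same, hcorner.2]
      -- The `(k, l)` term need not occur in the sum, but it is missing only when the entry
      -- vanishes: a nonzero entry forces `c k = b` and `c l = a`.
      by_cases h0 : A.1 k l = 0
      · rw [h0] at hdiag ⊢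
        refine Finset.sum_eq_zero fun i _ => Finset.sum_eq_zero fun j _ => ?_
        by_cases hij : i = k ∧ j = l
        · obtain ⟨rfl, rfl⟩ := hij
          rw [h0]
          exact hdiag
        · exact hterm i j (by tauto)
      · obtain ⟨c', σ, c'', τ, hσ, hτ, -⟩ := (entryComp_cases (hS.dUnique k) (hS.dUnique l) δ
          (hA k l)).resolve_left h0
        have hk : k ∈ T b := (h.mem_iff b k).2 (congrArg Quiver.Total.left hσ).symm
        have hl : l ∈ T a := (h.mem_iff a l).2 (congrArg Quiver.Total.left hτ).symm
        rw [Finset.sum_eq_single_of_mem k hk fun i _ hi => Finset.sum_eq_zero fun j _ =>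
          hterm i j (Or.inl hi), Finset.sum_eq_single_of_mem l hl fun j _ hj =>
          hterm k j (Or.inr hj), hdiag]

end MatrixIso

end GrRing

/-! ### Matrix units in the graded subring of an ambient ring. -/

section Family

variable {G : Type w} [Groupoid.{v} G] {X : Type u} [NonUnitalRing X]

/-- Matrix rings and endomorphism rings are both built by `familyGrading`; this lets their matrix
units be checked in the ambient ring, over any finite index type. -/
theorem hasMatrixUnits_familyGrading {A : ∀ ⦃a b : G⦄, (a ⟶ b) → AddSubgroup X}
    {hmul : ∀ ⦃a b c : G⦄ (γ : b ⟶ c) (δ : a ⟶ b), ∀ x ∈ A γ, ∀ y ∈ A δ, x * y ∈ A (δ ≫ γ)}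
    {hzero : ∀ ⦃a b b' c : G⦄ (γ : b' ⟶ c) (δ : a ⟶ b), b' ≠ b →
      ∀ x ∈ A γ, ∀ y ∈ A δ, x * y = 0}
    {hind : iSupIndep fun γ : Mor G => A γ.hom} {one : G → X}
    {hone : ∀ e : G, one e ∈ A (𝟙 e)}
    {hone_mul : ∀ ⦃a b : G⦄ (γ : a ⟶ b), ∀ x ∈ A γ, one b * x = x}
    {hmul_one : ∀ ⦃a b : G⦄ (γ : a ⟶ b), ∀ x ∈ A γ, x * one a = x}
    {e : G} {f : X} (hf : f ∈ A (𝟙 e)) (hff : f * f = f) (hf0 : f ≠ 0)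
    (hinv : ∀ γ : e ⟶ e, ∀ z ∈ A γ, f * z = z → z * f = z → z ≠ 0 →
      ∃ w ∈ A (Groupoid.inv γ), f * w = w ∧ w * f = w ∧ z * w = f ∧ w * z = f)
    (hu : ∀ c : G, ∃ (J : Type t) (_ : Fintype J) (γ : J → (e ⟶ c)) (x y : J → X),
      (∀ i, x i ∈ A (γ i)) ∧ (∀ i, y i ∈ A (Groupoid.inv (γ i))) ∧ (∀ i, x i * f = x i) ∧
      (∀ i, f * y i = y i) ∧ (∀ i, y i * x i = f) ∧ (∀ i j, i ≠ j → y i * x j = 0) ∧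
      ∑ i, x i * y i = one c) :
    (familyGrading A hmul hzero hind one hone hone_mul hmul_one).HasMatrixUnits := by
  have hm : ∀ {a b : G} {γ : a ⟶ b} {x : X}, x ∈ A γ → x ∈ familyRing A hmul hzero :=
    fun {a b γ x} hx => AddSubgroup.mem_iSup_of_mem (⟨a, b, γ⟩ : Mor G) hx
  refine ⟨e, ⟨f, hm hf⟩, ⟨hf, Subtype.ext hff, fun h => hf0 (congrArg Subtype.val h), ?_⟩,
    fun c => ?_⟩
  · rintro γ ⟨z, hz'⟩ hz hfz hzf hz0
    obtain ⟨w, hw, h1, h2, h3, h4⟩ := hinv γ z hz (congrArg Subtype.val hfz)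
      (congrArg Subtype.val hzf) fun h => hz0 (Subtype.ext h)
    exact ⟨⟨w, hm hw⟩, hw, Subtype.ext h1, Subtype.ext h2, Subtype.ext h3, Subtype.ext h4⟩
  · obtain ⟨J, _, γ, x, y, hx, hy, h1, h2, h3, h4, h5⟩ := hu c
    refine GrRing.IsUnitSystem.exists_fin (T := (Finset.univ : Finset J)) (γ := γ)
      (x := fun i => ⟨x i, hm (hx i)⟩)
      (y := fun i => ⟨y i, hm (hy i)⟩) ⟨fun i _ => hx i, fun i _ => hy i,
      fun i _ => Subtype.ext (h1 i), fun i _ => Subtype.ext (h2 i), fun i _ => Subtype.ext (h3 i),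
      fun i _ j _ hij => Subtype.ext (h4 i j hij), Subtype.ext ?_⟩
    rw [AddSubmonoidClass.coe_finsetSum]
    exact h5

end Family

/-! ### Supports of gr-division rings and gr-primeness. -/

namespace GrRing

variable {G : Type w} [Groupoid.{v} G] {R : Type u} [NonUnitalRing R] {𝒜 : GrRing G R}

theorem one_ne_zero_of_mem_objSupport {e : G} (he : e ∈ 𝒜.objSupport) : 𝒜.one e ≠ 0 := by
  intro h0
  refine he ((AddSubgroup.eq_bot_iff_forall _).2 fun x hx => ?_)
  rw [← one_mul_of_mem_rightPart hx, h0, zero_mul]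

theorem comp_one_ne_bot {e : G} (he : 𝒜.one e ≠ 0) : 𝒜.comp (𝟙 e) ≠ ⊥ := fun h =>
  he (by rw [← AddSubgroup.mem_bot, ← h]; exact 𝒜.one_mem e)

theorem IsGrDivision.comp_inv_ne_bot (hd : 𝒜.IsGrDivision) {a b : G} {γ : a ⟶ b}
    (h : 𝒜.comp γ ≠ ⊥) : 𝒜.comp (Groupoid.inv γ) ≠ ⊥ := by
  obtain ⟨⟨x, hx⟩, hx0⟩ := AddSubgroup.ne_bot_iff_exists_ne_zero.1 h
  replace hx0 : x ≠ 0 := fun h => hx0 (Subtype.ext h)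
  obtain ⟨y, hy, hxy, -⟩ := hd.2 γ x hx hx0
  intro hbot
  rw [hbot, AddSubgroup.mem_bot] at hy
  apply hx0
  rw [← 𝒜.one_mul γ x hx, ← hxy, hy, mul_zero, zero_mul]

/-- A nonzero homogeneous `x` is cancelled by its inverse. With `comp_inv_ne_bot`, the support is
closed under inverses and defined products. -/
theorem IsGrDivision.comp_comp_ne_bot (hd : 𝒜.IsGrDivision) {a b c : G} {γ : b ⟶ c} {δ : a ⟶ b}
    (hγ : 𝒜.comp γ ≠ ⊥) (hδ : 𝒜.comp δ ≠ ⊥) : 𝒜.comp (δ ≫ γ) ≠ ⊥ := by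
  obtain ⟨⟨x, hx⟩, hx0⟩ := AddSubgroup.ne_bot_iff_exists_ne_zero.1 hγ
  obtain ⟨⟨z, hz⟩, hz0⟩ := AddSubgroup.ne_bot_iff_exists_ne_zero.1 hδ
  replace hx0 : x ≠ 0 := fun h => hx0 (Subtype.ext h)
  obtain ⟨y, -, -, hyx⟩ := hd.2 γ x hx hx0
  intro hbot
  have h1 := 𝒜.mul_mem γ δ x hx z hz
  rw [hbot, AddSubgroup.mem_bot] at h1
  apply hz0
  apply Subtype.ext
  change z = 0
  rw [← 𝒜.one_mul δ z hz, ← hyx, mul_assoc, h1, mul_zero]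

variable (𝒜) in
/-- The sum of the components `R_γ` such that `r(γ)` is connected to `c` within the support. -/
def connectedPart (c : G) : AddSubgroup R :=
  ⨆ (γ : Mor G) (_ : ∃ μ : γ.right ⟶ c, 𝒜.comp μ ≠ ⊥), 𝒜.comp γ.hom

theorem mem_connectedPart {c a b : G} {γ : a ⟶ b} {x : R} (hx : x ∈ 𝒜.comp γ) (μ : b ⟶ c)
    (hμ : 𝒜.comp μ ≠ ⊥) : x ∈ 𝒜.connectedPart c :=
  AddSubgroup.mem_iSup_of_mem (⟨a, b, γ⟩ : Mor G) (AddSubgroup.mem_iSup_of_mem ⟨μ, hμ⟩ hx)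

theorem connectedPart_induction {c : G} {p : R → Prop} {x : R} (hx : x ∈ 𝒜.connectedPart c)
    (h : ∀ ⦃a b : G⦄ (γ : a ⟶ b) (μ : b ⟶ c), 𝒜.comp μ ≠ ⊥ → ∀ x ∈ 𝒜.comp γ, p x) (h0 : p 0)
    (hadd : ∀ x y, p x → p y → p (x + y)) : p x := by
  rw [connectedPart, iSup_subtype'] at hx
  induction hx using AddSubgroup.iSup_induction' with
  | hp γ x hx => exact h _ γ.2.choose γ.2.choose_spec x hx
  | h1 => exact h0
  | hadd x y _ _ h1 h2 => exact hadd x y h1 h2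

/-- Right factors do not change the range. A left factor of degree `δ` moves the range, but `μδ⁻¹`
still lies in the support and leads back to `c`. -/
theorem IsGrDivision.isGradedIdeal_connectedPart (hd : 𝒜.IsGrDivision) (c : G) :
    𝒜.IsGradedIdeal (𝒜.connectedPart c) := by
  have hhom : 𝒜.IsHomogeneous (𝒜.connectedPart c) := by
    refine iSup_le fun γ => iSup_le fun ⟨μ, hμ⟩ x hx => ?_
    exact AddSubgroup.mem_iSup_of_mem γ ⟨mem_connectedPart hx μ hμ, hx⟩
  refine ⟨⟨hhom, fun x hx r => ?_⟩, hhom, fun x hx r => ?_⟩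
  · refine connectedPart_induction (p := fun x => x * r ∈ _) hx (fun a b γ μ hμ x hx => ?_)
      (by rw [zero_mul]; exact zero_mem _) fun x y h1 h2 => by rw [add_mul]; exact add_mem h1 h2
    refine 𝒜.homogeneous_induction (p := fun r => x * r ∈ _) r (fun a' b' δ r hr => ?_)
      (by rw [mul_zero]; exact zero_mem _) fun y z h1 h2 => by rw [mul_add]; exact add_mem h1 h2
    by_cases h0 : x * r = 0
    · rw [h0]
      exact zero_mem _
    · obtain rfl := right_eq_of_mul_ne_zero hx hr h0
      exact mem_connectedPart (𝒜.mul_mem _ _ _ hx _ hr) μ hμ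
  · refine connectedPart_induction (p := fun x => r * x ∈ _) hx (fun a b γ μ hμ x hx => ?_)
      (by rw [mul_zero]; exact zero_mem _) fun x y h1 h2 => by rw [mul_add]; exact add_mem h1 h2
    refine 𝒜.homogeneous_induction (p := fun r => r * x ∈ _) r (fun a' b' δ r hr => ?_)
      (by rw [zero_mul]; exact zero_mem _) fun y z h1 h2 => by rw [add_mul]; exact add_mem h1 h2
    by_cases h0 : r * x = 0
    · rw [h0]
      exact zero_mem _
    · obtain rfl := right_eq_of_mul_ne_zero hr hx h0
      have hδ : 𝒜.comp δ ≠ ⊥ := fun h => h0 (by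
        rw [h, AddSubgroup.mem_bot] at hr
        rw [hr, zero_mul])
      exact mem_connectedPart (𝒜.mul_mem _ _ _ hr _ hx) (Groupoid.inv δ ≫ μ)
        (hd.comp_comp_ne_bot hμ (hd.comp_inv_ne_bot hδ))

/-- Any two objects in the support of a gr-prime gr-division ring are connected by an invertible
homogeneous element. -/
theorem IsGrDivision.exists_unit (hd : 𝒜.IsGrDivision) (hp : 𝒜.IsGrPrime) {a b : G}
    (ha : 𝒜.one a ≠ 0) (hb : 𝒜.one b ≠ 0) :
    ∃ (μ : a ⟶ b) (d d' : R), d ∈ 𝒜.comp μ ∧ d' ∈ 𝒜.comp (Groupoid.inv μ) ∧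
      d * d' = 𝒜.one b ∧ d' * d = 𝒜.one a := by
  have hne : ∀ {c : G}, 𝒜.one c ≠ 0 → 𝒜.connectedPart c ≠ ⊥ := fun {c} hc h => by
    apply hc
    rw [← AddSubgroup.mem_bot, ← h]
    exact mem_connectedPart (𝒜.one_mem c) (𝟙 c) (comp_one_ne_bot hc)
  obtain ⟨x, hx, y, hy, hxy⟩ := hp _ _ (hd.isGradedIdeal_connectedPart b)
    (hd.isGradedIdeal_connectedPart a) (hne hb) (hne ha)
  obtain ⟨μ, hμ⟩ : ∃ μ : a ⟶ b, 𝒜.comp μ ≠ ⊥ := by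
    by_contra! hcon
    apply hxy
    refine connectedPart_induction (p := fun x => x * y = 0) hx (fun a₁ b₁ γ μ hμ x hx => ?_)
      (zero_mul _) fun x x' h1 h2 => by rw [add_mul, h1, h2, add_zero]
    refine connectedPart_induction (p := fun y => x * y = 0) hy (fun a₂ b₂ δ ν hν y hy => ?_)
      (mul_zero _) fun x x' h1 h2 => by rw [mul_add, h1, h2, add_zero]
    by_contra h0
    obtain rfl := right_eq_of_mul_ne_zero hx hy h0
    have hγ : 𝒜.comp γ ≠ ⊥ := fun h => h0 (by
      rw [h, AddSubgroup.mem_bot] at hx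
      rw [hx, zero_mul])
    -- A nonzero product of homogeneous elements of the two ideals yields a path in the support:
    -- `ν⁻¹` from `a`, then `γ`, then `μ` to `b`.
    exact hd.comp_comp_ne_bot (hd.comp_comp_ne_bot hμ hγ) (hd.comp_inv_ne_bot hν) (hcon _)
  obtain ⟨⟨d, hdμ⟩, hd0⟩ := AddSubgroup.ne_bot_iff_exists_ne_zero.1 hμ
  obtain ⟨d', hd', h1, h2⟩ := hd.2 μ d hdμ fun h => hd0 (Subtype.ext h)
  exact ⟨μ, d, d', hdμ, hd', h1, h2⟩

/-- A gr-division ring with support in `eΓe` is gr-prime. -/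
theorem IsGrDivision.isGrPrime (hd : 𝒜.IsGrDivision) {e : G} (hs : 𝒜.SuppIn e) :
    𝒜.IsGrPrime := by
  -- A nonzero homogeneous element of `I` has degree in `eΓe` and is invertible.
  have key : ∀ I, 𝒜.IsGradedIdeal I → I ≠ ⊥ → 𝒜.one e ∈ I := by
    intro I hI h0
    obtain ⟨a, b, γ, x, hxI, hx, hx0⟩ := exists_homogeneous_mem hI.1.1 h0
    obtain ⟨rfl, rfl⟩ := hs γ fun h => hx0 (by rwa [h, AddSubgroup.mem_bot] at hx)
    obtain ⟨y, -, h1, -⟩ := hd.2 γ x hx hx0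
    rw [← h1]
    exact hI.1.2 x hxI y
  intro I J hI hJ hI0 hJ0
  refine ⟨_, key I hI hI0, _, key J hJ hJ0, ?_⟩
  rw [one_mul_one]
  have := hd.1
  obtain ⟨c, hc⟩ := exists_one_ne_zero (𝒜 := 𝒜)
  obtain ⟨rfl, -⟩ := hs _ (comp_one_ne_bot hc)
  exact hc

end GrRing

/-! ### Matrix units in graded matrix rings. -/

section Matrix

open GrRing

variable {G : Type w} [Groupoid.{v} G] {R : Type u} [NonUnitalRing R] {𝒜 : GrRing G R}
  {I : Type*} {S : I → Set (Mor G)}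

open Classical in
/-- The matrix with the only nonzero entry `r` at the position `(i, j)`. -/
noncomputable def FinMatrix.single (i j : I) (r : R) : FinMatrix I R :=
  ⟨fun k l => if k = i ∧ l = j then r else 0, (Set.finite_singleton (i, j)).subset fun p hp => by
    by_contra h
    exact hp (if_neg fun h' => h (Prod.ext h'.1 h'.2))⟩

theorem FinMatrix.single_apply_same (i j : I) (r : R) : (FinMatrix.single i j r).1 i j = r :=
  if_pos ⟨rfl, rfl⟩

theorem FinMatrix.single_apply_of_ne {i j k l : I} (h : ¬ (k = i ∧ l = j)) (r : R) :
    (FinMatrix.single i j r).1 k l = 0 := if_neg h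

theorem FinMatrix.single_mul_apply (i j : I) (r : R) (A : FinMatrix I R) (l : I) :
    (FinMatrix.single i j r * A).1 i l = r * A.1 j l := by
  rw [FinMatrix.mul_apply, finsum_eq_single _ j, single_apply_same]
  intro k hk
  rw [single_apply_of_ne fun h => hk h.2, zero_mul]

theorem FinMatrix.single_mul_apply_of_ne {i j k : I} (hk : k ≠ i) (r : R) (A : FinMatrix I R)
    (l : I) : (FinMatrix.single i j r * A).1 k l = 0 := by
  rw [FinMatrix.mul_apply]
  simp only [single_apply_of_ne fun h => hk h.1, zero_mul, finsum_zero]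

theorem FinMatrix.mul_single_apply_of_ne {i j l : I} (hl : l ≠ j) (r : R) (A : FinMatrix I R)
    (k : I) : (A * FinMatrix.single i j r).1 k l = 0 := by
  rw [FinMatrix.mul_apply]
  simp only [single_apply_of_ne fun h => hl h.2, mul_zero, finsum_zero]

theorem FinMatrix.single_mul_single (i j k : I) (r s : R) :
    FinMatrix.single i j r * FinMatrix.single j k s = FinMatrix.single i k (r * s) := by
  refine Subtype.ext (Matrix.ext fun m l => ?_)
  by_cases hm : m = i
  · subst hm
    rw [single_mul_apply]
    by_cases hl : l = k
    · subst hl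
      rw [single_apply_same, single_apply_same]
    · rw [single_apply_of_ne fun h => hl h.2, single_apply_of_ne fun h => hl h.2, mul_zero]
  · rw [single_mul_apply_of_ne hm, single_apply_of_ne fun h => hm h.1]

theorem FinMatrix.single_mul_single_of_ne {i j j' k : I} (h : j ≠ j') (r s : R) :
    FinMatrix.single i j r * FinMatrix.single j' k s = 0 := by
  refine Subtype.ext (Matrix.ext fun m l => ?_)
  by_cases hm : m = i
  · subst hm
    rw [single_mul_apply, single_apply_of_ne fun h' => h h'.1, mul_zero]
    rfl
  · rw [single_mul_apply_of_ne hm]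
    rfl

theorem single_mem_matrixComp (hS : IsMatricial 𝒜 S) {a b c d : G} {γ : a ⟶ b} {i j : I}
    {σ : b ⟶ c} {τ : a ⟶ d} (hσ : (⟨b, c, σ⟩ : Mor G) ∈ S i) (hτ : (⟨a, d, τ⟩ : Mor G) ∈ S j)
    {r : R} (hr : r ∈ 𝒜.comp (Groupoid.inv τ ≫ γ ≫ σ)) :
    FinMatrix.single i j r ∈ matrixComp 𝒜 S γ := by
  intro k l
  by_cases h : k = i ∧ l = j
  · obtain ⟨rfl, rfl⟩ := h
    rwa [FinMatrix.single_apply_same, entryComp_eq (hS.dUnique k) (hS.dUnique l) γ σ hσ τ hτ]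
  · rw [FinMatrix.single_apply_of_ne h]
    exact zero_mem _

theorem IsMatricial.one_ne_zero (hS : IsMatricial 𝒜 S) {a b : G} {σ : a ⟶ b} {i : I}
    (hσ : (⟨a, b, σ⟩ : Mor G) ∈ S i) : 𝒜.one b ≠ 0 := by
  have h : b ∈ 𝒜.objSupport := (hS.rUnique i).1 ⟨a, b, σ⟩ hσ
  exact one_ne_zero_of_mem_objSupport h

/-- Fix `σ₀ ∈ S i₀` and let `f` be the elementary idempotent at `(i₀, i₀)`. Its corner is a shifted
copy of a corner of the gr-division ring, and homogeneous units from `r(σ₀)` to `r(σ_i)` supply the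
entries at `(i, i₀)` and `(i₀, i)`. -/
theorem hasMatrixUnits_matrixGrading (hd : 𝒜.IsGrDivision) (hp : 𝒜.IsGrPrime) [Nonempty I]
    (hS : IsMatricial 𝒜 S) : (matrixGrading hS).HasMatrixUnits := by
  obtain ⟨i₀⟩ := ‹Nonempty I›
  obtain ⟨⟨e, o, σ₀⟩, hσ₀⟩ := hS.nonempty i₀
  have ho : 𝒜.one o ≠ 0 := hS.one_ne_zero hσ₀
  refine hasMatrixUnits_familyGrading (A := matrixComp 𝒜 S) (hmul := matrixComp_mul_mem hS)
    (hzero := matrixComp_mul_eq_zero hS) (hind := iSupIndep_matrixComp hS) (one := matrixOne hS)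
    (hone := matrixOne_mem hS) (hone_mul := matrixOne_mul hS) (hmul_one := mul_matrixOne hS)
    (e := e) (f := FinMatrix.single i₀ i₀ (𝒜.one o)) ?_ ?_ ?_ ?_ ?_
  · exact single_mem_matrixComp hS hσ₀ hσ₀ (by simpa using 𝒜.one_mem o)
  · rw [FinMatrix.single_mul_single, one_mul_one]
  · intro h0
    apply ho
    rw [← FinMatrix.single_apply_same i₀ i₀ (𝒜.one o), h0]
    rfl
  · intro γ A hA hfA hAf hA0
    -- Since `A = fA = Af`, only the entry at `(i₀, i₀)` survives, and inverting `A` amounts to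
    -- inverting this entry.
    have hA1 : A = FinMatrix.single i₀ i₀ (A.1 i₀ i₀) := by
      refine Subtype.ext (Matrix.ext fun k l => ?_)
      by_cases hk : k = i₀
      · subst hk
        by_cases hl : l = k
        · subst hl
          rw [FinMatrix.single_apply_same]
        · rw [FinMatrix.single_apply_of_ne fun h => hl h.2, ← hAf,
            FinMatrix.mul_single_apply_of_ne hl]
      · rw [FinMatrix.single_apply_of_ne fun h => hk h.1, ← hfA,
          FinMatrix.single_mul_apply_of_ne hk]
    have hd1 := hA i₀ i₀
    rw [entryComp_eq (hS.dUnique i₀) (hS.dUnique i₀) γ σ₀ hσ₀ σ₀ hσ₀] at hd1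
    generalize A.1 i₀ i₀ = d at hA1 hd1
    subst hA1
    have hd0 : d ≠ 0 := by
      rintro rfl
      refine hA0 (Subtype.ext (Matrix.ext fun k l => ?_))
      by_cases h : k = i₀ ∧ l = i₀
      · obtain ⟨rfl, rfl⟩ := h
        exact FinMatrix.single_apply_same _ _ _
      · exact FinMatrix.single_apply_of_ne h _
    obtain ⟨d', hd', h1, h2⟩ := hd.2 _ d hd1 hd0
    refine ⟨FinMatrix.single i₀ i₀ d', single_mem_matrixComp hS hσ₀ hσ₀ (by simpa using hd'),
      ?_, ?_, ?_, ?_⟩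
    · rw [FinMatrix.single_mul_single, 𝒜.one_mul _ _ hd']
    · rw [FinMatrix.single_mul_single, 𝒜.mul_one _ _ hd']
    · rw [FinMatrix.single_mul_single, h1]
    · rw [FinMatrix.single_mul_single, h2]
  · intro c
    have hfin := hS.dFinite c
    have hex : ∀ i : {i | ∃ σ ∈ S i, σ.left = c}, ∃ (z : G) (σ : c ⟶ z),
        (⟨c, z, σ⟩ : Mor G) ∈ S i.1 := by
      rintro ⟨i, ⟨c', z, σ⟩, hσ, rfl⟩
      exact ⟨z, σ, hσ⟩
    choose z σ hσ using hex
    have hunit := fun i => hd.exists_unit hp ho (hS.one_ne_zero (hσ i))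
    choose μ d d' hμ hμ' h1 h2 using hunit
    have := hfin.fintype
    -- Only the finitely many `i` with an element of `S i` of domain `c` contribute to the identity
    -- at `c`. The matrix with entry `d i` has degree `σ_i⁻¹ μ_i σ₀`.
    refine ⟨{i | ∃ σ ∈ S i, σ.left = c}, this,
      fun i => σ₀ ≫ μ i ≫ Groupoid.inv (σ i), fun i => FinMatrix.single i.1 i₀ (d i),
      fun i => FinMatrix.single i₀ i.1 (d' i),
      fun i => single_mem_matrixComp hS (hσ i) hσ₀ (by simpa using hμ i),
      fun i => single_mem_matrixComp hS hσ₀ (hσ i) (by simpa using hμ' i), fun i => ?_, fun i => ?_,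
      fun i => ?_, fun i j hij => ?_, ?_⟩
    · rw [FinMatrix.single_mul_single, 𝒜.mul_one _ _ (hμ i)]
    · rw [FinMatrix.single_mul_single, 𝒜.one_mul _ _ (hμ' i)]
    · rw [FinMatrix.single_mul_single, h2]
    · exact FinMatrix.single_mul_single_of_ne (fun h => hij (Subtype.ext h)) _ _
    · simp only [FinMatrix.single_mul_single, h1]
      refine Subtype.ext (Matrix.ext fun k l => ?_)
      rw [AddSubmonoidClass.coe_finsetSum, Matrix.sum_apply]
      by_cases hkl : k = l
      · subst hkl
        by_cases hk : ∃ σ ∈ S k, σ.left = c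
        · rw [Finset.sum_eq_single_of_mem ⟨k, hk⟩ (Finset.mem_univ _),
            FinMatrix.single_apply_same, matrixOne_diag hS k _ (hσ ⟨k, hk⟩)]
          intro i _ hi
          exact FinMatrix.single_apply_of_ne (fun h => hi (Subtype.ext h.1.symm)) _
        · rw [matrixOne_diag_eq_zero hS k fun x σ hσ => hk ⟨_, hσ, rfl⟩]
          refine Finset.sum_eq_zero fun i _ => FinMatrix.single_apply_of_ne ?_ _
          rintro ⟨rfl, -⟩
          exact hk i.2
      · rw [matrixOne_off_diag hS hkl]
        exact Finset.sum_eq_zero fun i _ =>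
          FinMatrix.single_apply_of_ne (fun h => hkl (h.1.trans h.2.symm)) _

end Matrix

/-! ### Coordinates and matrix units in endomorphism rings. -/

namespace GrModule

open GrRing

variable {G : Type w} [Groupoid.{v} G] {R : Type*} [NonUnitalRing R] {𝒜 : GrRing G R}
  {V : Type u} [AddCommGroup V] {𝒱 : GrModule 𝒜 V}

theorem homogeneous_induction {p : V → Prop} (𝒱 : GrModule 𝒜 V) (x : V)
    (h : ∀ ⦃a b : G⦄ (γ : a ⟶ b), ∀ x ∈ 𝒱.comp γ, p x) (h0 : p 0)
    (hadd : ∀ x y, p x → p y → p (x + y)) : p x := by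
  have hx : x ∈ ⨆ γ : Mor G, 𝒱.comp γ.hom := by
    rw [iSup_eq_top_of_isInternal 𝒱.isInternal]
    trivial
  induction hx using AddSubgroup.iSup_induction' with
  | hp γ x hx => exact h γ.hom x hx
  | h1 => exact h0
  | hadd x y _ _ h1 h2 => exact hadd x y h1 h2

open Classical in
/-- The homogeneous component of degree `γ` of an element of a graded module. -/
noncomputable def homPart (𝒱 : GrModule 𝒜 V) ⦃a b : G⦄ (γ : a ⟶ b) : V →+ V :=
  partProj 𝒱.isInternal fun ν => ν = ⟨a, b, γ⟩

theorem homPart_of_mem {a b : G} {γ : a ⟶ b} {x : V} (hx : x ∈ 𝒱.comp γ) :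
    𝒱.homPart γ x = x := by
  classical
  exact (partProj_apply 𝒱.isInternal _ (i := (⟨a, b, γ⟩ : Mor G)) hx).trans (if_pos rfl)

theorem homPart_of_ne {a b a' b' : G} {γ : a ⟶ b} {δ : a' ⟶ b'} {x : V} (hx : x ∈ 𝒱.comp δ)
    (h : (⟨a', b', δ⟩ : Mor G) ≠ ⟨a, b, γ⟩) : 𝒱.homPart γ x = 0 := by
  classical
  exact (partProj_apply 𝒱.isInternal _ (i := (⟨a', b', δ⟩ : Mor G)) hx).trans (if_neg h)

theorem homPart_act {a b c : G} (γ : b ⟶ c) (δ : a ⟶ b) {x : V} (hx : x ∈ 𝒱.comp γ) (r : R) :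
    𝒱.homPart (δ ≫ γ) (𝒱.act x r) = 𝒱.act x (𝒜.homPart δ r) := by
  suffices h : (𝒱.homPart (δ ≫ γ)).comp (𝒱.act x) = (𝒱.act x).comp (𝒜.homPart δ) from
    DFunLike.congr_fun h r
  refine 𝒜.addHom_ext fun a' b' ε r hr => ?_
  change 𝒱.homPart (δ ≫ γ) (𝒱.act x r) = 𝒱.act x (𝒜.homPart δ r)
  by_cases hb : b = b'
  · subst hb
    have hm := 𝒱.act_mem γ ε x hx r hr
    by_cases h : (⟨a', b, ε⟩ : Mor G) = ⟨a, b, δ⟩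
    · cases h
      rw [homPart_of_mem hm, GrRing.homPart_of_mem hr]
    · rw [GrRing.homPart_of_ne hr h, map_zero]
      exact homPart_of_ne hm fun h' => h (mor_comp_left_injective h')
  · rw [𝒱.act_eq_zero γ ε hb x hx r hr, GrRing.homPart_of_ne hr, map_zero, map_zero]
    intro h
    exact hb (congrArg Quiver.Total.right h).symm

/-- This is where `VR = V` enters: it suffices to treat the degree `γ` components of products `yr`,
and for homogeneous factors a nonzero such component forces `r 1_a = r`. -/
theorem act_one {a b : G} {γ : a ⟶ b} {x : V} (hx : x ∈ 𝒱.comp γ) :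
    𝒱.act x (𝒜.one a) = x := by
  have key : ∀ y r, 𝒱.act (𝒱.homPart γ (𝒱.act y r)) (𝒜.one a) = 𝒱.homPart γ (𝒱.act y r) := by
    intro y r
    refine 𝒱.homogeneous_induction (p := fun y => 𝒱.act (𝒱.homPart γ (𝒱.act y r)) (𝒜.one a)
      = 𝒱.homPart γ (𝒱.act y r)) y (fun b' c' ε y hy => ?_) (by simp)
      fun y z h1 h2 => by simp only [map_add, AddMonoidHom.add_apply, h1, h2]
    refine 𝒜.homogeneous_induction (p := fun r => 𝒱.act (𝒱.homPart γ (𝒱.act y r)) (𝒜.one a)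
      = 𝒱.homPart γ (𝒱.act y r)) r (fun a' b'' δ r hr => ?_) (by simp)
      fun y z h1 h2 => by simp only [map_add, AddMonoidHom.add_apply, h1, h2]
    by_cases hb : b' = b''
    · subst hb
      have hm := 𝒱.act_mem ε δ y hy r hr
      by_cases h : (⟨a', c', δ ≫ ε⟩ : Mor G) = ⟨a, b, γ⟩
      · cases h
        rw [homPart_of_mem hm, ← 𝒱.act_mul, 𝒜.mul_one δ r hr]
      · rw [homPart_of_ne hm h, map_zero, AddMonoidHom.zero_apply]
    · rw [𝒱.act_eq_zero ε δ hb y hy r hr, map_zero, map_zero, AddMonoidHom.zero_apply]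
  have hx' : x ∈ AddSubgroup.closure {y | ∃ x r, y = 𝒱.act x r} := by
    rw [𝒱.unital]
    trivial
  rw [← homPart_of_mem hx]
  clear hx
  induction hx' using AddSubgroup.closure_induction with
  | mem x hx =>
    obtain ⟨y, r, rfl⟩ := hx
    exact key y r
  | zero => simp
  | add x y _ _ h1 h2 => rw [map_add, map_add, AddMonoidHom.add_apply, h1, h2]
  | neg x _ h1 => rw [map_neg, map_neg, AddMonoidHom.neg_apply, h1]

theorem proj_of_mem_part {c : G} {x : V} (hx : x ∈ 𝒱.part c) : 𝒱.proj c x = x := by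
  have h : 𝒱.part c ≤ (𝒱.proj c).eqLocus (AddMonoidHom.id V) :=
    iSup_le fun a => iSup_le fun γ x hx => 𝒱.proj_self γ hx
  exact h hx

theorem mem_part {a c : G} {γ : a ⟶ c} {x : V} (hx : x ∈ 𝒱.comp γ) : x ∈ 𝒱.part c :=
  AddSubgroup.mem_iSup_of_mem a (AddSubgroup.mem_iSup_of_mem γ hx)

theorem proj_mem_part (c : G) (x : V) : 𝒱.proj c x ∈ 𝒱.part c := by
  refine 𝒱.homogeneous_induction (p := fun x => 𝒱.proj c x ∈ 𝒱.part c) x (fun a b γ x hx => ?_)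
    (by rw [map_zero]; exact zero_mem _) fun x y h1 h2 => by rw [map_add]; exact add_mem h1 h2
  by_cases h : b = c
  · subst h
    rw [𝒱.proj_self γ hx]
    exact mem_part hx
  · rw [𝒱.proj_of_ne γ h hx]
    exact zero_mem _

/-- A finite pseudo-basis of `V(c)` that consists of nonzero elements. -/
structure IsFinBasis (𝒱 : GrModule 𝒜 V) {c : G} {J : Type*} [Fintype J] {a : J → G}
    (γ : ∀ i, a i ⟶ c) (x : J → V) : Prop where
  mem : ∀ i, x i ∈ 𝒱.comp (γ i)
  ne_zero : ∀ i, x i ≠ 0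
  span : ∀ y ∈ 𝒱.part c, ∃ r : J → R, y = ∑ i, 𝒱.act (x i) (r i)
  indep : ∀ r : J → R, (∀ i, 𝒜.one (a i) * r i = r i) → ∑ i, 𝒱.act (x i) (r i) = 0 → ∀ i, r i = 0

/-- A pseudo-basis may contain `x_i = 0` when `1_{d(γ_i)} = 0`. Such terms are dropped; a nonzero
`x_i ∈ V(c)` has degree with range `c`. -/
theorem IsPseudoBasis.exists_isFinBasis {c : G} {n : ℕ} {γ : Fin n → Mor G} {x : Fin n → V}
    (h : 𝒱.IsPseudoBasis (𝒱.part c) γ x) :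
    ∃ (J : Type) (_ : Fintype J) (a : J → G) (γ : ∀ i, a i ⟶ c) (x : J → V),
      𝒱.IsFinBasis γ x := by
  classical
  obtain ⟨hmem, hspan, hindep⟩ := h
  have hdeg : ∀ i : {i // x i ≠ 0}, ∃ (a : G) (δ : a ⟶ c), γ i.1 = ⟨a, c, δ⟩ := by
    rintro ⟨i, hi⟩
    obtain ⟨h1, h2⟩ := hmem i
    generalize γ i = ν at h2
    obtain ⟨a, b, δ⟩ := ν
    by_cases hb : b = c
    · subst hb
      exact ⟨a, δ, rfl⟩
    · refine absurd ?_ hi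
      rw [← proj_of_mem_part h1, 𝒱.proj_of_ne δ hb h2]
  choose a δ hδ using hdeg
  have hsum : ∀ r : Fin n → R, ∑ i, 𝒱.act (x i) (r i) =
      ∑ i : {i // x i ≠ 0}, 𝒱.act (x i.1) (r i.1) := by
    intro r
    rw [← Fintype.sum_subtype_add_sum_subtype (fun i => x i ≠ 0), add_eq_left]
    refine Finset.sum_eq_zero fun i _ => ?_
    rw [not_not.1 i.2, map_zero, AddMonoidHom.zero_apply]
  refine ⟨{i // x i ≠ 0}, inferInstance, a, δ, fun i => x i.1, fun i => ?_, fun i => i.2,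
    fun y hy => ?_, fun r hr h0 i => ?_⟩
  · have h1 := (hmem i.1).2
    rwa [hδ i] at h1
  · obtain ⟨s, hs⟩ := hspan y hy
    rw [Finsupp.sum_fintype _ _ fun _ => map_zero _, hsum] at hs
    exact ⟨fun i => s i.1, hs⟩
  · let A : Fin n →₀ R := Finsupp.equivFunOnFinite.symm
      fun i => if hi : x i ≠ 0 then r ⟨i, hi⟩ else 0
    have hA : ∀ i : {i // x i ≠ 0}, A i.1 = r i := fun i => dif_pos i.2
    have hA0 : A = 0 := by
      refine hindep A (fun i => ?_) ?_
      · by_cases hi : x i ≠ 0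
        · refine ⟨r ⟨i, hi⟩, ?_⟩
          rw [hA ⟨i, hi⟩, show γ i = _ from hδ ⟨i, hi⟩, hr]
        · exact ⟨0, (dif_neg hi).trans (mul_zero _).symm⟩
      · rw [Finsupp.sum_fintype _ _ fun _ => map_zero _, hsum]
        simp only [hA]
        exact h0
    rw [← hA, hA0]
    rfl

/-- Coordinate maps with respect to a pseudo-basis of `V(c)`, extended by zero to `V`. -/
structure IsCoordinates (𝒱 : GrModule 𝒜 V) {c : G} {J : Type*} [Fintype J] {a : J → G}
    (γ : ∀ i, a i ⟶ c) (x : J → V) (κ : J → V →+ R) : Prop where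
  one_mul : ∀ i v, 𝒜.one (a i) * κ i v = κ i v
  sum_act : ∀ v, ∑ i, 𝒱.act (x i) (κ i v) = 𝒱.proj c v
  map_act : ∀ i v r, κ i (𝒱.act v r) = κ i v * r
  mem : ∀ i ⦃g : G⦄ (τ : g ⟶ c), ∀ v ∈ 𝒱.comp τ, κ i v ∈ 𝒜.comp (τ ≫ Groupoid.inv (γ i))
  eq_zero : ∀ i ⦃g c' : G⦄ (τ : g ⟶ c'), c' ≠ c → ∀ v ∈ 𝒱.comp τ, κ i v = 0
  same : ∀ i, κ i (x i) = 𝒜.one (a i)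
  ne : ∀ i j, i ≠ j → κ i (x j) = 0

/-- Coefficients normalised by `r_i = 1_{a_i} r_i` are unique. Additivity, linearity, the degrees
and the duality with the `x_i` all come from comparing two normalised expansions of one vector. -/
theorem IsFinBasis.exists_isCoordinates {c : G} {J : Type*} [Fintype J] {a : J → G}
    {γ : ∀ i, a i ⟶ c} {x : J → V} (h : 𝒱.IsFinBasis γ x) :
    ∃ κ : J → V →+ R, 𝒱.IsCoordinates γ x κ := by
  classical
  have hex : ∀ v, ∃ r : J → R, (∀ i, 𝒜.one (a i) * r i = r i) ∧
      ∑ i, 𝒱.act (x i) (r i) = 𝒱.proj c v := by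
    intro v
    obtain ⟨r, hr⟩ := h.span _ (proj_mem_part c v)
    refine ⟨fun i => 𝒜.one (a i) * r i, fun i => by rw [← mul_assoc, one_mul_one], ?_⟩
    rw [hr]
    refine Finset.sum_congr rfl fun i _ => ?_
    rw [𝒱.act_mul, act_one (h.mem i)]
  have huniq : ∀ r s : J → R, (∀ i, 𝒜.one (a i) * r i = r i) →
      (∀ i, 𝒜.one (a i) * s i = s i) →
      ∑ i, 𝒱.act (x i) (r i) = ∑ i, 𝒱.act (x i) (s i) → ∀ i, r i = s i := by
    intro r s hr hs hrs i
    refine sub_eq_zero.1 (h.indep (fun i => r i - s i) (fun i => by rw [mul_sub, hr, hs]) ?_ i)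
    simp only [map_sub, Finset.sum_sub_distrib, hrs, sub_self]
  choose r hr1 hr2 using hex
  let κ : J → V →+ R := fun i => AddMonoidHom.mk' (fun v => r v i) fun v v' => by
    refine huniq (r (v + v')) (fun i => r v i + r v' i) (hr1 _)
      (fun i => by rw [mul_add, hr1, hr1]) ?_ i
    simp only [map_add, Finset.sum_add_distrib, hr2]
  refine ⟨κ, fun i v => hr1 v i, hr2, fun i v d => ?_, fun i g τ v hv => ?_,
    fun i g c' τ hc v hv => ?_, fun i => ?_, fun i j hij => ?_⟩
  · refine huniq (r (𝒱.act v d)) (fun i => r v i * d) (hr1 _)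
      (fun i => by rw [← mul_assoc, hr1]) ?_ i
    simp only [𝒱.act_mul]
    rw [hr2, 𝒱.proj_act, ← hr2, map_sum, AddMonoidHom.finsetSum_apply]
  · have h1 : ∀ i, r v i = 𝒜.homPart (τ ≫ Groupoid.inv (γ i)) (r v i) := by
      refine huniq _ _ (hr1 v) (fun i => 𝒜.one_mul _ _ (GrRing.homPart_mem _ _)) ?_
      have h2 := congrArg (𝒱.homPart τ) (hr2 v)
      rw [𝒱.proj_self τ hv, homPart_of_mem hv, map_sum] at h2
      rw [hr2, 𝒱.proj_self τ hv]
      refine h2.symm.trans (Finset.sum_congr rfl fun i _ => ?_)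
      rw [← homPart_act (γ i) _ (h.mem i)]
      simp
    change r v i ∈ _
    rw [h1 i]
    exact GrRing.homPart_mem _ _
  · refine huniq (r v) (fun _ => 0) (hr1 v) (fun _ => mul_zero _) ?_ i
    rw [hr2, 𝒱.proj_of_ne τ hc hv]
    simp
  · have h1 := huniq (r (x i)) (fun k => if k = i then 𝒜.one (a k) else 0) (hr1 _)
      (fun k => by split_ifs <;> simp [one_mul_one]) ?_ i
    · exact h1.trans (if_pos rfl)
    · rw [hr2, 𝒱.proj_self _ (h.mem i), Finset.sum_eq_single i]
      · rw [if_pos rfl, act_one (h.mem i)]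
      · intro k _ hk
        rw [if_neg hk, map_zero]
      · exact fun h' => absurd (Finset.mem_univ i) h'
  · have h1 := huniq (r (x j)) (fun k => if k = j then 𝒜.one (a k) else 0) (hr1 _)
      (fun k => by split_ifs <;> simp [one_mul_one]) ?_ i
    · exact h1.trans (if_neg hij)
    · rw [hr2, 𝒱.proj_self _ (h.mem j), Finset.sum_eq_single j]
      · rw [if_pos rfl, act_one (h.mem j)]
      · intro k _ hk
        rw [if_neg hk, map_zero]
      · exact fun h' => absurd (Finset.mem_univ j) h'

/-- The endomorphism `v ↦ w κ(v)` for an element `w` and a linear form `κ`. -/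
def rankOne (𝒱 : GrModule 𝒜 V) (w : V) (κ : V →+ R) : AddMonoid.End V := (𝒱.act w).comp κ

theorem rankOne_apply (w : V) (κ : V →+ R) (v : V) : 𝒱.rankOne w κ v = 𝒱.act w (κ v) := rfl

theorem rankOne_mul_rankOne {κ κ' : V →+ R} (hκ : ∀ v r, κ (𝒱.act v r) = κ v * r) (w w' : V) :
    𝒱.rankOne w κ * 𝒱.rankOne w' κ' = 𝒱.rankOne (𝒱.act w (κ w')) κ' := by
  ext v
  change 𝒱.act w (κ (𝒱.act w' (κ' v))) = 𝒱.act (𝒱.act w (κ w')) (κ' v)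
  rw [hκ, 𝒱.act_mul]

section Coordinates

variable {c : G} {J : Type*} [Fintype J] {a : J → G} {γ : ∀ i, a i ⟶ c} {x : J → V}
  {κ : J → V →+ R}

theorem IsCoordinates.rankOne_mem (h : 𝒱.IsCoordinates γ x κ) (i : J) {b : G} {δ : a i ⟶ b}
    {w : V} (hw : w ∈ 𝒱.comp δ) :
    𝒱.rankOne w (κ i) ∈ 𝒱.endComp (Groupoid.inv (γ i) ≫ δ) := by
  refine ⟨fun v r => ?_, fun g τ v hv => ?_, fun g c' τ hc v hv => ?_⟩
  · rw [rankOne_apply, rankOne_apply, h.map_act, 𝒱.act_mul]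
  · rw [← Category.assoc]
    exact 𝒱.act_mem _ _ w hw _ (h.mem i τ v hv)
  · rw [rankOne_apply, h.eq_zero i τ hc v hv, map_zero]

end Coordinates

/-- The idempotent `f` is the projection `x₀ κ₀` onto one basis vector. Basis vectors with different
domains are matched by homogeneous units, and the matrix units are the rank one maps `x_i d_i κ₀`
and `x₀ d_i' κ_i`. -/
theorem hasMatrixUnits_endGrading [Nontrivial V] (hd : 𝒜.IsGrDivision) (hp : 𝒜.IsGrPrime)
    (hfin : 𝒱.IsFiniteDimensional) : 𝒱.endGrading.HasMatrixUnits := by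
  have hb : ∀ c : G, ∃ (J : Type) (_ : Fintype J) (a : J → G) (γ : ∀ i, a i ⟶ c) (x : J → V)
      (κ : J → V →+ R), 𝒱.IsFinBasis γ x ∧ 𝒱.IsCoordinates γ x κ := by
    intro c
    obtain ⟨n, γ, x, hx⟩ := hfin c
    obtain ⟨J, _, a, γ, x, hx⟩ := hx.exists_isFinBasis
    obtain ⟨κ, hκ⟩ := hx.exists_isCoordinates
    exact ⟨J, _, a, γ, x, κ, hx, hκ⟩
  choose J inst a γ x κ hx hκ using hb
  have hone : ∀ c i, 𝒜.one (a c i) ≠ 0 := fun c i h0 => (hx c).ne_zero i (by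
    rw [← act_one ((hx c).mem i), h0, map_zero])
  obtain ⟨e, i₀, -⟩ : ∃ (c : G) (_ : J c), True := by
    by_contra! hcon
    obtain ⟨v, hv⟩ := exists_ne (0 : V)
    refine hv (𝒱.homogeneous_induction (p := fun v => v = 0) v (fun g c τ v hv => ?_) rfl
      fun _ _ h1 h2 => by rw [h1, h2, add_zero])
    have : IsEmpty (J c) := ⟨fun i => hcon c i⟩
    rw [← 𝒱.proj_self τ hv, ← (hκ c).sum_act, Finset.univ_eq_empty, Finset.sum_empty]
  have hm₀ := (hx e).mem i₀
  have hact₀ := (hκ e).map_act i₀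
  have hff : 𝒱.rankOne (x e i₀) (κ e i₀) * 𝒱.rankOne (x e i₀) (κ e i₀) =
      𝒱.rankOne (x e i₀) (κ e i₀) := by
    rw [rankOne_mul_rankOne hact₀, (hκ e).same, act_one hm₀]
  refine hasMatrixUnits_familyGrading (A := 𝒱.endComp) (e := e)
    (f := 𝒱.rankOne (x e i₀) (κ e i₀)) ?_ hff ?_ ?_ ?_
  · simpa using (hκ e).rankOne_mem i₀ hm₀
  · intro h0
    apply (hx e).ne_zero i₀
    have h1 := DFunLike.congr_fun h0 (x e i₀)
    rw [rankOne_apply, (hκ e).same, act_one hm₀] at h1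
    exact h1
  · intro δ z hz hfz hzf hz0
    have hzx := hz.2.1 _ _ _ hm₀
    have hdm := (hκ e).mem i₀ _ _ hzx
    -- The equality `z = fzf` shows that `z` has the form `x₀ d κ₀` with the scalar `d = κ₀(z(x₀))`.
    have hz1 : z = 𝒱.rankOne (𝒱.act (x e i₀) (κ e i₀ (z (x e i₀)))) (κ e i₀) := by
      conv_lhs => rw [← hfz, ← hzf]
      ext v
      change 𝒱.act _ (κ e i₀ (z (𝒱.act _ _))) = 𝒱.act (𝒱.act _ _) _
      rw [hz.1, hact₀, 𝒱.act_mul]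
    generalize κ e i₀ (z (x e i₀)) = d at hz1 hdm
    have hd0 : d ≠ 0 := by
      rintro rfl
      apply hz0
      rw [hz1]
      ext v
      change 𝒱.act (𝒱.act (x e i₀) 0) _ = 0
      rw [map_zero, map_zero, AddMonoidHom.zero_apply]
    obtain ⟨d', hd', h1, h2⟩ := hd.2 _ d hdm hd0
    -- Maps of this form compose by multiplying their scalars, so the inverse of `z` in the corner
    -- comes from the inverse of `d`.
    have hcomp : ∀ r s, 𝒜.one (a e i₀) * s = s →
        𝒱.rankOne (𝒱.act (x e i₀) r) (κ e i₀) * 𝒱.rankOne (𝒱.act (x e i₀) s) (κ e i₀) =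
        𝒱.rankOne (𝒱.act (x e i₀) (r * s)) (κ e i₀) := by
      intro r s hs
      rw [rankOne_mul_rankOne hact₀, hact₀, (hκ e).same, hs, 𝒱.act_mul]
    have hf1 : 𝒱.rankOne (x e i₀) (κ e i₀) =
        𝒱.rankOne (𝒱.act (x e i₀) (𝒜.one (a e i₀))) (κ e i₀) := by rw [act_one hm₀]
    have hod : 𝒜.one (a e i₀) * d = d := 𝒜.one_mul _ _ hdm
    have hod' : 𝒜.one (a e i₀) * d' = d' := 𝒜.one_mul _ _ hd'
    have hdo' : d' * 𝒜.one (a e i₀) = d' := 𝒜.mul_one _ _ hd'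
    refine ⟨𝒱.rankOne (𝒱.act (x e i₀) d') (κ e i₀), ?_, ?_, ?_, ?_, ?_⟩
    · simpa using (hκ e).rankOne_mem i₀ (𝒱.act_mem _ _ _ hm₀ _ hd')
    · rw [hf1, hcomp _ _ hod', hod']
    · rw [hf1, hcomp _ _ (one_mul_one _), hdo']
    · rw [hz1, hf1, hcomp _ _ hod', h1]
    · rw [hz1, hf1, hcomp _ _ hod, h2]
  · intro c
    have hunit := fun i => hd.exists_unit hp (hone e i₀) (hone c i)
    choose μ d d' hμ hμ' h1 h2 using hunit
    refine ⟨J c, inst c, fun i => Groupoid.inv (γ e i₀) ≫ μ i ≫ γ c i,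
      fun i => 𝒱.rankOne (𝒱.act (x c i) (d i)) (κ e i₀),
      fun i => 𝒱.rankOne (𝒱.act (x e i₀) (d' i)) (κ c i),
      fun i => (hκ e).rankOne_mem i₀ (𝒱.act_mem _ _ _ ((hx c).mem i) _ (hμ i)),
      fun i => ?_, fun i => ?_, fun i => ?_, fun i => ?_, fun i j hij => ?_, ?_⟩
    · simpa using (hκ c).rankOne_mem i (𝒱.act_mem _ _ _ hm₀ _ (hμ' i))
    · rw [rankOne_mul_rankOne hact₀, (hκ e).same, ← 𝒱.act_mul, 𝒜.mul_one _ _ (hμ i)]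
    · rw [rankOne_mul_rankOne hact₀, hact₀, (hκ e).same, 𝒜.one_mul _ _ (hμ' i)]
    · rw [rankOne_mul_rankOne ((hκ c).map_act i), (hκ c).map_act, (hκ c).same,
        𝒜.one_mul _ _ (hμ i), ← 𝒱.act_mul, h2, act_one hm₀]
    · rw [rankOne_mul_rankOne ((hκ c).map_act i), (hκ c).map_act, (hκ c).ne _ _ hij, zero_mul,
        map_zero]
      ext v
      change 𝒱.act 0 _ = 0
      rw [map_zero, AddMonoidHom.zero_apply]
    · have h3 : ∀ i, 𝒱.rankOne (𝒱.act (x c i) (d i)) (κ e i₀) *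
          𝒱.rankOne (𝒱.act (x e i₀) (d' i)) (κ c i) = 𝒱.rankOne (x c i) (κ c i) := by
        intro i
        rw [rankOne_mul_rankOne hact₀, hact₀, (hκ e).same, 𝒜.one_mul _ _ (hμ' i), ← 𝒱.act_mul,
          h1, act_one ((hx c).mem i)]
      simp only [h3]
      ext v
      rw [← (hκ c).sum_act]
      exact AddMonoidHom.finsetSum_apply _ _ _

end GrModule

end GroupoidGraded

/-! ### The main theorem. -/

theorem mainTheorem2 {G : Type w} [Groupoid.{v} G] {R : Type u} [NonUnitalRing R]
    (𝒜 : GroupoidGraded.GrRing G R) :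
    List.TFAE [
      𝒜.IsGrSimple ∧ 𝒜.IsRightArtinian,
      𝒜.IsGrSimple ∧ 𝒜.IsLeftArtinian,
      ∃ (e : G) (D : Type u) (_ : NonUnitalRing D) (𝒟 : GroupoidGraded.GrRing G D)
        (hD : 𝒟.IsGrDivision) (hs : 𝒟.SuppIn e)
        (I : Type u) (_ : Nonempty I) (σ : I → GroupoidGraded.Mor G)
        (hr : ∀ i, (σ i).right = e) (hσ : GroupoidGraded.DFinite fun i => {σ i}),
        GroupoidGraded.GrIsomorphic 𝒜
          (GroupoidGraded.matrixGrading (GroupoidGraded.isMatricial_singleton hD hs hr hσ)),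
      ∃ (D : Type u) (_ : NonUnitalRing D) (𝒟 : GroupoidGraded.GrRing G D)
        (_ : 𝒟.IsGrDivision) (_ : 𝒟.IsGrPrime)
        (I : Type u) (_ : Nonempty I) (S : I → Set (GroupoidGraded.Mor G))
        (hS : GroupoidGraded.IsMatricial 𝒟 S),
        GroupoidGraded.GrIsomorphic 𝒜 (GroupoidGraded.matrixGrading hS),
      ∃ (e : G) (D : Type u) (_ : NonUnitalRing D) (𝒟 : GroupoidGraded.GrRing G D)
        (_ : 𝒟.IsGrDivision) (_ : 𝒟.SuppIn e)
        (V : Type u) (_ : AddCommGroup V) (_ : Nontrivial V)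
        (𝒱 : GroupoidGraded.GrModule 𝒟 V) (_ : 𝒱.IsFiniteDimensional),
        GroupoidGraded.GrIsomorphic 𝒜 𝒱.endGrading,
      ∃ (D : Type u) (_ : NonUnitalRing D) (𝒟 : GroupoidGraded.GrRing G D)
        (_ : 𝒟.IsGrDivision) (_ : 𝒟.IsGrPrime)
        (V : Type u) (_ : AddCommGroup V) (_ : Nontrivial V)
        (𝒱 : GroupoidGraded.GrModule 𝒟 V) (_ : 𝒱.IsFiniteDimensional),
        GroupoidGraded.GrIsomorphic 𝒜 𝒱.endGrading] ∧
    (𝒜.IsGrSimple → (𝒜.IsRightArtinian ↔ 𝒜.IsLeftArtinian)) ∧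
    (𝒜.IsRightGrSemisimple ↔ 𝒜.IsLeftGrSemisimple) := by
  have h12 : 𝒜.IsGrSimple ∧ 𝒜.IsRightArtinian ↔ 𝒜.IsGrSimple ∧ 𝒜.IsLeftArtinian :=
    GroupoidGraded.GrRing.hasMatrixUnits_iff_right.symm.trans
      GroupoidGraded.GrRing.hasMatrixUnits_iff_left
  refine ⟨?_, fun h => ⟨fun hr => (h12.1 ⟨h, hr⟩).2, fun hl => (h12.2 ⟨h, hl⟩).2⟩,
    GroupoidGraded.GrRing.isRightGrSemisimple_iff_isLeftGrSemisimple⟩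
  -- The first two conditions both become `HasMatrixUnits`, the hub of the remaining implications.
  rw [← GroupoidGraded.GrRing.hasMatrixUnits_iff_right,
    ← GroupoidGraded.GrRing.hasMatrixUnits_iff_left]
  tfae_have 1 ↔ 2 := Iff.rfl
  tfae_have 1 → 3 := by
    intro h
    obtain ⟨e, f, I, c, γ, x, y, T, hf, hu⟩ := h.exists_global
    exact ⟨e, 𝒜.Corner f, inferInstance, _, hf.isGrDivision_corner, hf.suppIn_corner, I,
      hu.nonempty hf, hu.degrees, fun _ => rfl, hu.dFinite, hu.grIsomorphic_matrix hf⟩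
  tfae_have 3 → 4 := by
    rintro ⟨e, D, _, 𝒟, hD, hs, I, hI, σ, hr, hσ, h⟩
    exact ⟨D, _, 𝒟, hD, hD.isGrPrime hs, I, hI, _, _, h⟩
  tfae_have 4 → 1 := by
    rintro ⟨D, _, 𝒟, hD, hp, I, hI, S, hS, h⟩
    exact GroupoidGraded.HasMatrixUnits.of_grIsomorphic h
      (GroupoidGraded.hasMatrixUnits_matrixGrading hD hp hS)
  tfae_have 1 → 5 := by
    intro h
    obtain ⟨e, f, I, c, γ, x, y, T, hf, hu⟩ := h.exists_global
    exact ⟨e, 𝒜.Corner f, inferInstance, _, hf.isGrDivision_corner, hf.suppIn_corner,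
      𝒜.LeftCorner f, inferInstance,
      ⟨⟨f, GroupoidGraded.GrRing.mem_leftCorner hf.mem hf.idem hf.idem⟩, 0,
        fun h0 => hf.ne_zero (congrArg Subtype.val h0)⟩,
      _, hu.isFiniteDimensional hf, hu.grIsomorphic_end hf⟩
  tfae_have 5 → 6 := by
    rintro ⟨e, D, _, 𝒟, hD, hs, V, _, hV, 𝒱, hfin, h⟩
    exact ⟨D, _, 𝒟, hD, hD.isGrPrime hs, V, _, hV, 𝒱, hfin, h⟩
  tfae_have 6 → 1 := by
    rintro ⟨D, _, 𝒟, hD, hp, V, _, hV, 𝒱, hfin, h⟩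
    exact GroupoidGraded.HasMatrixUnits.of_grIsomorphic h
      (GroupoidGraded.GrModule.hasMatrixUnits_endGrading hD hp hfin)
  tfae_finish
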